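/- Let $R$ be an associative ring with unit and let $M$ be an $R$-bimodule with $M\otimes_R M=0$. Modules are left modules, and modules over the opposite ring are right modules. Let $R\ltimes M$ be the trivial extension, i.e. $R\oplus M$ with multiplication $(r_1,m_1)(r_2,m_2)=(r_1r_2,\,r_1m_2+m_1r_2)$. View a left $R\ltimes M$-module as a pair $(X,u)$, where $X$ is the underlying left $R$-module and $u\colon M\otimes_R X\to X$ is the $R$-homomorphism $m\otimes x\mapsto (0,m)x$. View a right $R\ltimes M$-module as a pair $[Y,v]$, where $Y$ is the underlying right $R$-module and $v\colon Y\to \operatorname{Hom}_{R^{\mathrm{op}}}(M,Y)$ is the homomorphism of right $R$-modules $y\mapsto (m\mapsto y(0,m))$. For a class $\mathsf X$ of left $R$-modules and a class $\mathsf Y$ of right $R$-modules put $$\Phi(\mathsf X)=\{(X,u) : u \text{ is a monomorphism and } \operatorname{coker}(u)\in\mathsf X\},$$ $$\Psi(\mathsf Y)=\{[Y,v] : v \text{ is an epimorphism and } \ker(v)\in\mathsf Y\}.$$ For a ring $S$, an $S$-module is Gorenstein projective if it is isomorphic to $\ker(P^0\to P^1)$ for an exact complex $P^\bullet$ (indexed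 by $\mathbb Z$) of projective $S$-modules such that $\operatorname{Hom}_S(P^\bullet,Q)$ is exact for every projective $S$-module $Q$. It is Gorenstein injective if it is isomorphic to $\ker(I^0\to I^1)$ for an exact complex $I^\bullet$ of injective $S$-modules such that $\operatorname{Hom}_S(E,I^\bullet)$ is exact for every injective $S$-module $E$. It is Gorenstein flat if it is isomorphic to $\ker(F^0\to F^1)$ for an exact complex $F^\bullet$ of flat $S$-modules such that $E\otimes_S F^\bullet$ is exact for every injective right $S$-module $E$. Write $\mathcal{GP}(S)$, $\mathcal{GI}(S)$, $\mathcal{GF}(S)$ for the corresponding classes of $S$-modules, and $\operatorname{pd}$, $\operatorname{fd}$ for projective and flat dimension. Then: 1. If $\operatorname{Tor}^R_n(M,M\otimes_R P)=0$ for every projective left $R$-module $P$ and every $n\ge 1$, $\operatorname{pd}_R M<\infty$ and $\operatorname{fd}_{R^{\mathrm{op}}}M<\infty$, then $\mathcal{GP}(R\ltimes M)=\Phi(\mathcal{GP}(R))$. 2. If $\operatorname{Tor}^R_n(M,M\otimes_R P)=0$ for every projective left $R$-module $P$ and every $n\ge 1$, $\operatorname{fd}_R M<\infty$ and $\operatorname{pd}_{R^{\mathrm{op}}}M<\infty$,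 then $\mathcal{GI}((R\ltimes M)^{\mathrm{op}})=\Psi(\mathcal{GI}(R^{\mathrm{op}}))$. 3. If $R$ is right coherent, $M$ is flat as a left $R$-module and finitely presented as a right $R$-module, and $\operatorname{pd}_{R^{\mathrm{op}}}M<\infty$, then $\mathcal{GF}(R\ltimes M)=\Phi(\mathcal{GF}(R))$. -/

import Mathlib

open CategoryTheory MulOpposite TensorProduct

universe u

noncomputable section

/-! ### Tensor products over a noncommutative ring

Right `R`-modules are modules over `Rᵐᵒᵖ`, with `m · r = op r • m`. -/

/-- The subgroup of `M ⊗[ℤ] X` generated by the elements `(m · r) ⊗ x - m ⊗ (r x)`. -/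
def balancedRel (R : Type*) [Ring R] (M : Type*) [AddCommGroup M] [Module Rᵐᵒᵖ M]
    (X : Type*) [AddCommGroup X] [Module R X] : AddSubgroup (M ⊗[ℤ] X) :=
  AddSubgroup.closure
    {t | ∃ (m : M) (r : R) (x : X), t = (op r • m) ⊗ₜ[ℤ] x - m ⊗ₜ[ℤ] (r • x)}

/-- The tensor product `M ⊗_R X` of a right `R`-module `M` and a left `R`-module `X`. -/
def RTensor (R : Type*) [Ring R] (M : Type*) [AddCommGroup M] [Module Rᵐᵒᵖ M]
    (X : Type*) [AddCommGroup X] [Module R X] : Type _ :=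
  (M ⊗[ℤ] X) ⧸ balancedRel R M X

namespace RTensor

section Basic

variable (R : Type*) [Ring R] (M : Type*) [AddCommGroup M] [Module Rᵐᵒᵖ M]
  (X : Type*) [AddCommGroup X] [Module R X]

instance : AddCommGroup (RTensor R M X) :=
  inferInstanceAs (AddCommGroup ((M ⊗[ℤ] X) ⧸ balancedRel R M X))

variable {M X}

/-- The quotient map `M ⊗[ℤ] X → M ⊗_R X`. -/
def mkHom : M ⊗[ℤ] X →+ RTensor R M X :=
  QuotientAddGroup.mk' (balancedRel R M X)

/-- The pure tensor `m ⊗ x` in `M ⊗_R X`. -/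
def tmul (m : M) (x : X) : RTensor R M X :=
  mkHom R (m ⊗ₜ[ℤ] x)

variable {R}

theorem tmul_add (m : M) (x y : X) : tmul R m (x + y) = tmul R m x + tmul R m y := by
  unfold tmul
  rw [TensorProduct.tmul_add, map_add]

theorem add_tmul (m n : M) (x : X) : tmul R (m + n) x = tmul R m x + tmul R n x := by
  unfold tmul
  rw [TensorProduct.add_tmul, map_add]

theorem zero_tmul (x : X) : tmul R (0 : M) x = 0 := by
  unfold tmul
  rw [TensorProduct.zero_tmul, map_zero]

theorem smul_tmul (r : R) (m : M) (x : X) : tmul R (op r • m) x = tmul R m (r • x) := by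
  unfold tmul
  refine (QuotientAddGroup.eq_iff_sub_mem).2 ?_
  exact AddSubgroup.subset_closure ⟨m, r, x, rfl⟩

/-- The homomorphism on `M ⊗_R X` induced by an `R`-balanced biadditive map. -/
def lift {A : Type*} [AddCommGroup A] (f : M →+ X →+ A)
    (hf : ∀ (r : R) (m : M) (x : X), f (op r • m) x = f m (r • x)) : RTensor R M X →+ A :=
  QuotientAddGroup.lift (balancedRel R M X)
    (TensorProduct.liftAddHom f (fun n m x => by simp)) (by
      rw [balancedRel, AddSubgroup.closure_le]
      rintro _ ⟨m, r, x, rfl⟩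
      simp [hf])

@[simp]
theorem lift_tmul {A : Type*} [AddCommGroup A] (f : M →+ X →+ A)
    (hf : ∀ (r : R) (m : M) (x : X), f (op r • m) x = f m (r • x)) (m : M) (x : X) :
    lift f hf (tmul R m x) = f m x := rfl

theorem hom_ext {A : Type*} [AddCommGroup A] {f g : RTensor R M X →+ A}
    (h : ∀ (m : M) (x : X), f (tmul R m x) = g (tmul R m x)) : f = g := by
  refine QuotientAddGroup.addMonoidHom_ext _ ?_
  ext t
  induction t with
  | zero => simp
  | tmul m x => exact h m x
  | add a b ha hb => rw [map_add, map_add, ha, hb]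

variable {M' : Type*} [AddCommGroup M'] [Module Rᵐᵒᵖ M']
  {X' : Type*} [AddCommGroup X'] [Module R X']

/-- The homomorphism `f ⊗ g : M ⊗_R X → M' ⊗_R X'`. -/
def map (f : M →ₗ[Rᵐᵒᵖ] M') (g : X →ₗ[R] X') : RTensor R M X →+ RTensor R M' X' :=
  lift
    (AddMonoidHom.mk' (fun m => AddMonoidHom.mk' (fun x => tmul R (f m) (g x))
        (fun x y => by rw [map_add, tmul_add]))
      (fun m n => by ext x; simp [add_tmul]))
    (fun r m x => by simp [smul_tmul])

@[simp]
theorem map_tmul (f : M →ₗ[Rᵐᵒᵖ] M') (g : X →ₗ[R] X') (m : M) (x : X) :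
    map f g (tmul R m x) = tmul R (f m) (g x) := rfl

variable (M) in
/-- The homomorphism `M ⊗ g : M ⊗_R X → M ⊗_R X'`. -/
def lTensor (g : X →ₗ[R] X') : RTensor R M X →+ RTensor R M X' :=
  map LinearMap.id g

variable (X) in
/-- The homomorphism `f ⊗ X : M ⊗_R X → M' ⊗_R X`. -/
def rTensor (f : M →ₗ[Rᵐᵒᵖ] M') : RTensor R M X →+ RTensor R M' X :=
  map f LinearMap.id

end Basic

section Bimodule

variable (R : Type*) [Ring R] (M : Type*) [AddCommGroup M] [Module R M] [Module Rᵐᵒᵖ M]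
  [SMulCommClass R Rᵐᵒᵖ M] (X : Type*) [AddCommGroup X] [Module R X]

/-- The left action of `R` on `M ⊗_R X` for an `R`-bimodule `M`, as a ring homomorphism. -/
def leftAction : R →+* AddMonoid.End (RTensor R M X) where
  toFun r := rTensor X
    { toFun := fun m => r • m
      map_add' := smul_add r
      map_smul' := fun a m => smul_comm r a m }
  map_one' := hom_ext fun m x => congrArg (fun n => tmul R n x) (one_smul R m)
  map_mul' r s := hom_ext fun m x => congrArg (fun n => tmul R n x) (mul_smul r s m)
  map_zero' := hom_ext fun m x =>
    (congrArg (fun n => tmul R n x) (zero_smul R m)).trans (zero_tmul x)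
  map_add' r s := hom_ext fun m x =>
    (congrArg (fun n => tmul R n x) (add_smul r s m)).trans (add_tmul _ _ x)

/-- For an `R`-bimodule `M`, the group `M ⊗_R X` is a left `R`-module via
`r • (m ⊗ x) = (r m) ⊗ x`. -/
instance : Module R (RTensor R M X) :=
  Module.compHom (RTensor R M X) (leftAction R M X)

variable {R M X}

theorem smul_tmul_left (r : R) (m : M) (x : X) : r • tmul R m x = tmul R (r • m) x := rfl

end Bimodule

end RTensor

/-! ### Flatness, flat dimension, coherence, Tor -/

/-- A left `R`-module `X` is flat if `- ⊗_R X` preserves injections of right `R`-modules. -/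
def IsFlatLeft (R : Type u) [Ring R] : ObjectProperty (ModuleCat.{u} R) := fun X =>
  ∀ (A B : Type u) [AddCommGroup A] [AddCommGroup B] [Module Rᵐᵒᵖ A] [Module Rᵐᵒᵖ B]
    (f : A →ₗ[Rᵐᵒᵖ] B), Function.Injective f →
      Function.Injective (RTensor.rTensor (R := R) X f)

/-- A right `R`-module `M` is flat if `M ⊗_R -` preserves injections of left `R`-modules. -/
def IsFlatRight (R : Type u) [Ring R] : ObjectProperty (ModuleCat.{u} Rᵐᵒᵖ) := fun M =>
  ∀ (A B : Type u) [AddCommGroup A] [AddCommGroup B] [Module R A] [Module R B]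
    (f : A →ₗ[R] B), Function.Injective f →
      Function.Injective (RTensor.lTensor (R := R) M f)

/-- `HasResolutionLE 𝓕 n X`: there is an exact sequence
`0 → Fₙ → ⋯ → F₁ → F₀ → X → 0` with all `Fᵢ` in `𝓕`. -/
def HasResolutionLE {S : Type u} [Ring S] (𝓕 : ObjectProperty (ModuleCat.{u} S)) :
    ℕ → ModuleCat.{u} S → Prop
  | 0, X => ∃ F : ModuleCat.{u} S, 𝓕 F ∧ Nonempty (F ≃ₗ[S] X)
  | n + 1, X => ∃ (K F : ModuleCat.{u} S) (i : K →ₗ[S] F) (p : F →ₗ[S] X),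
      Function.Injective i ∧ Function.Exact i p ∧ Function.Surjective p ∧
        𝓕 F ∧ HasResolutionLE 𝓕 n K

/-- The left `R`-module `X` has finite flat dimension. -/
def FiniteFlatDimLeft (R : Type u) [Ring R] (X : Type u) [AddCommGroup X] [Module R X] : Prop :=
  ∃ n : ℕ, HasResolutionLE (IsFlatLeft R) n (ModuleCat.of R X)

/-- The right `R`-module `M` has finite flat dimension. -/
def FiniteFlatDimRight (R : Type u) [Ring R] (M : Type u) [AddCommGroup M] [Module Rᵐᵒᵖ M] :
    Prop :=
  ∃ n : ℕ, HasResolutionLE (IsFlatRight R) n (ModuleCat.of Rᵐᵒᵖ M)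

/-- The ring `R` is right coherent: every finitely generated right ideal is finitely presented. -/
def IsRightCoherent (R : Type u) [Ring R] : Prop :=
  ∀ I : Submodule Rᵐᵒᵖ R, I.FG → Module.FinitePresentation Rᵐᵒᵖ I

/-- The functor `M ⊗_R -` from left `R`-modules to abelian groups. -/
def tensorFunctor (R : Type u) [Ring R] (M : Type u) [AddCommGroup M] [Module Rᵐᵒᵖ M] :
    ModuleCat.{u} R ⥤ AddCommGrpCat.{u} where
  obj X := AddCommGrpCat.of (RTensor R M X)
  map f := AddCommGrpCat.ofHom (RTensor.lTensor M f.hom)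
  map_id X := by
    ext1
    exact RTensor.hom_ext fun m x => rfl
  map_comp f g := by
    ext1
    exact RTensor.hom_ext fun m x => rfl

instance (R : Type u) [Ring R] (M : Type u) [AddCommGroup M] [Module Rᵐᵒᵖ M] :
    (tensorFunctor R M).Additive where
  map_add {X Y f g} := by
    ext1
    exact RTensor.hom_ext fun m x => RTensor.tmul_add m (f.hom x) (g.hom x)

/-- `Torₙ^R(M, X)`, as the `n`-th left derived functor of `M ⊗_R -` at `X`. -/
def RTor (R : Type u) [Ring R] (n : ℕ) (M : Type u) [AddCommGroup M] [Module Rᵐᵒᵖ M]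
    (X : Type u) [AddCommGroup X] [Module R X] : AddCommGrpCat.{u} :=
  ((tensorFunctor R M).leftDerived n).obj (ModuleCat.of R X)

/-! ### Gorenstein projective, injective and flat modules -/

section Gorenstein

variable {S : Type u} [Ring S]

/-- The cochain complex `(P, d)` of `S`-modules indexed by `ℤ` is a complete projective
resolution. -/
structure IsCompleteProjectiveResolution (P : ℤ → ModuleCat.{u} S)
    (d : ∀ i, P i →ₗ[S] P (i + 1)) : Prop where
  projective : ∀ i, Module.Projective S (P i)
  exact : ∀ i, Function.Exact (d i) (d (i + 1))
  hom_exact : ∀ Q : ModuleCat.{u} S, Module.Projective S Q → ∀ i,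
    Function.Exact (fun g : P (i + 1 + 1) →ₗ[S] Q => g ∘ₗ d (i + 1))
      (fun g : P (i + 1) →ₗ[S] Q => g ∘ₗ d i)

/-- The cochain complex `(I, d)` of `S`-modules indexed by `ℤ` is a complete injective
resolution. -/
structure IsCompleteInjectiveResolution (I : ℤ → ModuleCat.{u} S)
    (d : ∀ i, I i →ₗ[S] I (i + 1)) : Prop where
  injective : ∀ i, Module.Injective S (I i)
  exact : ∀ i, Function.Exact (d i) (d (i + 1))
  hom_exact : ∀ E : ModuleCat.{u} S, Module.Injective S E → ∀ i,
    Function.Exact (fun g : E →ₗ[S] I i => d i ∘ₗ g)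
      (fun g : E →ₗ[S] I (i + 1) => d (i + 1) ∘ₗ g)

/-- The cochain complex `(F, d)` of left `S`-modules indexed by `ℤ` is a complete flat
resolution. -/
structure IsCompleteFlatResolution (F : ℤ → ModuleCat.{u} S)
    (d : ∀ i, F i →ₗ[S] F (i + 1)) : Prop where
  flat : ∀ i, IsFlatLeft S (F i)
  exact : ∀ i, Function.Exact (d i) (d (i + 1))
  tensor_exact : ∀ E : ModuleCat.{u} Sᵐᵒᵖ, Module.Injective Sᵐᵒᵖ E → ∀ i,
    Function.Exact (RTensor.lTensor E (d i)) (RTensor.lTensor E (d (i + 1)))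

variable (S)

/-- The class `GP(S)` of Gorenstein projective `S`-modules. -/
def GorensteinProjective : ObjectProperty (ModuleCat.{u} S) := fun X =>
  ∃ (P : ℤ → ModuleCat.{u} S) (d : ∀ i, P i →ₗ[S] P (i + 1)),
    IsCompleteProjectiveResolution P d ∧ Nonempty (X ≃ₗ[S] LinearMap.ker (d 0))

/-- The class `GI(S)` of Gorenstein injective `S`-modules. -/
def GorensteinInjective : ObjectProperty (ModuleCat.{u} S) := fun X =>
  ∃ (I : ℤ → ModuleCat.{u} S) (d : ∀ i, I i →ₗ[S] I (i + 1)),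
    IsCompleteInjectiveResolution I d ∧ Nonempty (X ≃ₗ[S] LinearMap.ker (d 0))

/-- The class `GF(S)` of Gorenstein flat `S`-modules. -/
def GorensteinFlat : ObjectProperty (ModuleCat.{u} S) := fun X =>
  ∃ (F : ℤ → ModuleCat.{u} S) (d : ∀ i, F i →ₗ[S] F (i + 1)),
    IsCompleteFlatResolution F d ∧ Nonempty (X ≃ₗ[S] LinearMap.ker (d 0))

end Gorenstein

/-! ### The module `Hom_{Rᵒᵖ}(M, Y)` -/

/-- The group `Hom_{Rᵒᵖ}(M, Y)` of homomorphisms of right `R`-modules. It is a separate type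
because, for a bimodule `M`, it carries the right `R`-action coming from the left action of `R`
on `M`. -/
def RightHom (R : Type*) [Ring R] (M : Type*) [AddCommGroup M] [Module Rᵐᵒᵖ M]
    (Y : Type*) [AddCommGroup Y] [Module Rᵐᵒᵖ Y] : Type _ :=
  M →ₗ[Rᵐᵒᵖ] Y

namespace RightHom

variable (R : Type*) [Ring R] (M : Type*) [AddCommGroup M] [Module R M] [Module Rᵐᵒᵖ M]
  [SMulCommClass R Rᵐᵒᵖ M] (Y : Type*) [AddCommGroup Y] [Module Rᵐᵒᵖ Y]

instance : AddCommGroup (RightHom R M Y) := inferInstanceAs (AddCommGroup (M →ₗ[Rᵐᵒᵖ] Y))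

instance : FunLike (RightHom R M Y) M Y := inferInstanceAs (FunLike (M →ₗ[Rᵐᵒᵖ] Y) M Y)

instance : LinearMapClass (RightHom R M Y) Rᵐᵒᵖ M Y :=
  inferInstanceAs (LinearMapClass (M →ₗ[Rᵐᵒᵖ] Y) Rᵐᵒᵖ M Y)

/-- The right `R`-module structure `(f · r) m = f (r m)` on `Hom_{Rᵒᵖ}(M, Y)`. -/
instance : Module Rᵐᵒᵖ (RightHom R M Y) where
  smul a f :=
    { toFun := fun m => f (unop a • m)
      map_add' := fun m n => by rw [smul_add, map_add]
      map_smul' := fun b m => by rw [smul_comm, map_smul]; rfl }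
  one_smul f := DFunLike.ext _ _ fun m => congrArg f (one_smul R m)
  mul_smul a b f := DFunLike.ext _ _ fun m => congrArg f (mul_smul (unop b) (unop a) m)
  smul_zero a := DFunLike.ext _ _ fun m => rfl
  smul_add a f g := DFunLike.ext _ _ fun m => rfl
  add_smul a b f := DFunLike.ext _ _ fun m =>
    (congrArg f (add_smul (unop a) (unop b) m)).trans (map_add f _ _)
  zero_smul f := DFunLike.ext _ _ fun m => (congrArg f (zero_smul R m)).trans (map_zero f)

end RightHom

/-! ### Modules over the trivial extension `R ⋉ M` and the classes `Φ`, `Ψ` -/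

section TrivialExtension

variable (R : Type u) [Ring R] (M : Type u) [AddCommGroup M] [Module R M] [Module Rᵐᵒᵖ M]
  [SMulCommClass R Rᵐᵒᵖ M]

/-- The left `R`-module underlying a left `R ⋉ M`-module. -/
abbrev underlyingLeft (X : ModuleCat.{u} (TrivSqZeroExt R M)) : ModuleCat.{u} R :=
  (ModuleCat.restrictScalars (TrivSqZeroExt.inlHom R M)).obj X

/-- The right `R`-module underlying a right `R ⋉ M`-module. -/
abbrev underlyingRight (Y : ModuleCat.{u} (TrivSqZeroExt R M)ᵐᵒᵖ) : ModuleCat.{u} Rᵐᵒᵖ :=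
  (ModuleCat.restrictScalars (RingHom.op (TrivSqZeroExt.inlHom R M))).obj Y

/-- The map `M ⊗_R X → X`, `m ⊗ x ↦ (0, m) x`, as a homomorphism of groups. -/
def leftStructureHom (X : ModuleCat.{u} (TrivSqZeroExt R M)) :
    RTensor R M (underlyingLeft R M X) →+ underlyingLeft R M X :=
  RTensor.lift (X := underlyingLeft R M X)
    (AddMonoidHom.mk'
      (fun m => AddMonoidHom.mk' (M := underlyingLeft R M X) (G := underlyingLeft R M X)
        (fun x => ((TrivSqZeroExt.inr m : TrivSqZeroExt R M) • (x : X) : X))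
        (fun x y => smul_add (TrivSqZeroExt.inr m : TrivSqZeroExt R M) (x : X) (y : X)))
      (fun m n => by
        refine AddMonoidHom.ext fun x => ?_
        change (TrivSqZeroExt.inr (m + n) : TrivSqZeroExt R M) • (x : X) =
          (TrivSqZeroExt.inr m : TrivSqZeroExt R M) • (x : X) +
            (TrivSqZeroExt.inr n : TrivSqZeroExt R M) • (x : X)
        rw [TrivSqZeroExt.inr_add, add_smul]))
    (fun r m x => by
      change (TrivSqZeroExt.inr (op r • m) : TrivSqZeroExt R M) • (x : X) =
        (TrivSqZeroExt.inr m : TrivSqZeroExt R M) •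
          (TrivSqZeroExt.inl r : TrivSqZeroExt R M) • (x : X)
      rw [← mul_smul, TrivSqZeroExt.inr_mul_inl])

/-- The `R`-homomorphism `u : M ⊗_R X → X`, `m ⊗ x ↦ (0, m) x`, through which a left
`R ⋉ M`-module is the pair `(X, u)`. -/
def leftStructureMap (X : ModuleCat.{u} (TrivSqZeroExt R M)) :
    RTensor R M (underlyingLeft R M X) →ₗ[R] underlyingLeft R M X :=
  { toFun := leftStructureHom R M X
    map_add' := map_add _
    map_smul' := fun r t => by
      refine DFunLike.congr_fun (RTensor.hom_ext
        (f := (leftStructureHom R M X).comp (RTensor.leftAction R M (underlyingLeft R M X) r))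
        (g := (DistribSMul.toAddMonoidHom (underlyingLeft R M X) r).comp
          (leftStructureHom R M X)) fun m x => ?_) t
      change (TrivSqZeroExt.inr (r • m) : TrivSqZeroExt R M) • (x : X) =
        (TrivSqZeroExt.inl r : TrivSqZeroExt R M) •
          (TrivSqZeroExt.inr m : TrivSqZeroExt R M) • (x : X)
      rw [← mul_smul, TrivSqZeroExt.inl_mul_inr] }

theorem leftStructureMap_tmul (X : ModuleCat.{u} (TrivSqZeroExt R M)) (m : M) (x : X) :
    leftStructureMap R M X (RTensor.tmul R m (x : underlyingLeft R M X)) =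
      (TrivSqZeroExt.inr m : TrivSqZeroExt R M) • x := rfl

/-- The `Rᵒᵖ`-homomorphism `v : Y → Hom_{Rᵒᵖ}(M, Y)`, `y ↦ (m ↦ y (0, m))`, through which a right
`R ⋉ M`-module is the pair `[Y, v]`. -/
def rightStructureMap (Y : ModuleCat.{u} (TrivSqZeroExt R M)ᵐᵒᵖ) :
    underlyingRight R M Y →ₗ[Rᵐᵒᵖ] RightHom R M (underlyingRight R M Y) :=
  { toFun := fun y =>
      ({ toFun := fun m => (op (TrivSqZeroExt.inr m : TrivSqZeroExt R M) • (y : Y) : Y)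
         map_add' := fun m n => by
          rw [TrivSqZeroExt.inr_add, MulOpposite.op_add]
          exact add_smul _ _ (y : Y)
         map_smul' := fun a m => by
          change op (TrivSqZeroExt.inr (a • m) : TrivSqZeroExt R M) • (y : Y) =
            op (TrivSqZeroExt.inl (unop a) : TrivSqZeroExt R M) •
              op (TrivSqZeroExt.inr m : TrivSqZeroExt R M) • (y : Y)
          rw [← mul_smul, ← MulOpposite.op_mul, TrivSqZeroExt.inr_mul_inl, op_unop] } :
        M →ₗ[Rᵐᵒᵖ] underlyingRight R M Y)
    map_add' := fun y z => DFunLike.ext _ _ fun m =>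
      smul_add (op (TrivSqZeroExt.inr m : TrivSqZeroExt R M)) (y : Y) (z : Y)
    map_smul' := fun a y => DFunLike.ext _ _ fun m => by
      change op (TrivSqZeroExt.inr m : TrivSqZeroExt R M) •
          op (TrivSqZeroExt.inl (unop a) : TrivSqZeroExt R M) • (y : Y) =
        op (TrivSqZeroExt.inr (unop a • m) : TrivSqZeroExt R M) • (y : Y)
      rw [← mul_smul, ← MulOpposite.op_mul, TrivSqZeroExt.inl_mul_inr] }

theorem rightStructureMap_apply (Y : ModuleCat.{u} (TrivSqZeroExt R M)ᵐᵒᵖ) (y : Y) (m : M) :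
    rightStructureMap R M Y (y : underlyingRight R M Y) m =
      op (TrivSqZeroExt.inr m : TrivSqZeroExt R M) • y := rfl

variable {R}

/-- `Φ(𝒳)`: the left `R ⋉ M`-modules `(X, u)` with `u` a monomorphism and `coker u` in `𝒳`. -/
def PhiClass (𝒳 : ObjectProperty (ModuleCat.{u} R)) :
    ObjectProperty (ModuleCat.{u} (TrivSqZeroExt R M)) := fun X =>
  Function.Injective (leftStructureMap R M X) ∧
    𝒳 (ModuleCat.of R (underlyingLeft R M X ⧸ LinearMap.range (leftStructureMap R M X)))

/-- `Ψ(𝒴)`: the right `R ⋉ M`-modules `[Y, v]` with `v` an epimorphism and `ker v` in `𝒴`. -/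
def PsiClass (𝒴 : ObjectProperty (ModuleCat.{u} Rᵐᵒᵖ)) :
    ObjectProperty (ModuleCat.{u} (TrivSqZeroExt R M)ᵐᵒᵖ) := fun Y =>
  Function.Surjective (rightStructureMap R M Y) ∧
    𝒴 (ModuleCat.of Rᵐᵒᵖ (LinearMap.ker (rightStructureMap R M Y)))

end TrivialExtension

end

/-! Since `M ⊗ M = 0`, also `M ⊗ (M ⊗ X) = 0` for every left `R`-module `X`. If `u` is a
monomorphism with cokernel `C`, right exactness therefore gives `M ⊗ X ≅ M ⊗ C`. Hence the modules
in Φ are the extensions `0 → M ⊗ C → X → C → 0` whose structure map is the composite `M ⊗ X → M ⊗ C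
→ X` (`IsLeftExtension`, `phiClass_iff`). Dually `Hom(M, Hom(M, Y)) = 0`, and Ψ consists of
extensions `0 → C → Y → Hom(M, C) → 0` (`IsRightExtension`, `psiClass_iff`). Projective modules over
`R ⋉ M` are left extensions of projective `C`, and injective right modules are right extensions for
injective `C`.

Part 1 transports complete resolutions between `X` and `C`, one short exact sequence at a time. From
`C` to `X`: finite flat dimension of `M` on the right keeps the sequences of a complete resolution
exact after applying `M ⊗ -`, and finite projective dimension on the left gives `Ext¹(C, M ⊗ P) =
0`. So each embedding of `C` in a projective `P`, and each cover, yields one of `X` by the induced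
module `P ⊕ M ⊗ P` (`IsLeftExtension.exists_embedding`, `IsLeftExtension.exists_cover`). `Ext¹(X, Q)
= 0` for projective `Q` follows by filtering `Q` by modules with trivial action of `M`. From `X` to
`C`: projective modules over `R ⋉ M` have vanishing higher Tor with `M`, so dimension shifting makes
`M ⊗ X` a submodule of `M ⊗ P` and forces `u` to be injective. Passing to cokernels gives the
sequences for `C`. Their Hom-exactness is `extOneVanishes_trivialLeft_of_projective`: a projective
`R`-module with trivial action is reached, up to retracts, from induced modules with finite
resolutions by induced projectives.

Part 2 is the dual argument with coinduced modules `E ⊕ Hom(M, E)`. The hypotheses on Tor and on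
flat dimension become statements on Ext through `(M ⊗ F)⁺ ≅ Hom(M, F⁺)`, because every injective
right module is a retract of `F⁺` for some free `F`.

Part 3 is reduced to part 2 by character modules. The dual of a Gorenstein flat module is Gorenstein
injective, and the converse holds over rings for which duals of injective right modules are flat
(`gorensteinFlat_of_leftDual`). Coherence provides this for `R`; finite presentation of `M`
transfers it to `R ⋉ M` through `M ⊗ D⁺ ≅ Hom(M, D)⁺`. Dualising turns left extensions into right
extensions, so Φ for `X` corresponds to Ψ for `X⁺`.

Gorenstein modules are treated throughout as members of classes stable under one-step embeddings and
covers, and vanishing of Tor and Ext is expressed by classes stable under syzygies; complexes appear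
only when a two-sided chain is spliced. -/

/-! ### Short exact sequences of modules -/

/-- `0 → K → L → N → 0` is exact. -/
structure IsShortExact {S : Type*} [Ring S] {K L N : Type*} [AddCommGroup K] [AddCommGroup L]
    [AddCommGroup N] [Module S K] [Module S L] [Module S N]
    (i : K →ₗ[S] L) (p : L →ₗ[S] N) : Prop where
  inj : Function.Injective i
  exact : Function.Exact i p
  surj : Function.Surjective p

namespace IsShortExact

variable {S : Type*} [Ring S] {K L N : Type*} [AddCommGroup K] [AddCommGroup L]
    [AddCommGroup N] [Module S K] [Module S L] [Module S N]
    {i : K →ₗ[S] L} {p : L →ₗ[S] N}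

theorem apply_apply (h : IsShortExact i p) (k : K) : p (i k) = 0 :=
  h.exact.apply_apply_eq_zero k

theorem exists_of_eq_zero (h : IsShortExact i p) {l : L} (hl : p l = 0) : ∃ k, i k = l :=
  (h.exact l).1 hl

theorem exists_of_eq (h : IsShortExact i p) {l l' : L} (hl : p l = p l') : ∃ k, i k = l - l' :=
  h.exists_of_eq_zero (by rw [map_sub, hl, sub_self])

/-- A linear map on the middle term that kills the first term factors through the last one. -/
theorem exists_desc (h : IsShortExact i p) {B : Type*} [AddCommGroup B] [Module S B]
    (f : L →ₗ[S] B) (hf : ∀ k, f (i k) = 0) : ∃ g : N →ₗ[S] B, ∀ l, g (p l) = f l := by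
  have key : ∀ l l', p l = p l' → f l = f l' := fun l l' e => by
    obtain ⟨k, hk⟩ := h.exists_of_eq e
    rw [← sub_eq_zero, ← map_sub, ← hk, hf]
  have hs : ∀ n, p (Function.surjInv h.surj n) = n := Function.surjInv_eq h.surj
  refine ⟨{ toFun := fun n => f (Function.surjInv h.surj n), map_add' := fun a b => ?_,
            map_smul' := fun r a => ?_ }, fun l => key _ _ (hs _)⟩
  · rw [← map_add]; exact key _ _ (by rw [map_add, hs, hs, hs])
  · rw [RingHom.id_apply, ← map_smul]; exact key _ _ (by rw [map_smul, hs, hs])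

/-- A linear map to the middle term that vanishes in the last term factors through the first. -/
theorem exists_lift (h : IsShortExact i p) {B : Type*} [AddCommGroup B] [Module S B]
    (f : B →ₗ[S] L) (hf : ∀ b, p (f b) = 0) : ∃ g : B →ₗ[S] K, ∀ b, i (g b) = f b := by
  choose g hg using fun b => h.exists_of_eq_zero (hf b)
  exact ⟨{ toFun := g
           map_add' := fun a b => h.inj (by rw [map_add, hg, hg, hg, map_add])
           map_smul' := fun r a => h.inj (by
            rw [RingHom.id_apply, map_smul, hg, hg, map_smul]) }, hg⟩

theorem comp_equiv_left (h : IsShortExact i p) {K' : Type*} [AddCommGroup K'] [Module S K']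
    (e : K' ≃ₗ[S] K) : IsShortExact (i ∘ₗ e.toLinearMap) p where
  inj := h.inj.comp e.injective
  exact := fun l => (h.exact l).trans
    ⟨fun ⟨k, hk⟩ => ⟨e.symm k, by simpa using hk⟩, fun ⟨k, hk⟩ => ⟨e k, hk⟩⟩
  surj := h.surj

theorem comp_equiv_right (h : IsShortExact i p) {N' : Type*} [AddCommGroup N'] [Module S N']
    (e : N ≃ₗ[S] N') : IsShortExact i (e.toLinearMap ∘ₗ p) where
  inj := h.inj
  exact := fun l => by
    rw [← h.exact l]
    simp
  surj := e.surjective.comp h.surj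

end IsShortExact

theorem isShortExact_ker_subtype {S : Type*} [Ring S] {L N : Type*} [AddCommGroup L]
    [AddCommGroup N] [Module S L] [Module S N] (p : L →ₗ[S] N) (hp : Function.Surjective p) :
    IsShortExact (LinearMap.ker p).subtype p where
  inj := Subtype.val_injective
  exact := fun l => by simp
  surj := hp

theorem isShortExact_range_mkQ {S : Type*} [Ring S] {K L : Type*} [AddCommGroup L]
    [AddCommGroup K] [Module S L] [Module S K] (i : K →ₗ[S] L) (hi : Function.Injective i) :
    IsShortExact i (LinearMap.range i).mkQ where
  inj := hi
  exact := fun l => by simp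
  surj := Submodule.mkQ_surjective _

/-- Every module is a quotient of a projective module. -/
theorem exists_projective_presentation (S : Type u) [Ring S] (X : Type u) [AddCommGroup X]
    [Module S X] : ∃ (K P : ModuleCat.{u} S) (i : K →ₗ[S] P) (p : P →ₗ[S] X),
      IsShortExact i p ∧ Module.Projective S P := by
  have h := isShortExact_ker_subtype (Finsupp.linearCombination S (id : X → X))
    (Finsupp.linearCombination_id_surjective S X)
  exact ⟨ModuleCat.of S (LinearMap.ker (Finsupp.linearCombination S (id : X → X))),
    ModuleCat.of S (X →₀ S), (LinearMap.ker (Finsupp.linearCombination S (id : X → X))).subtype,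
    Finsupp.linearCombination S (id : X → X), h,
    inferInstanceAs (Module.Projective S (X →₀ S))⟩

/-! ### Exactness of tensor products -/

namespace RTensor

variable {R : Type*} [Ring R] {A B C : Type*} [AddCommGroup A] [Module Rᵐᵒᵖ A]
  [AddCommGroup B] [Module Rᵐᵒᵖ B] [AddCommGroup C] [Module Rᵐᵒᵖ C]
  {X Y Z : Type*} [AddCommGroup X] [Module R X] [AddCommGroup Y] [Module R Y]
  [AddCommGroup Z] [Module R Z]

@[elab_as_elim]
theorem induction_on {motive : RTensor R A X → Prop} (t : RTensor R A X) (zero : motive 0)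
    (tmul : ∀ a x, motive (RTensor.tmul R a x))
    (add : ∀ s t, motive s → motive t → motive (s + t)) : motive t := by
  obtain ⟨s, rfl⟩ := QuotientAddGroup.mk'_surjective (balancedRel R A X) t
  induction s with
  | zero => exact zero
  | tmul a x => exact tmul a x
  | add s t hs ht => exact add _ _ hs ht

theorem tmul_zero (a : A) : tmul R a (0 : X) = 0 := by
  unfold tmul
  rw [TensorProduct.tmul_zero, map_zero]

theorem tmul_sub (a : A) (x y : X) : tmul R a (x - y) = tmul R a x - tmul R a y := by
  rw [eq_sub_iff_add_eq, ← tmul_add, sub_add_cancel]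

theorem sub_tmul (a b : A) (x : X) : tmul R (a - b) x = tmul R a x - tmul R b x := by
  rw [eq_sub_iff_add_eq, ← add_tmul, sub_add_cancel]

theorem sum_tmul {ι : Type*} (s : Finset ι) (f : ι → A) (x : X) :
    tmul R (∑ i ∈ s, f i) x = ∑ i ∈ s, tmul R (f i) x :=
  map_sum (AddMonoidHom.mk' (fun a => tmul R a x) (fun a b => add_tmul a b x)) f s

@[simp]
theorem lTensor_tmul (g : X →ₗ[R] Y) (a : A) (x : X) :
    lTensor A g (tmul R a x) = tmul R a (g x) := rfl

@[simp]
theorem rTensor_tmul (f : A →ₗ[Rᵐᵒᵖ] B) (a : A) (x : X) :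
    rTensor X f (tmul R a x) = tmul R (f a) x := rfl

theorem lTensor_lTensor (f : X →ₗ[R] Y) (g : Y →ₗ[R] Z) (t : RTensor R A X) :
    lTensor A g (lTensor A f t) = lTensor A (g ∘ₗ f) t :=
  DFunLike.congr_fun (hom_ext (f := (lTensor A g).comp (lTensor A f))
    (g := lTensor A (g ∘ₗ f)) fun _ _ => rfl) t

theorem rTensor_lTensor (f : A →ₗ[Rᵐᵒᵖ] B) (g : X →ₗ[R] Y) (t : RTensor R A X) :
    rTensor Y f (lTensor A g t) = lTensor B g (rTensor X f t) :=
  DFunLike.congr_fun (hom_ext (f := (rTensor Y f).comp (lTensor A g))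
    (g := (lTensor B g).comp (rTensor X f)) fun _ _ => rfl) t

theorem lTensor_eq_zero (g : X →ₗ[R] Y) (hg : ∀ x, g x = 0) (t : RTensor R A X) :
    lTensor A g t = 0 :=
  DFunLike.congr_fun (hom_ext (f := lTensor A g) (g := 0) fun a x => by
    rw [lTensor_tmul, hg, tmul_zero]; rfl) t

theorem lTensor_eq_self (g : X →ₗ[R] X) (hg : ∀ x, g x = x) (t : RTensor R A X) :
    lTensor A g t = t :=
  DFunLike.congr_fun (hom_ext (f := lTensor A g) (g := AddMonoidHom.id _) fun a x => by
    rw [lTensor_tmul, hg]; rfl) t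

theorem lTensor_injective_of_retract (g : X →ₗ[R] Y) (s : Y →ₗ[R] X) (h : ∀ x, s (g x) = x) :
    Function.Injective (lTensor A g) :=
  Function.LeftInverse.injective (g := lTensor A s) fun t => by
    rw [lTensor_lTensor]; exact lTensor_eq_self _ h t

theorem lTensor_surjective (g : X →ₗ[R] Y) (hg : Function.Surjective g) :
    Function.Surjective (lTensor A g) := fun t => by
  induction t using RTensor.induction_on with
  | zero => exact ⟨0, map_zero _⟩
  | tmul a y => obtain ⟨x, rfl⟩ := hg y; exact ⟨tmul R a x, rfl⟩
  | add s t hs ht =>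
    obtain ⟨s, rfl⟩ := hs
    obtain ⟨t, rfl⟩ := ht
    exact ⟨s + t, map_add _ _ _⟩

theorem rTensor_surjective (f : A →ₗ[Rᵐᵒᵖ] B) (hf : Function.Surjective f) :
    Function.Surjective (rTensor X f) := fun t => by
  induction t using RTensor.induction_on with
  | zero => exact ⟨0, map_zero _⟩
  | tmul b x => obtain ⟨a, rfl⟩ := hf b; exact ⟨tmul R a x, rfl⟩
  | add s t hs ht =>
    obtain ⟨s, rfl⟩ := hs
    obtain ⟨t, rfl⟩ := ht
    exact ⟨s + t, map_add _ _ _⟩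

/-- Choosing preimages under `g` defines a map `σ` from `A ⊗ Z` to the cokernel of `A ⊗ f`; it is
well defined because two preimages differ by an element of the image of `f`. The quotient map
factors through `A ⊗ g` by `σ`, so everything killed by `A ⊗ g` lies in the image. -/
theorem lTensor_exact (f : X →ₗ[R] Y) (g : Y →ₗ[R] Z) (h : Function.Exact f g)
    (hg : Function.Surjective g) : Function.Exact (lTensor A f) (lTensor A g) := by
  intro t
  constructor
  · intro ht
    let q := QuotientAddGroup.mk' (lTensor A f).range
    have key : ∀ (a : A) (y y' : Y), g y = g y' → q (tmul R a y) = q (tmul R a y') := by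
      intro a y y' e
      obtain ⟨x, hx⟩ := (h (y - y')).1 (by rw [map_sub, e, sub_self])
      rw [← sub_eq_zero, ← map_sub, ← tmul_sub, ← hx]
      exact (QuotientAddGroup.eq_zero_iff _).2 ⟨tmul R a x, rfl⟩
    have hs : ∀ z, g (Function.surjInv hg z) = z := Function.surjInv_eq hg
    let σ : RTensor R A Z →+ RTensor R A Y ⧸ (lTensor A f).range :=
      lift (AddMonoidHom.mk' (fun a => AddMonoidHom.mk'
          (fun z => q (tmul R a (Function.surjInv hg z))) (fun z z' => by
            rw [← map_add, ← tmul_add]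
            exact key _ _ _ (by rw [map_add, hs, hs, hs])))
          (fun a b => by ext z; simp [add_tmul]))
        (fun r a z => by
          simp only [AddMonoidHom.mk'_apply, smul_tmul]
          exact key _ _ _ (by rw [map_smul, hs, hs]))
    have hσ : σ.comp (lTensor A g) = q := hom_ext fun a y => key _ _ _ (hs _)
    have := DFunLike.congr_fun hσ t
    rw [AddMonoidHom.comp_apply, ht, map_zero] at this
    exact (QuotientAddGroup.eq_zero_iff t).1 this.symm
  · rintro ⟨s, rfl⟩
    rw [lTensor_lTensor]
    exact lTensor_eq_zero _ (fun x => h.apply_apply_eq_zero x) s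

theorem rTensor_rTensor (f : A →ₗ[Rᵐᵒᵖ] B) (g : B →ₗ[Rᵐᵒᵖ] C) (t : RTensor R A X) :
    rTensor X g (rTensor X f t) = rTensor X (g ∘ₗ f) t :=
  DFunLike.congr_fun (hom_ext (f := (rTensor X g).comp (rTensor X f))
    (g := rTensor X (g ∘ₗ f)) fun _ _ => rfl) t

theorem rTensor_exact (f : A →ₗ[Rᵐᵒᵖ] B) (g : B →ₗ[Rᵐᵒᵖ] C) (h : Function.Exact f g)
    (hg : Function.Surjective g) : Function.Exact (rTensor X f) (rTensor X g) := by
  intro t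
  constructor
  · intro ht
    let q := QuotientAddGroup.mk' (rTensor X f).range
    have key : ∀ (x : X) (b b' : B), g b = g b' → q (tmul R b x) = q (tmul R b' x) := by
      intro x b b' e
      obtain ⟨a, ha⟩ := (h (b - b')).1 (by rw [map_sub, e, sub_self])
      rw [← sub_eq_zero, ← map_sub, ← sub_tmul, ← ha]
      exact (QuotientAddGroup.eq_zero_iff _).2 ⟨tmul R a x, rfl⟩
    have hs : ∀ c, g (Function.surjInv hg c) = c := Function.surjInv_eq hg
    let σ : RTensor R C X →+ RTensor R B X ⧸ (rTensor X f).range :=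
      lift (AddMonoidHom.mk' (fun c => AddMonoidHom.mk'
          (fun x => q (tmul R (Function.surjInv hg c) x)) (fun x x' => by
            rw [← map_add, ← tmul_add]))
          (fun a b => by
            ext x
            simp only [AddMonoidHom.mk'_apply, AddMonoidHom.add_apply]
            rw [← map_add, ← add_tmul]
            exact key _ _ _ (by rw [map_add, hs, hs, hs])))
        (fun r c x => by
          simp only [AddMonoidHom.mk'_apply, ← smul_tmul]
          exact key _ _ _ (by rw [map_smul, hs, hs]))
    have hσ : σ.comp (rTensor X g) = q := hom_ext fun a y => key _ _ _ (hs _)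
    have := DFunLike.congr_fun hσ t
    rw [AddMonoidHom.comp_apply, ht, map_zero] at this
    exact (QuotientAddGroup.eq_zero_iff t).1 this.symm
  · rintro ⟨s, rfl⟩
    rw [rTensor_rTensor]
    exact DFunLike.congr_fun (hom_ext (f := rTensor X (g ∘ₗ f)) (g := 0) fun a x => by
      rw [rTensor_tmul, LinearMap.comp_apply, h.apply_apply_eq_zero, zero_tmul]; rfl) s

/-- For a bimodule `A`, the map `A ⊗ g` is `R`-linear. -/
def lTensorLinear (A : Type*) [AddCommGroup A] [Module R A] [Module Rᵐᵒᵖ A]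
    [SMulCommClass R Rᵐᵒᵖ A] (g : X →ₗ[R] Y) : RTensor R A X →ₗ[R] RTensor R A Y :=
  { lTensor A g with
    map_smul' := fun r t => rTensor_lTensor (X := X)
      { toFun := fun m => r • m
        map_add' := smul_add r
        map_smul' := fun a m => smul_comm r a m } g t |>.symm }

@[simp]
theorem lTensorLinear_apply (A : Type*) [AddCommGroup A] [Module R A] [Module Rᵐᵒᵖ A]
    [SMulCommClass R Rᵐᵒᵖ A] (g : X →ₗ[R] Y) (t : RTensor R A X) :
    lTensorLinear A g t = lTensor A g t := rfl

/-- Comparison of the two ways to express the vanishing of `Tor₁`. -/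
theorem rTensor_injective_of_lTensor_injective {i : A →ₗ[Rᵐᵒᵖ] B} {p : B →ₗ[Rᵐᵒᵖ] C}
    (h : IsShortExact i p) {j : X →ₗ[R] Y} {q : Y →ₗ[R] Z} (h' : IsShortExact j q)
    (h₁ : Function.Injective (rTensor Y i)) (h₂ : Function.Injective (lTensor C j)) :
    Function.Injective (rTensor Z i) := by
  rw [injective_iff_map_eq_zero]
  intro t ht
  obtain ⟨t, rfl⟩ := lTensor_surjective q h'.surj t
  rw [rTensor_lTensor] at ht
  obtain ⟨s, hs⟩ := (lTensor_exact j q h'.exact h'.surj _).1 ht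
  have : rTensor X p s = 0 := h₂ (by
    rw [← rTensor_lTensor, hs, map_zero]
    exact (rTensor_exact i p h.exact h.surj).apply_apply_eq_zero t)
  obtain ⟨w, rfl⟩ := (rTensor_exact i p h.exact h.surj _).1 this
  rw [← rTensor_lTensor] at hs
  rw [← h₁ hs]
  exact (lTensor_exact j q h'.exact h'.surj).apply_apply_eq_zero w

/-- The companion of the previous chase with the two variables exchanged; together they express the
balance of `Tor₁(C, Z)`. -/
theorem lTensor_injective_of_rTensor_injective {i : A →ₗ[Rᵐᵒᵖ] B} {p : B →ₗ[Rᵐᵒᵖ] C}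
    (h : IsShortExact i p) {j : X →ₗ[R] Y} {q : Y →ₗ[R] Z} (h' : IsShortExact j q)
    (h₁ : Function.Injective (lTensor B j)) (h₂ : Function.Injective (rTensor Z i)) :
    Function.Injective (lTensor C j) := by
  rw [injective_iff_map_eq_zero]
  intro t ht
  obtain ⟨t, rfl⟩ := rTensor_surjective p h.surj t
  rw [← rTensor_lTensor] at ht
  obtain ⟨s, hs⟩ := (rTensor_exact i p h.exact h.surj _).1 ht
  have : lTensor A q s = 0 := h₂ (by
    rw [rTensor_lTensor, hs, map_zero]
    exact (lTensor_exact j q h'.exact h'.surj).apply_apply_eq_zero t)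
  obtain ⟨w, rfl⟩ := (lTensor_exact j q h'.exact h'.surj _).1 this
  rw [rTensor_lTensor] at hs
  rw [← h₁ hs]
  exact (rTensor_exact i p h.exact h.surj).apply_apply_eq_zero w

end RTensor

/-! ### Character modules -/

/-- The character module of a left `R`-module, a right `R`-module. -/
def LeftDual (R : Type*) [Ring R] (X : Type*) [AddCommGroup X] [Module R X] : Type _ :=
  X →+ AddCircle (1 : ℚ)

/-- The character module of a right `R`-module, a left `R`-module. -/
def RightDual (R : Type*) [Ring R] (A : Type*) [AddCommGroup A] [Module Rᵐᵒᵖ A] : Type _ :=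
  A →+ AddCircle (1 : ℚ)

theorem exists_character_ne_zero {G : Type*} [AddCommGroup G] {g : G} (hg : g ≠ 0) :
    ∃ φ : G →+ AddCircle (1 : ℚ), φ g ≠ 0 :=
  CharacterModule.exists_character_apply_ne_zero_of_ne_zero hg

theorem exists_character_extension {G H : Type*} [AddCommGroup G] [AddCommGroup H] (f : G →+ H)
    (hf : Function.Injective f) (φ : G →+ AddCircle (1 : ℚ)) :
    ∃ ψ : H →+ AddCircle (1 : ℚ), ψ.comp f = φ :=
  CharacterModule.dual_surjective_of_injective f.toIntLinearMap hf φ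

/-- `ℚ/ℤ` is an injective cogenerator of abelian groups. Injectivity of tensored maps thereby
becomes an extension problem for characters. -/
theorem injective_iff_character_extension {G H : Type*} [AddCommGroup G] [AddCommGroup H]
    (f : G →+ H) : Function.Injective f ↔
      ∀ φ : G →+ AddCircle (1 : ℚ), ∃ ψ : H →+ AddCircle (1 : ℚ), ψ.comp f = φ := by
  refine ⟨exists_character_extension f, fun h => (injective_iff_map_eq_zero f).2 fun g hg => ?_⟩
  by_contra hne
  obtain ⟨φ, hφ⟩ := exists_character_ne_zero hne
  obtain ⟨ψ, rfl⟩ := h φ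
  exact hφ (by rw [AddMonoidHom.comp_apply, hg, map_zero])

namespace LeftDual

variable (R : Type*) [Ring R] (X : Type*) [AddCommGroup X] [Module R X]

noncomputable instance : AddCommGroup (LeftDual R X) :=
  inferInstanceAs (AddCommGroup (X →+ AddCircle (1 : ℚ)))

instance : FunLike (LeftDual R X) X (AddCircle (1 : ℚ)) :=
  inferInstanceAs (FunLike (X →+ AddCircle (1 : ℚ)) X (AddCircle (1 : ℚ)))

instance : AddMonoidHomClass (LeftDual R X) X (AddCircle (1 : ℚ)) :=
  inferInstanceAs (AddMonoidHomClass (X →+ AddCircle (1 : ℚ)) X (AddCircle (1 : ℚ)))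

noncomputable instance : Module Rᵐᵒᵖ (LeftDual R X) where
  smul a φ := AddMonoidHom.comp φ (DistribSMul.toAddMonoidHom X (unop a))
  one_smul φ := DFunLike.ext _ _ fun x => congrArg φ (one_smul R x)
  mul_smul a b φ := DFunLike.ext _ _ fun x => congrArg φ (mul_smul (unop b) (unop a) x)
  smul_zero _ := DFunLike.ext _ _ fun _ => rfl
  smul_add _ _ _ := DFunLike.ext _ _ fun _ => rfl
  add_smul a b φ := DFunLike.ext _ _ fun x =>
    (congrArg φ (add_smul (unop a) (unop b) x)).trans (map_add φ _ _)
  zero_smul φ := DFunLike.ext _ _ fun x => (congrArg φ (zero_smul R x)).trans (map_zero φ)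

variable {R X}

theorem smul_apply (a : Rᵐᵒᵖ) (φ : LeftDual R X) (x : X) : (a • φ) x = φ (unop a • x) := rfl

@[simp]
theorem add_apply (φ ψ : LeftDual R X) (x : X) : (φ + ψ) x = φ x + ψ x := rfl

@[simp]
theorem zero_apply (x : X) : (0 : LeftDual R X) x = 0 := rfl

/-- The linear map of character modules induced by a linear map. -/
def map {Y : Type*} [AddCommGroup Y] [Module R Y] (f : X →ₗ[R] Y) :
    LeftDual R Y →ₗ[Rᵐᵒᵖ] LeftDual R X where
  toFun φ := AddMonoidHom.comp φ f.toAddMonoidHom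
  map_add' _ _ := rfl
  map_smul' a φ := DFunLike.ext _ _ fun x => congrArg φ (f.map_smul (unop a) x).symm

@[simp]
theorem map_apply {Y : Type*} [AddCommGroup Y] [Module R Y] (f : X →ₗ[R] Y) (φ : LeftDual R Y)
    (x : X) : map f φ x = φ (f x) := rfl

/-- Only surjectivity uses that `ℚ/ℤ` is injective; the rest is left exactness of Hom. -/
theorem map_isShortExact {Y Z : Type*} [AddCommGroup Y] [Module R Y] [AddCommGroup Z]
    [Module R Z] {i : X →ₗ[R] Y} {p : Y →ₗ[R] Z} (h : IsShortExact i p) :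
    IsShortExact (map p) (map i) where
  inj := fun φ ψ e => DFunLike.ext _ _ fun z => by
    obtain ⟨y, rfl⟩ := h.surj z
    exact DFunLike.congr_fun e y
  exact := fun φ => by
    constructor
    · intro hφ
      obtain ⟨g, hg⟩ : ∃ g : Z →+ AddCircle (1 : ℚ), ∀ y, g (p y) = φ y := by
        have h0 : ∀ x, φ (i x) = 0 := fun x => DFunLike.congr_fun hφ x
        let i' := i.toAddMonoidHom.toIntLinearMap
        let p' := p.toAddMonoidHom.toIntLinearMap
        have h' : IsShortExact i' p' := ⟨h.inj, h.exact, h.surj⟩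
        obtain ⟨g, hg⟩ := h'.exists_desc (AddMonoidHom.toIntLinearMap φ) h0
        exact ⟨g.toAddMonoidHom, hg⟩
      exact ⟨g, DFunLike.ext _ _ hg⟩
    · rintro ⟨ψ, rfl⟩
      exact DFunLike.ext _ _ fun x =>
        (congrArg ψ (h.apply_apply x)).trans (map_zero ψ)
  surj := fun φ => by
    obtain ⟨ψ, hψ⟩ := exists_character_extension i.toAddMonoidHom h.inj φ
    exact ⟨ψ, hψ⟩

end LeftDual

namespace RightDual

variable (R : Type*) [Ring R] (A : Type*) [AddCommGroup A] [Module Rᵐᵒᵖ A]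

noncomputable instance : AddCommGroup (RightDual R A) :=
  inferInstanceAs (AddCommGroup (A →+ AddCircle (1 : ℚ)))

instance : FunLike (RightDual R A) A (AddCircle (1 : ℚ)) :=
  inferInstanceAs (FunLike (A →+ AddCircle (1 : ℚ)) A (AddCircle (1 : ℚ)))

instance : AddMonoidHomClass (RightDual R A) A (AddCircle (1 : ℚ)) :=
  inferInstanceAs (AddMonoidHomClass (A →+ AddCircle (1 : ℚ)) A (AddCircle (1 : ℚ)))

noncomputable instance : Module R (RightDual R A) where
  smul r φ := AddMonoidHom.comp φ (DistribSMul.toAddMonoidHom A (op r))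
  one_smul φ := DFunLike.ext _ _ fun x => congrArg φ (one_smul Rᵐᵒᵖ x)
  mul_smul a b φ := DFunLike.ext _ _ fun x => congrArg φ (mul_smul (op b) (op a) x)
  smul_zero _ := DFunLike.ext _ _ fun _ => rfl
  smul_add _ _ _ := DFunLike.ext _ _ fun _ => rfl
  add_smul a b φ := DFunLike.ext _ _ fun x =>
    (congrArg φ (add_smul (op a) (op b) x)).trans (map_add φ _ _)
  zero_smul φ := DFunLike.ext _ _ fun x => (congrArg φ (zero_smul Rᵐᵒᵖ x)).trans (map_zero φ)

variable {R A}

theorem smul_apply (r : R) (φ : RightDual R A) (a : A) : (r • φ) a = φ (op r • a) := rfl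

@[simp]
theorem add_apply (φ ψ : RightDual R A) (a : A) : (φ + ψ) a = φ a + ψ a := rfl

@[simp]
theorem zero_apply (a : A) : (0 : RightDual R A) a = 0 := rfl

/-- The linear map of character modules induced by a linear map. -/
def map {B : Type*} [AddCommGroup B] [Module Rᵐᵒᵖ B] (f : A →ₗ[Rᵐᵒᵖ] B) :
    RightDual R B →ₗ[R] RightDual R A where
  toFun φ := AddMonoidHom.comp φ f.toAddMonoidHom
  map_add' _ _ := rfl
  map_smul' r φ := DFunLike.ext _ _ fun x => congrArg φ (f.map_smul (op r) x).symm

@[simp]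
theorem map_apply {B : Type*} [AddCommGroup B] [Module Rᵐᵒᵖ B] (f : A →ₗ[Rᵐᵒᵖ] B)
    (φ : RightDual R B) (a : A) : map f φ a = φ (f a) := rfl

theorem map_surjective {B : Type*} [AddCommGroup B] [Module Rᵐᵒᵖ B] (f : A →ₗ[Rᵐᵒᵖ] B)
    (hf : Function.Injective f) : Function.Surjective (map f) := fun φ => by
  obtain ⟨ψ, hψ⟩ := exists_character_extension f.toAddMonoidHom hf φ
  exact ⟨ψ, hψ⟩

end RightDual

namespace RTensor

variable {R : Type*} [Ring R] {A B : Type*} [AddCommGroup A] [Module Rᵐᵒᵖ A]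
  [AddCommGroup B] [Module Rᵐᵒᵖ B] {X Y : Type*} [AddCommGroup X] [Module R X]
  [AddCommGroup Y] [Module R Y]

/-- A character of `A ⊗_R X` as a linear map from `A` to the character module of `X`. -/
noncomputable def toLeftDual (φ : RTensor R A X →+ AddCircle (1 : ℚ)) : A →ₗ[Rᵐᵒᵖ] LeftDual R X where
  toFun a := AddMonoidHom.mk' (fun x => φ (tmul R a x)) fun x y => by rw [tmul_add, map_add]
  map_add' a b := DFunLike.ext _ _ fun x =>
    (congrArg φ (add_tmul a b x)).trans (map_add φ _ _)
  map_smul' r a := DFunLike.ext _ _ fun x => congrArg φ (smul_tmul (unop r) a x)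

@[simp]
theorem toLeftDual_apply (φ : RTensor R A X →+ AddCircle (1 : ℚ)) (a : A) (x : X) :
    toLeftDual φ a x = φ (tmul R a x) := rfl

/-- The character of `A ⊗_R X` given by a linear map from `A` to the character module of `X`. -/
noncomputable def ofLeftDual (f : A →ₗ[Rᵐᵒᵖ] LeftDual R X) : RTensor R A X →+ AddCircle (1 : ℚ) :=
  lift (AddMonoidHom.mk' (fun a => (f a : X →+ AddCircle (1 : ℚ))) (map_add f))
    (fun r a x => DFunLike.congr_fun (f.map_smul (op r) a) x)

@[simp]
theorem ofLeftDual_tmul (f : A →ₗ[Rᵐᵒᵖ] LeftDual R X) (a : A) (x : X) :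
    ofLeftDual f (tmul R a x) = f a x := rfl

/-- A character of `A ⊗_R X` as a linear map from `X` to the character module of `A`. -/
noncomputable def toRightDual (φ : RTensor R A X →+ AddCircle (1 : ℚ)) : X →ₗ[R] RightDual R A where
  toFun x := AddMonoidHom.mk' (fun a => φ (tmul R a x)) fun a b => by rw [add_tmul, map_add]
  map_add' x y := DFunLike.ext _ _ fun a =>
    (congrArg φ (tmul_add a x y)).trans (map_add φ _ _)
  map_smul' r x := DFunLike.ext _ _ fun a => (congrArg φ (smul_tmul r a x)).symm

@[simp]
theorem toRightDual_apply (φ : RTensor R A X →+ AddCircle (1 : ℚ)) (a : A) (x : X) :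
    toRightDual φ x a = φ (tmul R a x) := rfl

/-- The character of `A ⊗_R X` given by a linear map from `X` to the character module of `A`. -/
noncomputable def ofRightDual (f : X →ₗ[R] RightDual R A) : RTensor R A X →+ AddCircle (1 : ℚ) :=
  lift (AddMonoidHom.flip (AddMonoidHom.mk' (fun x => (f x : A →+ AddCircle (1 : ℚ)))
    (map_add f))) (fun r a x => (DFunLike.congr_fun (f.map_smul r x) a).symm)

@[simp]
theorem ofRightDual_tmul (f : X →ₗ[R] RightDual R A) (a : A) (x : X) :
    ofRightDual f (tmul R a x) = f x a := rfl

/-- The adjunction `(A ⊗ X)⁺ = Hom(A, X⁺)` combined with the character criterion for injectivity.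
The two variants below use the adjunction on the other side, or vary the other factor. -/
theorem rTensor_injective_iff (i : A →ₗ[Rᵐᵒᵖ] B) : Function.Injective (rTensor X i) ↔
    ∀ f : A →ₗ[Rᵐᵒᵖ] LeftDual R X, ∃ g : B →ₗ[Rᵐᵒᵖ] LeftDual R X, ∀ a, g (i a) = f a := by
  rw [injective_iff_character_extension]
  constructor
  · intro h f
    obtain ⟨ψ, hψ⟩ := h (ofLeftDual f)
    exact ⟨toLeftDual ψ, fun a => DFunLike.ext _ _ fun x => DFunLike.congr_fun hψ (tmul R a x)⟩
  · intro h φ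
    obtain ⟨g, hg⟩ := h (toLeftDual φ)
    exact ⟨ofLeftDual g, hom_ext fun a x => DFunLike.congr_fun (hg a) x⟩

theorem rTensor_injective_iff_of_right (i : A →ₗ[Rᵐᵒᵖ] B) :
    Function.Injective (rTensor X i) ↔
      ∀ f : X →ₗ[R] RightDual R A, ∃ g : X →ₗ[R] RightDual R B,
        ∀ x, RightDual.map i (g x) = f x := by
  rw [injective_iff_character_extension]
  constructor
  · intro h f
    obtain ⟨ψ, hψ⟩ := h (ofRightDual f)
    exact ⟨toRightDual ψ, fun x => DFunLike.ext _ _ fun a => DFunLike.congr_fun hψ (tmul R a x)⟩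
  · intro h φ
    obtain ⟨g, hg⟩ := h (toRightDual φ)
    exact ⟨ofRightDual g, hom_ext fun a x => DFunLike.congr_fun (hg x) a⟩

theorem lTensor_injective_iff_of_left (i : X →ₗ[R] Y) :
    Function.Injective (lTensor A i) ↔
      ∀ f : A →ₗ[Rᵐᵒᵖ] LeftDual R X, ∃ g : A →ₗ[Rᵐᵒᵖ] LeftDual R Y,
        ∀ a, LeftDual.map i (g a) = f a := by
  rw [injective_iff_character_extension]
  constructor
  · intro h f
    obtain ⟨ψ, hψ⟩ := h (ofLeftDual f)
    exact ⟨toLeftDual ψ, fun a => DFunLike.ext _ _ fun x => DFunLike.congr_fun hψ (tmul R a x)⟩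
  · intro h φ
    obtain ⟨g, hg⟩ := h (toLeftDual φ)
    exact ⟨ofLeftDual g, hom_ext fun a x => DFunLike.congr_fun (hg a) x⟩

end RTensor

/-! ### Flat modules -/

section Flat

variable {R : Type u} [Ring R]

/-- By adjunction flatness asks for lifts along the dual map `B⁺ → A⁺`, which is surjective for
injective `A → B`. -/
theorem isFlatLeft_of_projective (X : ModuleCat.{u} R) (h : Module.Projective R X) :
    IsFlatLeft R X := by
  intro A B _ _ _ _ f hf
  rw [RTensor.rTensor_injective_iff_of_right]
  intro g
  obtain ⟨g', hg'⟩ := Module.projective_lifting_property (RightDual.map f) g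
    (RightDual.map_surjective f hf)
  exact ⟨g', fun x => DFunLike.congr_fun hg' x⟩

theorem isFlatRight_of_projective (A : ModuleCat.{u} Rᵐᵒᵖ) (h : Module.Projective Rᵐᵒᵖ A) :
    IsFlatRight R A := by
  intro X Y _ _ _ _ f hf
  rw [RTensor.lTensor_injective_iff_of_left]
  intro g
  obtain ⟨g', hg'⟩ := Module.projective_lifting_property (LeftDual.map f) g
    (LeftDual.map_isShortExact (isShortExact_range_mkQ f hf)).surj
  exact ⟨g', fun x => DFunLike.congr_fun hg' x⟩

/-- Lambek's criterion. This is the bridge between the flat and the injective theory. -/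
theorem isFlatLeft_iff_injective_leftDual (X : ModuleCat.{u} R) :
    IsFlatLeft R X ↔ Module.Injective Rᵐᵒᵖ (LeftDual R X) := by
  constructor
  · intro h
    exact ⟨fun A B _ _ _ _ i hi f => (RTensor.rTensor_injective_iff i).1 (h A B i hi) f⟩
  · intro h A B _ _ _ _ i hi
    exact (RTensor.rTensor_injective_iff i).2 fun f => h.out i hi f

end Flat

/-! ### Vanishing of `Ext¹` -/

/-- Every extension of `A` by `B` splits, i.e. `Ext¹(A, B) = 0`, expressed by the extension of
linear maps to `B` along short exact sequences `0 → K → L → A → 0`. -/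
def ExtOneVanishes (S : Type u) [Ring S] (A B : Type u) [AddCommGroup A] [Module S A]
    [AddCommGroup B] [Module S B] : Prop :=
  ∀ (K L : Type u) [AddCommGroup K] [Module S K] [AddCommGroup L] [Module S L]
    (i : K →ₗ[S] L) (p : L →ₗ[S] A), IsShortExact i p →
      ∀ f : K →ₗ[S] B, ∃ g : L →ₗ[S] B, ∀ k, g (i k) = f k

namespace ExtOneVanishes

variable {S : Type u} [Ring S] {A A' A'' B B' B'' : Type u}
  [AddCommGroup A] [Module S A] [AddCommGroup A'] [Module S A'] [AddCommGroup A''] [Module S A'']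
  [AddCommGroup B] [Module S B] [AddCommGroup B'] [Module S B'] [AddCommGroup B''] [Module S B'']

/-- Every extension of `A` is a pushout of a projective presentation, so extending maps along one
presentation suffices. -/
theorem of_projective_presentation {K P : Type u} [AddCommGroup K] [Module S K] [AddCommGroup P]
    [Module S P] {i : K →ₗ[S] P} {p : P →ₗ[S] A} (h : IsShortExact i p)
    (hP : Module.Projective S P)
    (hf : ∀ f : K →ₗ[S] B, ∃ g : P →ₗ[S] B, ∀ k, g (i k) = f k) : ExtOneVanishes S A B := by
  intro K' L _ _ _ _ i' p' h' f
  obtain ⟨s, hs⟩ := Module.projective_lifting_property p' p h'.surj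
  have hs : ∀ x, p' (s x) = p x := fun x => DFunLike.congr_fun hs x
  obtain ⟨t, ht⟩ := h'.exists_lift (s ∘ₗ i) (fun k => by
    rw [LinearMap.comp_apply, hs, h.apply_apply])
  obtain ⟨g, hg⟩ := hf (f ∘ₗ t)
  -- `L` is the quotient of `K' × P` by the pairs `(-t k, i k)`. The map given by `f` and `g`
  -- vanishes on these pairs and descends to `L`.
  have hq : Function.Surjective (i'.coprod s) := fun l => by
    obtain ⟨x, hx⟩ := h.surj (p' l)
    obtain ⟨k, hk⟩ := h'.exists_of_eq (l := l) (l' := s x) (by rw [hs, hx])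
    exact ⟨(k, x), by rw [LinearMap.coprod_apply, hk, sub_add_cancel]⟩
  obtain ⟨e, he⟩ := (isShortExact_ker_subtype _ hq).exists_desc (f.coprod g) (by
    rintro ⟨⟨k', x⟩, hx⟩
    rw [LinearMap.mem_ker, LinearMap.coprod_apply] at hx
    have hx' := congrArg p' hx
    rw [map_add, h'.apply_apply, hs, zero_add, map_zero] at hx'
    obtain ⟨k, rfl⟩ := h.exists_of_eq_zero hx'
    have hk : k' = -t k := h'.inj (by
      rw [map_neg, ht, LinearMap.comp_apply]; exact eq_neg_of_add_eq_zero_left hx)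
    simp [hg, hk])
  refine ⟨e, fun k => ?_⟩
  have := he (k, 0)
  simpa using this

/-- Injectivity of `I` extends `f` to `L` with values in `I`. The obstruction to landing in `B` is a
map `A → N`; subtracting a lift of it to `I` removes the obstruction without changing the values on
`K`. -/
theorem of_injective_presentation {I N : Type u} [AddCommGroup I] [Module S I] [AddCommGroup N]
    [Module S N] {i : B →ₗ[S] I} {p : I →ₗ[S] N} (h : IsShortExact i p)
    (hI : Module.Injective S I)
    (hf : ∀ f : A →ₗ[S] N, ∃ g : A →ₗ[S] I, ∀ a, p (g a) = f a) : ExtOneVanishes S A B := by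
  intro K L _ _ _ _ i' p' h' f
  obtain ⟨g, hg⟩ := hI.out i' h'.inj (i ∘ₗ f)
  obtain ⟨t, ht⟩ := h'.exists_desc (p ∘ₗ g) (fun k => by
    rw [LinearMap.comp_apply, hg, LinearMap.comp_apply, h.apply_apply])
  obtain ⟨t', ht'⟩ := hf t
  obtain ⟨e, he⟩ := h.exists_lift (g - t' ∘ₗ p') (fun l => by
    rw [LinearMap.sub_apply, map_sub, LinearMap.comp_apply, ht', ht, LinearMap.comp_apply,
      sub_self])
  exact ⟨e, fun k => h.inj (by simp [he, hg, h'.apply_apply])⟩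

theorem of_projective (h : Module.Projective S A) : ExtOneVanishes S A B := by
  intro K L _ _ _ _ i p hip f
  obtain ⟨s, hs⟩ := Module.projective_lifting_property p LinearMap.id hip.surj
  have hs : ∀ a, p (s a) = a := fun a => DFunLike.congr_fun hs a
  obtain ⟨e, he⟩ := hip.exists_lift (LinearMap.id - s ∘ₗ p) (fun l => by simp [hs])
  exact ⟨f ∘ₗ e, fun k => congrArg f (hip.inj (by simp [he, hip.apply_apply]))⟩

theorem of_injective (h : Module.Injective S B) : ExtOneVanishes S A B :=
  fun _ _ _ _ _ _ i _ hip f => h.out i hip.inj f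

/-- Linear maps from `A` lift along a surjection with kernel `B`. -/
theorem exists_lift (h : ExtOneVanishes S A B) {Q N : Type u} [AddCommGroup Q] [Module S Q]
    [AddCommGroup N] [Module S N] {j : B →ₗ[S] Q} {q : Q →ₗ[S] N} (hjq : IsShortExact j q)
    (f : A →ₗ[S] N) : ∃ g : A →ₗ[S] Q, ∀ a, q (g a) = f a := by
  -- The pullback of `q` and `f`, an extension of `A` by `B`. A retraction `r` onto `B` corrects the
  -- projection to `Q` so that it descends to `A`.
  let L := LinearMap.ker (q.coprod (-f))
  have hL : ∀ x : L, q x.1.1 = f x.1.2 := fun x => by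
    have := x.2
    rw [LinearMap.mem_ker, LinearMap.coprod_apply, LinearMap.neg_apply] at this
    exact eq_of_sub_eq_zero (by rwa [sub_eq_add_neg])
  let i : B →ₗ[S] L := LinearMap.codRestrict L (LinearMap.inl S Q A ∘ₗ j) (fun b => by
    simp [L, hjq.apply_apply])
  let p : L →ₗ[S] A := LinearMap.snd S Q A ∘ₗ L.subtype
  have hip : IsShortExact i p := by
    refine ⟨fun b b' e => hjq.inj (congrArg (fun x : L => x.1.1) e), fun x => ?_, fun a => ?_⟩
    · constructor
      · intro hx
        have hx : x.1.2 = 0 := hx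
        obtain ⟨b, hb⟩ := hjq.exists_of_eq_zero (l := x.1.1) (by rw [hL, hx, map_zero])
        exact ⟨b, Subtype.ext (Prod.ext hb hx.symm)⟩
      · rintro ⟨b, rfl⟩
        rfl
    · obtain ⟨x, hx⟩ := hjq.surj (f a)
      exact ⟨⟨(x, a), by simp [L, hx]⟩, rfl⟩
  obtain ⟨r, hr⟩ := h _ _ i p hip LinearMap.id
  obtain ⟨g, hg⟩ := hip.exists_desc (LinearMap.fst S Q A ∘ₗ L.subtype - j ∘ₗ r) (fun b => by
    have : r (i b) = b := hr b
    simp only [LinearMap.sub_apply, LinearMap.comp_apply, this]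
    exact sub_self _)
  refine ⟨g, fun a => ?_⟩
  obtain ⟨x, rfl⟩ := hip.surj a
  rw [hg]
  simp only [LinearMap.sub_apply, LinearMap.comp_apply, map_sub, hjq.apply_apply, sub_zero]
  exact hL x

theorem retract_right (h : ExtOneVanishes S A B) (s : B' →ₗ[S] B) (r : B →ₗ[S] B')
    (hrs : ∀ b, r (s b) = b) : ExtOneVanishes S A B' := by
  intro K L _ _ _ _ i p hip f
  obtain ⟨g, hg⟩ := h K L i p hip (s ∘ₗ f)
  exact ⟨r ∘ₗ g, fun k => by simp [hg, hrs]⟩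

theorem retract_left (h : ExtOneVanishes S A B) (s : A' →ₗ[S] A) (r : A →ₗ[S] A')
    (hrs : ∀ b, r (s b) = b) : ExtOneVanishes S A' B := by
  obtain ⟨K, P, i, p, hip, hP⟩ := exists_projective_presentation S A'
  refine of_projective_presentation hip hP fun f => ?_
  -- Pulling the presentation of `A'` back along `r` gives an extension of `A`, to which the
  -- hypothesis applies. The map `x ↦ (x, s (p x))` brings the result back to `P`.
  let L := LinearMap.ker (p.coprod (-r))
  have hL : ∀ x : L, p x.1.1 = r x.1.2 := fun x => by
    have := x.2
    rw [LinearMap.mem_ker, LinearMap.coprod_apply, LinearMap.neg_apply] at this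
    exact eq_of_sub_eq_zero (by rwa [sub_eq_add_neg])
  let i' : K →ₗ[S] L := LinearMap.codRestrict L (LinearMap.inl S P A ∘ₗ i) (fun b => by
    simp [L, hip.apply_apply])
  let p' : L →ₗ[S] A := LinearMap.snd S P A ∘ₗ L.subtype
  have hip' : IsShortExact i' p' := by
    refine ⟨fun b b' e => hip.inj (congrArg (fun x : L => x.1.1) e), fun x => ?_, fun a => ?_⟩
    · constructor
      · intro hx
        have hx : x.1.2 = 0 := hx
        obtain ⟨b, hb⟩ := hip.exists_of_eq_zero (l := x.1.1) (by rw [hL, hx, map_zero])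
        exact ⟨b, Subtype.ext (Prod.ext hb hx.symm)⟩
      · rintro ⟨b, rfl⟩
        rfl
    · obtain ⟨x, hx⟩ := hip.surj (r a)
      exact ⟨⟨(x, a), by simp [L, hx]⟩, rfl⟩
  obtain ⟨g, hg⟩ := h _ _ i' p' hip' f
  let c : P →ₗ[S] L := LinearMap.codRestrict L (LinearMap.prod LinearMap.id (s ∘ₗ p)) (fun x => by
    simp [L, hrs])
  refine ⟨g ∘ₗ c, fun k => ?_⟩
  rw [← hg]
  refine congrArg g (Subtype.ext (Prod.ext rfl ?_))
  change s (p (i k)) = 0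
  rw [hip.apply_apply, map_zero]

theorem congr_left (h : ExtOneVanishes S A B) (e : A ≃ₗ[S] A') : ExtOneVanishes S A' B :=
  h.retract_left e.symm.toLinearMap e.toLinearMap (by simp)

theorem congr_right (h : ExtOneVanishes S A B) (e : B ≃ₗ[S] B') : ExtOneVanishes S A B' :=
  h.retract_right e.symm.toLinearMap e.toLinearMap (by simp)

theorem extension_right {j : B' →ₗ[S] B} {q : B →ₗ[S] B''} (hjq : IsShortExact j q)
    (h' : ExtOneVanishes S A B') (h'' : ExtOneVanishes S A B'') : ExtOneVanishes S A B := by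
  obtain ⟨K, P, i, p, hip, hP⟩ := exists_projective_presentation S A
  refine of_projective_presentation hip hP fun f => ?_
  obtain ⟨g, hg⟩ := h'' _ _ i p hip (q ∘ₗ f)
  obtain ⟨g', hg'⟩ := Module.projective_lifting_property q g hjq.surj
  have hg' : ∀ x, q (g' x) = g x := fun x => DFunLike.congr_fun hg' x
  obtain ⟨f', hf'⟩ := hjq.exists_lift (f - g' ∘ₗ i) (fun k => by simp [hg', hg])
  obtain ⟨e, he⟩ := h' _ _ i p hip f'
  exact ⟨j ∘ₗ e + g', fun k => by simp [he, hf']⟩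

/-- The map is extended in two stages: first to the preimage `L'` of `A'` in `L`, an extension of
`A'`, and then from `L'` to `L`, whose quotient is `A''`. -/
theorem extension_left {j : A' →ₗ[S] A} {q : A →ₗ[S] A''} (hjq : IsShortExact j q)
    (h' : ExtOneVanishes S A' B) (h'' : ExtOneVanishes S A'' B) : ExtOneVanishes S A B := by
  intro K L _ _ _ _ i p hip f
  let L' := LinearMap.ker (q ∘ₗ p)
  have hL : IsShortExact L'.subtype (q ∘ₗ p) :=
    isShortExact_ker_subtype _ (hjq.surj.comp hip.surj)
  obtain ⟨p', hp'⟩ := hjq.exists_lift (p ∘ₗ L'.subtype) (fun x => x.2)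
  have hp' : ∀ x : L', j (p' x) = p x := hp'
  let i' : K →ₗ[S] L' := LinearMap.codRestrict L' i (fun k => by simp [L', hip.apply_apply])
  have hip' : IsShortExact i' p' := by
    refine ⟨fun b b' e => hip.inj (congrArg Subtype.val e), fun x => ?_, fun a => ?_⟩
    · constructor
      · intro hx
        obtain ⟨k, hk⟩ := hip.exists_of_eq_zero (l := x.1) (by rw [← hp', hx, map_zero])
        exact ⟨k, Subtype.ext hk⟩
      · rintro ⟨b, rfl⟩
        exact hjq.inj (by rw [hp', map_zero]; exact hip.apply_apply b)
    · obtain ⟨x, hx⟩ := hip.surj (j a)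
      exact ⟨⟨x, by simp [L', hx, hjq.apply_apply]⟩, hjq.inj (by rw [hp', hx])⟩
  obtain ⟨g', hg'⟩ := h' _ _ i' p' hip' f
  obtain ⟨g, hg⟩ := h'' _ _ _ _ hL g'
  exact ⟨g, fun k => (hg (i' k)).trans (hg' k)⟩

end ExtOneVanishes

/-! ### Vanishing of all higher `Tor` groups -/

/-- `Torₙ(A, X) = 0` for all `n ≥ 1`, expressed by the syzygies of `X`. -/
def TorAcyclic (R : Type u) [Ring R] (A X : Type u) [AddCommGroup A] [Module Rᵐᵒᵖ A]
    [AddCommGroup X] [Module R X] : Prop :=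
  ∃ 𝒲 : ModuleCat.{u} R → Prop, 𝒲 (ModuleCat.of R X) ∧ ∀ W, 𝒲 W →
    ∃ (K P : ModuleCat.{u} R) (i : K →ₗ[R] P) (p : P →ₗ[R] W), IsShortExact i p ∧
      Module.Projective R P ∧ Function.Injective (RTensor.lTensor A i) ∧ 𝒲 K

namespace TorAcyclic

variable {R : Type u} [Ring R] {A B C : Type u} [AddCommGroup A] [Module Rᵐᵒᵖ A]
  [AddCommGroup B] [Module Rᵐᵒᵖ B] [AddCommGroup C] [Module Rᵐᵒᵖ C]
  {X Y Z : Type u} [AddCommGroup X] [Module R X] [AddCommGroup Y] [Module R Y]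
  [AddCommGroup Z] [Module R Z]

theorem rTensor_injective (h : TorAcyclic R C X) {i : A →ₗ[Rᵐᵒᵖ] B} {p : B →ₗ[Rᵐᵒᵖ] C}
    (hip : IsShortExact i p) : Function.Injective (RTensor.rTensor X i) := by
  obtain ⟨𝒲, hX, h𝒲⟩ := h
  obtain ⟨K, P, j, q, hjq, hP, hj, -⟩ := h𝒲 _ hX
  exact RTensor.rTensor_injective_of_lTensor_injective hip hjq
    (isFlatLeft_of_projective P hP _ _ i hip.inj) hj

/-- Dimension shifting in the first variable with the same class `𝒲`: the composite `A ⊗ K → B ⊗ K →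
B ⊗ P` is injective, the first map by `Tor₁(C, K) = 0` and the second by flatness of `B`, and it
factors through `A ⊗ K → A ⊗ P`. -/
theorem syzygy_left (h : TorAcyclic R C X) {i : A →ₗ[Rᵐᵒᵖ] B} {p : B →ₗ[Rᵐᵒᵖ] C}
    (hip : IsShortExact i p) (hB : IsFlatRight R (ModuleCat.of Rᵐᵒᵖ B)) : TorAcyclic R A X := by
  obtain ⟨𝒲, hX, h𝒲⟩ := h
  refine ⟨𝒲, hX, fun W hW => ?_⟩
  obtain ⟨K, P, j, q, hjq, hP, hj, hK⟩ := h𝒲 W hW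
  refine ⟨K, P, j, q, hjq, hP, ?_, hK⟩
  have h₁ : Function.Injective (RTensor.rTensor K i) := rTensor_injective ⟨𝒲, hK, h𝒲⟩ hip
  have h₂ : Function.Injective (RTensor.lTensor B j) := hB _ _ j hjq.inj
  refine Function.Injective.of_comp (f := RTensor.rTensor P i) fun s t hst => h₁ (h₂ ?_)
  rw [← RTensor.rTensor_lTensor, ← RTensor.rTensor_lTensor]
  exact hst

/-- The vanishing of `Tor` can be tested on the syzygies of the first variable. -/
theorem of_left (𝒱 : ModuleCat.{u} Rᵐᵒᵖ → Prop)
    (h𝒱 : ∀ V, 𝒱 V → ∃ (L F : ModuleCat.{u} Rᵐᵒᵖ) (i : L →ₗ[Rᵐᵒᵖ] F) (p : F →ₗ[Rᵐᵒᵖ] V),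
      IsShortExact i p ∧ IsFlatRight R F ∧ Function.Injective (RTensor.rTensor X i) ∧ 𝒱 L)
    (hA : 𝒱 (ModuleCat.of Rᵐᵒᵖ A)) : TorAcyclic R A X := by
  -- The class of all `W` that satisfy the hypothesis in place of `X`. The rest shows that it passes
  -- to syzygies of `W`.
  refine ⟨fun W => ∀ V, 𝒱 V → ∃ (L F : ModuleCat.{u} Rᵐᵒᵖ) (i : L →ₗ[Rᵐᵒᵖ] F)
    (p : F →ₗ[Rᵐᵒᵖ] V), IsShortExact i p ∧ IsFlatRight R F ∧
      Function.Injective (RTensor.rTensor W i) ∧ 𝒱 L, h𝒱, fun W hW => ?_⟩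
  obtain ⟨K, P, j, q, hjq, hP⟩ := exists_projective_presentation R W
  have key : ∀ V, 𝒱 V → Function.Injective (RTensor.lTensor V j) := fun V hV => by
    obtain ⟨L, F, i, p, hip, hF, hi, -⟩ := hW V hV
    exact RTensor.lTensor_injective_of_rTensor_injective hip hjq (hF _ _ j hjq.inj) hi
  refine ⟨K, P, j, q, hjq, hP, key _ hA, fun V hV => ?_⟩
  obtain ⟨L, F, i, p, hip, hF, hi, hL⟩ := hW V hV
  refine ⟨L, F, i, p, hip, hF, ?_, hL⟩
  have h₁ := key L hL
  have h₂ := isFlatLeft_of_projective P hP _ _ i hip.inj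
  refine Function.Injective.of_comp (f := RTensor.lTensor F j) fun s t hst => h₁ (h₂ ?_)
  rw [RTensor.rTensor_lTensor, RTensor.rTensor_lTensor]
  exact hst

theorem lTensor_injective (h : TorAcyclic R A Z) {j : X →ₗ[R] Y} {q : Y →ₗ[R] Z}
    (hjq : IsShortExact j q) : Function.Injective (RTensor.lTensor A j) := by
  obtain ⟨L, F, i, p, hip, hF⟩ := exists_projective_presentation Rᵐᵒᵖ A
  exact RTensor.lTensor_injective_of_rTensor_injective hip hjq
    (isFlatRight_of_projective F hF _ _ j hjq.inj) (h.rTensor_injective hip)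

/-- `TorAcyclic` follows syzygies of its own choosing, whereas here the presentation is prescribed
and `Y` is only flat. Testing on syzygies of the first variable, all of which stay acyclic with `Z`,
avoids comparing two resolutions. -/
theorem syzygy_right (h : TorAcyclic R A Z) {j : X →ₗ[R] Y} {q : Y →ₗ[R] Z}
    (hjq : IsShortExact j q) (hY : IsFlatLeft R (ModuleCat.of R Y)) : TorAcyclic R A X := by
  refine of_left (fun V => TorAcyclic R V Z) (fun V hV => ?_) h
  obtain ⟨L, F, i, p, hip, hF⟩ := exists_projective_presentation Rᵐᵒᵖ V
  have hF' := isFlatRight_of_projective F hF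
  have hL : TorAcyclic R L Z := hV.syzygy_left hip hF'
  refine ⟨L, F, i, p, hip, hF', ?_, hL⟩
  have h₁ := hL.lTensor_injective hjq
  have h₂ : Function.Injective (RTensor.rTensor Y i) := hY _ _ i hip.inj
  refine Function.Injective.of_comp (f := RTensor.lTensor F j) fun s t hst => h₁ (h₂ ?_)
  rw [RTensor.rTensor_lTensor, RTensor.rTensor_lTensor]
  exact hst

theorem of_flat (hX : IsFlatLeft R (ModuleCat.of R X)) : TorAcyclic R A X := by
  refine of_left (fun _ => True) (fun V _ => ?_) trivial
  obtain ⟨L, F, i, p, hip, hF⟩ := exists_projective_presentation Rᵐᵒᵖ V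
  exact ⟨L, F, i, p, hip, isFlatRight_of_projective F hF, hX _ _ i hip.inj, trivial⟩

/-- An element of `L ⊗ Y` that dies in `F ⊗ Y` has zero image in `L ⊗ Z`, hence comes from `L ⊗ X`;
there it is zero because `F ⊗ X → F ⊗ Y` is injective for flat `F` and `Tor₁(V, X) = 0`. -/
theorem extension {j : X →ₗ[R] Y} {q : Y →ₗ[R] Z} (hjq : IsShortExact j q)
    (hX : TorAcyclic R A X) (hZ : TorAcyclic R A Z) : TorAcyclic R A Y := by
  refine of_left (fun V => TorAcyclic R V X ∧ TorAcyclic R V Z) (fun V hV => ?_) ⟨hX, hZ⟩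
  obtain ⟨L, F, i, p, hip, hF⟩ := exists_projective_presentation Rᵐᵒᵖ V
  have hF' := isFlatRight_of_projective F hF
  refine ⟨L, F, i, p, hip, hF', ?_, hV.1.syzygy_left hip hF', hV.2.syzygy_left hip hF'⟩
  rw [injective_iff_map_eq_zero]
  intro t ht
  have h₁ : RTensor.lTensor L q t = 0 := hV.2.rTensor_injective hip (by
    rw [RTensor.rTensor_lTensor, ht, map_zero, map_zero])
  obtain ⟨s, rfl⟩ := (RTensor.lTensor_exact j q hjq.exact hjq.surj t).1 h₁
  rw [RTensor.rTensor_lTensor] at ht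
  have h₂ : RTensor.rTensor X i s = 0 := hF' _ _ j hjq.inj (ht.trans (map_zero _).symm)
  rw [hV.1.rTensor_injective hip (h₂.trans (map_zero _).symm), map_zero]

/-- `Ext¹(A, X⁺) = 0` if the higher `Tor` groups of `A` and `X` vanish. -/
theorem extOneVanishes (h : TorAcyclic R A X) : ExtOneVanishes Rᵐᵒᵖ A (LeftDual R X) :=
  fun _ _ _ _ _ _ i _ hip f => (RTensor.rTensor_injective_iff i).1 (h.rTensor_injective hip) f

end TorAcyclic

/-- For a projective resolution `P` of `X`, vanishing homology of `M ⊗ P` in degree `n + 1` says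
that `M ⊗ im d → M ⊗ Pₙ` is injective, where `d : Pₙ₊₁ → Pₙ`. -/
theorem torAcyclic_of_isZero_RTor {R : Type u} [Ring R] {M X : Type u} [AddCommGroup M]
    [Module Rᵐᵒᵖ M] [AddCommGroup X] [Module R X]
    (h : ∀ n : ℕ, 1 ≤ n → Limits.IsZero (RTor R n M X)) : TorAcyclic R M X := by
  let P := projectiveResolution (ModuleCat.of R X)
  let F := tensorFunctor R M
  have hex : ∀ n, Function.Exact (P.complex.d (n + 2) (n + 1)) (P.complex.d (n + 1) n) :=
    fun n => (ShortComplex.ShortExact.moduleCat_exact_iff_function_exact _).1 (P.exact_succ n)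
  have hex₀ : Function.Exact (P.complex.d 1 0) (P.π.f 0) :=
    (ShortComplex.ShortExact.moduleCat_exact_iff_function_exact _).1 P.exact₀
  have hπ : Function.Surjective (P.π.f 0) := (ModuleCat.epi_iff_surjective _).1 inferInstance
  have htens : ∀ n, Function.Exact (RTensor.lTensor M (P.complex.d (n + 2) (n + 1)).hom)
      (RTensor.lTensor M (P.complex.d (n + 1) n).hom) := fun n => by
    have h₁ : ((F.mapHomologicalComplex _).obj P.complex).ExactAt (n + 1) := by
      rw [HomologicalComplex.exactAt_iff_isZero_homology]
      exact (h (n + 1) (by omega)).of_iso (P.isoLeftDerivedObj F (n + 1)).symm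
    rw [HomologicalComplex.exactAt_iff' _ (n + 2) (n + 1) n (by simp) (by simp)] at h₁
    exact (ShortComplex.ab_exact_iff_function_exact _).1 h₁
  have key : ∀ (n : ℕ) (W : ModuleCat.{u} R) (p : P.complex.X n →ₗ[R] W),
      Function.Surjective p → Function.Exact (P.complex.d (n + 1) n) p →
      IsShortExact (LinearMap.range (P.complex.d (n + 1) n).hom).subtype p ∧
      Function.Injective (RTensor.lTensor M
        (LinearMap.range (P.complex.d (n + 1) n).hom).subtype) := by
    intro n W p hp he
    refine ⟨⟨Subtype.val_injective, fun x => (he x).trans ?_, hp⟩, ?_⟩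
    · simp
    · rw [injective_iff_map_eq_zero]
      intro t ht
      obtain ⟨s, rfl⟩ := RTensor.lTensor_surjective (P.complex.d (n + 1) n).hom.rangeRestrict
        (LinearMap.surjective_rangeRestrict _) t
      rw [RTensor.lTensor_lTensor] at ht
      obtain ⟨w, rfl⟩ := (htens n s).1 ht
      rw [RTensor.lTensor_lTensor]
      exact RTensor.lTensor_eq_zero _ (fun x =>
        Subtype.ext ((hex n).apply_apply_eq_zero x)) w
  have hproj : ∀ n, Module.Projective R (P.complex.X n) := fun n =>
    (IsProjective.iff_projective (P.complex.X n)).2 (P.projective n)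
  -- The class consists of `X` and the images of all differentials, the successive syzygies of the
  -- resolution.
  refine ⟨fun W => W = ModuleCat.of R X ∨
    ∃ n, W = ModuleCat.of R (LinearMap.range (P.complex.d (n + 1) n).hom), Or.inl rfl, ?_⟩
  rintro W (rfl | ⟨n, rfl⟩)
  · obtain ⟨h₁, h₂⟩ := key 0 (ModuleCat.of R X) (P.π.f 0).hom hπ hex₀
    exact ⟨ModuleCat.of R _, _, _, _, h₁, hproj 0, h₂, Or.inr ⟨0, rfl⟩⟩
  · obtain ⟨h₁, h₂⟩ := key (n + 1)
      (ModuleCat.of R (LinearMap.range (P.complex.d (n + 1) n).hom))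
      (P.complex.d (n + 1) n).hom.rangeRestrict (LinearMap.surjective_rangeRestrict _)
      (fun x => by
        rw [← hex n x]
        exact Subtype.ext_iff)
    exact ⟨ModuleCat.of R _, _, _, _, h₁, hproj (n + 1), h₂, Or.inr ⟨n + 1, rfl⟩⟩

/-! ### Finite resolutions -/

/-- The class of projective modules. -/
def IsProj (S : Type u) [Ring S] : ObjectProperty (ModuleCat.{u} S) := fun P =>
  Module.Projective S P

theorem exists_hasResolutionLE_of_projectiveDimension {S : Type u} [Ring S] (X : ModuleCat.{u} S)
    (h : projectiveDimension X < ⊤) : ∃ n, HasResolutionLE (IsProj S) n X := by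
  obtain ⟨n, hn⟩ := (projectiveDimension_ne_top_iff X).1 h.ne
  refine ⟨n, ?_⟩
  induction n generalizing X with
  | zero =>
    exact ⟨X, (IsProjective.iff_projective X).2 ((projective_iff_hasProjectiveDimensionLE_zero X).2 hn),
      ⟨LinearEquiv.refl S X⟩⟩
  | succ n ih =>
    obtain ⟨K, P, i, p, hip, hP⟩ := exists_projective_presentation S X
    have hse : (ShortComplex.mk (ModuleCat.ofHom i) (ModuleCat.ofHom p) (by
        ext k; exact hip.apply_apply k)).ShortExact :=
      { exact := (ShortComplex.ShortExact.moduleCat_exact_iff_function_exact _).2 hip.exact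
        mono_f := (ModuleCat.mono_iff_injective _).2 hip.inj
        epi_g := (ModuleCat.epi_iff_surjective _).2 hip.surj }
    have hK : HasProjectiveDimensionLE K n :=
      (hse.hasProjectiveDimensionLT_X₃_iff n ((IsProjective.iff_projective P).1 hP)).1 hn
    refine ⟨K, P, i, p, hip.inj, hip.exact, hip.surj, hP, ih K ?_ hK⟩
    exact lt_top_iff_ne_top.2 ((projectiveDimension_ne_top_iff K).2 ⟨n, hK⟩)

theorem HasResolutionLE.of_equiv {S : Type u} [Ring S] {𝓕 : ObjectProperty (ModuleCat.{u} S)}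
    {n : ℕ} {X Y : ModuleCat.{u} S} (h : HasResolutionLE 𝓕 n X) (e : X ≃ₗ[S] Y) :
    HasResolutionLE 𝓕 n Y := by
  cases n with
  | zero =>
    obtain ⟨F, hF, ⟨e'⟩⟩ := h
    exact ⟨F, hF, ⟨e'.trans e⟩⟩
  | succ n =>
    obtain ⟨K, F, i, p, h₁, h₂, h₃, h₄, h₅⟩ := h
    have h' := IsShortExact.comp_equiv_right ⟨h₁, h₂, h₃⟩ e
    exact ⟨K, F, i, e.toLinearMap ∘ₗ p, h'.inj, h'.exact, h'.surj, h₄, h₅⟩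

theorem IsShortExact.finsupp {S : Type*} [Ring S] {K L N : Type*} [AddCommGroup K]
    [AddCommGroup L] [AddCommGroup N] [Module S K] [Module S L] [Module S N]
    {i : K →ₗ[S] L} {p : L →ₗ[S] N} (h : IsShortExact i p) (ι : Type*) :
    IsShortExact (Finsupp.mapRange.linearMap (α := ι) i)
      (Finsupp.mapRange.linearMap (α := ι) p) where
  inj := Finsupp.mapRange_injective _ (map_zero i) h.inj
  exact := fun f => by
    constructor
    · intro hf
      have hf' : ∀ a, p (f a) = 0 := fun a => DFunLike.congr_fun hf a
      choose g hg using fun a => h.exists_of_eq_zero (hf' a)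
      -- The chosen preimages vanish off the support of `f` because `i` is injective.
      refine ⟨Finsupp.onFinset f.support g fun a ha => ?_, ?_⟩
      · rw [Finsupp.mem_support_iff, ← hg]
        exact fun e => ha (h.inj (e.trans (map_zero i).symm))
      · ext a
        simp [hg]
    · rintro ⟨g, rfl⟩
      ext a
      simp [h.apply_apply]
  surj := Finsupp.mapRange_surjective _ (map_zero p) h.surj

theorem HasResolutionLE.finsupp {S : Type u} [Ring S] {𝓕 : ObjectProperty (ModuleCat.{u} S)}
    {ι : Type u} (h𝓕 : ∀ F : ModuleCat.{u} S, 𝓕 F → 𝓕 (ModuleCat.of S (ι →₀ F)))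
    {n : ℕ} {X : ModuleCat.{u} S} (h : HasResolutionLE 𝓕 n X) :
    HasResolutionLE 𝓕 n (ModuleCat.of S (ι →₀ X)) := by
  induction n generalizing X with
  | zero =>
    obtain ⟨F, hF, ⟨e⟩⟩ := h
    exact ⟨_, h𝓕 F hF, ⟨Finsupp.mapRange.linearEquiv e⟩⟩
  | succ n ih =>
    obtain ⟨K, F, i, p, h₁, h₂, h₃, h₄, h₅⟩ := h
    have h' := IsShortExact.finsupp ⟨h₁, h₂, h₃⟩ ι
    exact ⟨ModuleCat.of S (ι →₀ K), ModuleCat.of S (ι →₀ F), _, _, h'.inj, h'.exact, h'.surj,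
      h𝓕 F h₄, ih h₅⟩

theorem isProj_finsupp {S : Type u} [Ring S] {ι : Type u} (F : ModuleCat.{u} S)
    (hF : IsProj S F) : IsProj S (ModuleCat.of S (ι →₀ F)) := by
  have : Module.Projective S F := hF
  refine Module.Projective.of_lifting_property'' (P := ι →₀ F) fun f hf => ?_
  choose g hg using fun a : ι => Module.projective_lifting_property f (Finsupp.lsingle a) hf
  refine ⟨Finsupp.lsum ℕ g, ?_⟩
  ext a y : 2
  simpa using DFunLike.congr_fun (hg a) y

theorem isFlatLeft_finsupp {S : Type u} [Ring S] {ι : Type u} (F : ModuleCat.{u} S)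
    (hF : IsFlatLeft S F) : IsFlatLeft S (ModuleCat.of S (ι →₀ F)) := by
  intro A B _ _ _ _ f hf
  rw [RTensor.rTensor_injective_iff_of_right]
  intro g
  have h := (RTensor.rTensor_injective_iff_of_right (X := F) f).1 (hF A B f hf)
  choose g' hg' using fun a : ι => h (g ∘ₗ Finsupp.lsingle a)
  refine ⟨Finsupp.lsum ℕ g', fun x => ?_⟩
  have : RightDual.map f ∘ₗ Finsupp.lsum ℕ g' = g := by
    ext a y : 2
    simpa using hg' a y
  exact DFunLike.congr_fun this x

theorem isFlatLeft_retract {S : Type u} [Ring S] {X Y : ModuleCat.{u} S} (hX : IsFlatLeft S X)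
    (s : Y →ₗ[S] X) (r : X →ₗ[S] Y) (h : ∀ y, r (s y) = y) : IsFlatLeft S Y := by
  intro A B _ _ _ _ f hf
  refine Function.Injective.of_comp (f := RTensor.lTensor B s) fun t t' e =>
    RTensor.lTensor_injective_of_retract s r h (hX A B f hf ?_)
  rw [RTensor.rTensor_lTensor, RTensor.rTensor_lTensor]
  exact e

theorem isFlatRight_congr {S : Type u} [Ring S] {A B : ModuleCat.{u} Sᵐᵒᵖ}
    (hA : IsFlatRight S A) (e : A ≃ₗ[Sᵐᵒᵖ] B) : IsFlatRight S B := by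
  intro X Y _ _ _ _ f hf
  have h : Function.LeftInverse (RTensor.rTensor X e.toLinearMap)
      (RTensor.rTensor (R := S) X e.symm.toLinearMap) := fun t =>
    DFunLike.congr_fun (RTensor.hom_ext (f := (RTensor.rTensor X e.toLinearMap).comp
      (RTensor.rTensor X e.symm.toLinearMap)) (g := AddMonoidHom.id _) fun a x => by simp) t
  refine Function.Injective.of_comp (f := RTensor.rTensor Y e.symm.toLinearMap) fun t t' e' =>
    h.injective (hA X Y f hf ?_)
  rw [← RTensor.rTensor_lTensor, ← RTensor.rTensor_lTensor]
  exact e'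

/-- Tensoring with a free module. -/
noncomputable def tensorFinsuppEquiv (R : Type*) [Ring R] (M : Type*) [AddCommGroup M]
    [Module R M] [Module Rᵐᵒᵖ M] [SMulCommClass R Rᵐᵒᵖ M] (ι : Type*) :
    (ι →₀ M) ≃ₗ[R] RTensor R M (ι →₀ R) := by
  let f : (ι →₀ M) →ₗ[R] RTensor R M (ι →₀ R) := Finsupp.lsum ℕ fun a =>
    { toFun := fun m => RTensor.tmul R m (Finsupp.single a 1)
      map_add' := fun m n => RTensor.add_tmul m n _
      map_smul' := fun r m => rfl }
  let g : RTensor R M (ι →₀ R) →+ (ι →₀ M) := RTensor.lift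
    (AddMonoidHom.mk' (fun m => AddMonoidHom.mk'
        (fun x => x.mapRange (fun r => op r • m) (by simp))
        (fun x y => by ext a; simp [add_smul]))
      (fun m n => by ext x a; simp [smul_add]))
    (fun r m x => by
      ext a
      simp [mul_smul])
  have hgf : ∀ x, g (f x) = x := by
    intro x
    induction x using Finsupp.induction_linear with
    | zero => simp
    | add x y hx hy => rw [map_add, map_add, hx, hy]
    | single a m =>
      have : f (Finsupp.single a m) = RTensor.tmul R m (Finsupp.single a 1) := by
        simp only [f, Finsupp.lsum_single]; rfl
      rw [this]
      ext b
      simp [g]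
  have hfg : ∀ t, f (g t) = t := by
    intro t
    induction t using RTensor.induction_on with
    | zero => simp
    | add s t hs ht => rw [map_add, map_add, hs, ht]
    | tmul m x =>
      induction x using Finsupp.induction_linear with
      | zero => simp [RTensor.tmul_zero]
      | add x y hx hy => rw [RTensor.tmul_add, map_add, map_add, hx, hy]
      | single a r =>
        have h₁ : g (RTensor.tmul R m (Finsupp.single a r)) = Finsupp.single a (op r • m) := by
          simp [g]
        have h₂ : f (Finsupp.single a (op r • m)) =
          RTensor.tmul R (op r • m) (Finsupp.single a 1) := by
            simp only [f, Finsupp.lsum_single]; rfl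
        rw [h₁, h₂, RTensor.smul_tmul]
        simp
  exact LinearEquiv.ofBijective f ⟨Function.LeftInverse.injective hgf,
    Function.RightInverse.surjective hfg⟩

/-! ### Dimension shifting along infinite coresolutions and resolutions -/

/-- If `A` has finite flat dimension, then `A ⊗ -` preserves the exactness of infinite
coresolutions whose terms have vanishing higher `Tor` groups with `A`. -/
theorem HasResolutionLE.lTensor_injective {R : Type u} [Ring R] {n : ℕ} {A : ModuleCat.{u} Rᵐᵒᵖ}
    (hA : HasResolutionLE (IsFlatRight R) n A) (𝒵 : ModuleCat.{u} R → Prop)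
    (h𝒵 : ∀ Z, 𝒵 Z → ∃ (P Z' : ModuleCat.{u} R) (i : Z →ₗ[R] P) (p : P →ₗ[R] Z'),
      IsShortExact i p ∧ TorAcyclic R A P ∧ 𝒵 Z')
    {Z P Z' : Type u} [AddCommGroup Z] [Module R Z] [AddCommGroup P] [Module R P]
    [AddCommGroup Z'] [Module R Z'] {i : Z →ₗ[R] P} {p : P →ₗ[R] Z'} (hip : IsShortExact i p)
    (hZ' : 𝒵 (ModuleCat.of R Z')) :
    Function.Injective (RTensor.lTensor A i) := by
  induction n generalizing A Z P Z' with
  | zero =>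
    obtain ⟨F, hF, ⟨e⟩⟩ := hA
    exact isFlatRight_congr hF e _ _ i hip.inj
  | succ n ih =>
    obtain ⟨K, F, j, q, h₁, h₂, h₃, hF, hK⟩ := hA
    have hjq : IsShortExact j q := ⟨h₁, h₂, h₃⟩
    refine RTensor.lTensor_injective_of_rTensor_injective hjq hip (hF _ _ i hip.inj) ?_
    obtain ⟨P', Z'', i', p', hip', hP', hZ''⟩ := h𝒵 _ hZ'
    -- The shift `Tor₁(A, Z') = Tor₂(A, Z'') = Tor₁(K, Z'')`: the induction applies to the syzygy
    -- `K` one step further along the coresolution. The composite `K ⊗ Z' → K ⊗ P' → F ⊗ P'` is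
    -- injective, hence so is `K ⊗ Z' → F ⊗ Z'`.
    have h₄ : Function.Injective (RTensor.lTensor K i') := by
      refine ih hK (fun W hW => ?_) hip' hZ''
      obtain ⟨Q, W', a, b, hab, hQ, hW'⟩ := h𝒵 W hW
      exact ⟨Q, W', a, b, hab, hQ.syzygy_left hjq hF, hW'⟩
    have h₅ := hP'.rTensor_injective hjq
    refine Function.Injective.of_comp (f := RTensor.lTensor F i') fun s t hst => h₄ (h₅ ?_)
    rw [RTensor.rTensor_lTensor, RTensor.rTensor_lTensor]
    exact hst

/-- `Extⁿ(A, B) = 0` for all `n ≥ 1`, expressed by the syzygies of `A`. -/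
def ExtAcyclic (S : Type u) [Ring S] (A B : Type u) [AddCommGroup A] [Module S A]
    [AddCommGroup B] [Module S B] : Prop :=
  ∃ 𝒱 : ModuleCat.{u} S → Prop, 𝒱 (ModuleCat.of S A) ∧ ∀ V, 𝒱 V → ExtOneVanishes S V B ∧
    ∀ (K P : ModuleCat.{u} S) (i : K →ₗ[S] P) (p : P →ₗ[S] V), IsShortExact i p →
      Module.Projective S P → 𝒱 K

theorem TorAcyclic.extAcyclic {R : Type u} [Ring R] {A X : Type u} [AddCommGroup A]
    [Module Rᵐᵒᵖ A] [AddCommGroup X] [Module R X] (h : TorAcyclic R A X) :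
    ExtAcyclic Rᵐᵒᵖ A (LeftDual R X) :=
  ⟨fun V => TorAcyclic R V X, h, fun _ hV => ⟨hV.extOneVanishes, fun _ P _ _ hip hP =>
    hV.syzygy_left hip (isFlatRight_of_projective P hP)⟩⟩

namespace ExtAcyclic

variable {S : Type u} [Ring S] {A B B' B'' : Type u} [AddCommGroup A] [Module S A]
  [AddCommGroup B] [Module S B] [AddCommGroup B'] [Module S B'] [AddCommGroup B''] [Module S B'']

theorem of_injective (h : Module.Injective S B) : ExtAcyclic S A B :=
  ⟨fun _ => True, trivial, fun _ _ => ⟨.of_injective h, fun _ _ _ _ _ _ => trivial⟩⟩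

theorem retract (h : ExtAcyclic S A B) (s : B' →ₗ[S] B) (r : B →ₗ[S] B')
    (hrs : ∀ b, r (s b) = b) : ExtAcyclic S A B' := by
  obtain ⟨𝒱, hA, h𝒱⟩ := h
  exact ⟨𝒱, hA, fun V hV => ⟨(h𝒱 V hV).1.retract_right s r hrs, (h𝒱 V hV).2⟩⟩

theorem extension {j : B' →ₗ[S] B} {q : B →ₗ[S] B''} (hjq : IsShortExact j q)
    (h' : ExtAcyclic S A B') (h'' : ExtAcyclic S A B'') : ExtAcyclic S A B := by
  obtain ⟨𝒱', hA', h𝒱'⟩ := h'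
  obtain ⟨𝒱'', hA'', h𝒱''⟩ := h''
  exact ⟨fun V => 𝒱' V ∧ 𝒱'' V, ⟨hA', hA''⟩, fun V hV =>
    ⟨.extension_right hjq (h𝒱' V hV.1).1 (h𝒱'' V hV.2).1, fun K P i p hip hP =>
      ⟨(h𝒱' V hV.1).2 K P i p hip hP, (h𝒱'' V hV.2).2 K P i p hip hP⟩⟩⟩

end ExtAcyclic

/-- If `A` has finite projective dimension, then `Ext¹(A, Z) = 0` for every `Z` with an infinite
resolution whose terms have vanishing higher `Ext` groups with `A`. -/
theorem HasResolutionLE.extOneVanishes {S : Type u} [Ring S] {n : ℕ} {A : ModuleCat.{u} S}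
    (hA : HasResolutionLE (IsProj S) n A) (𝒵 : ModuleCat.{u} S → Prop)
    (h𝒵 : ∀ Z, 𝒵 Z → ∃ (Z' I : ModuleCat.{u} S) (i : Z' →ₗ[S] I) (p : I →ₗ[S] Z),
      IsShortExact i p ∧ ExtAcyclic S A I ∧ 𝒵 Z')
    (Z : ModuleCat.{u} S) (hZ : 𝒵 Z) : ExtOneVanishes S A Z := by
  induction n generalizing A Z with
  | zero =>
    obtain ⟨F, hF, ⟨e⟩⟩ := hA
    exact (ExtOneVanishes.of_projective hF).congr_left e
  | succ n ih =>
    obtain ⟨K, F, j, q, h₁, h₂, h₃, hF, hK⟩ := hA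
    have hjq : IsShortExact j q := ⟨h₁, h₂, h₃⟩
    refine ExtOneVanishes.of_projective_presentation hjq hF fun f => ?_
    obtain ⟨Z', I, i, p, hip, ⟨𝒱, hA, h𝒱⟩, hZ'⟩ := h𝒵 Z hZ
    -- By induction `f` lifts from `Z` to `I`. The lift extends to `F` because `Ext¹(A, I) = 0`, and
    -- is then pushed back down to `Z`.
    have hKZ' : ExtOneVanishes S K Z' := by
      refine ih hK (fun W hW => ?_) Z' hZ'
      obtain ⟨W', J, a, b, hab, ⟨𝒱', hA', h𝒱'⟩, hW'⟩ := h𝒵 W hW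
      exact ⟨W', J, a, b, hab, ⟨𝒱', (h𝒱' _ hA').2 K F j q hjq hF, h𝒱'⟩, hW'⟩
    obtain ⟨g, hg⟩ := hKZ'.exists_lift hip f
    obtain ⟨g', hg'⟩ := (h𝒱 _ hA).1 _ _ j q hjq g
    exact ⟨p ∘ₗ g', fun k => by rw [LinearMap.comp_apply, hg', hg]⟩

/-! ### Gorenstein modules through totally acyclic chains of short exact sequences -/

/-- Successors are iterated for nonnegative indices and predecessors for negative ones, the two
halves meeting at `W`. This is the only place where two-sided complexes are assembled. -/
theorem exists_int_chain {α : Type*} (r : α → α → Prop) (𝒲 : α → Prop)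
    (hright : ∀ W, 𝒲 W → ∃ W', 𝒲 W' ∧ r W W') (hleft : ∀ W, 𝒲 W → ∃ W', 𝒲 W' ∧ r W' W)
    (W : α) (hW : 𝒲 W) : ∃ Z : ℤ → α, Z 0 = W ∧ ∀ i, r (Z i) (Z (i + 1)) := by
  choose fr hfr hrr using fun x : {x // 𝒲 x} => hright x.1 x.2
  choose fl hfl hrl using fun x : {x // 𝒲 x} => hleft x.1 x.2
  let a : ℕ → {x // 𝒲 x} := fun n => (fun x => ⟨fr x, hfr x⟩)^[n] ⟨W, hW⟩
  let b : ℕ → {x // 𝒲 x} := fun n => (fun x => ⟨fl x, hfl x⟩)^[n] ⟨W, hW⟩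
  have ha : ∀ n, r (a n) (a (n + 1)) := fun n => by
    have : a (n + 1) = ⟨fr (a n), hfr (a n)⟩ := Function.iterate_succ_apply' _ n _
    rw [this]
    exact hrr _
  have hb : ∀ n, r (b (n + 1)) (b n) := fun n => by
    have : b (n + 1) = ⟨fl (b n), hfl (b n)⟩ := Function.iterate_succ_apply' _ n _
    rw [this]
    exact hrl _
  refine ⟨fun i => if 0 ≤ i then (a i.toNat).1 else (b (-i).toNat).1, rfl, fun i => ?_⟩
  rcases lt_trichotomy i (-1) with hi | rfl | hi
  · have h := hb (-(i + 1)).toNat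
    have e : (-(i + 1)).toNat + 1 = (-i).toNat := by omega
    rw [e] at h
    simpa [show ¬ (0 ≤ i) by omega, show ¬ (0 ≤ i + 1) by omega] using h
  -- At the seam the index `0` is read from `a`, and `a 0` and `b 0` are both `W`.
  · exact hb 0
  · have h := ha i.toNat
    have e : i.toNat + 1 = (i + 1).toNat := by omega
    rw [e] at h
    simpa [show 0 ≤ i by omega, show 0 ≤ i + 1 by omega] using h

section Chains

variable {S : Type u} [Ring S]

theorem exact_of_isShortExact {P : ℤ → ModuleCat.{u} S} {Z : ℤ → ModuleCat.{u} S}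
    {i : ∀ j, Z j →ₗ[S] P j} {p : ∀ j, P j →ₗ[S] Z (j + 1)} (h : ∀ j, IsShortExact (i j) (p j))
    (j : ℤ) : Function.Exact (i (j + 1) ∘ₗ p j) (i (j + 1 + 1) ∘ₗ p (j + 1)) := by
  intro x
  constructor
  · intro hx
    obtain ⟨z, rfl⟩ := (h (j + 1)).exists_of_eq_zero ((h (j + 1 + 1)).inj (hx.trans (map_zero _).symm))
    obtain ⟨y, rfl⟩ := (h j).surj z
    exact ⟨y, rfl⟩
  · rintro ⟨y, rfl⟩
    simp [(h (j + 1)).apply_apply]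

theorem nonempty_equiv_ker {Z P Z' P' : Type*} [AddCommGroup Z] [Module S Z] [AddCommGroup P]
    [Module S P] [AddCommGroup Z'] [Module S Z'] [AddCommGroup P'] [Module S P'] {i : Z →ₗ[S] P}
    {p : P →ₗ[S] Z'} (h : IsShortExact i p) (i' : Z' →ₗ[S] P') (hi' : Function.Injective i') :
    Nonempty (Z ≃ₗ[S] LinearMap.ker (i' ∘ₗ p)) := by
  refine ⟨LinearEquiv.ofBijective (LinearMap.codRestrict _ i fun z => ?_) ⟨?_, ?_⟩⟩
  · simp [h.apply_apply]
  · exact fun z z' e => h.inj (congrArg Subtype.val e)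
  · rintro ⟨x, hx⟩
    obtain ⟨z, rfl⟩ := h.exists_of_eq_zero (hi' (hx.trans (map_zero _).symm))
    exact ⟨z, rfl⟩

/-- The corestriction of the differential to the cycles. -/
def toCycles {P : ℤ → ModuleCat.{u} S} {d : ∀ i, P i →ₗ[S] P (i + 1)}
    (h : ∀ i, Function.Exact (d i) (d (i + 1))) (j : ℤ) : P j →ₗ[S] LinearMap.ker (d (j + 1)) :=
  LinearMap.codRestrict _ (d j) fun x => (h j).apply_apply_eq_zero x

theorem isShortExact_toCycles {P : ℤ → ModuleCat.{u} S} {d : ∀ i, P i →ₗ[S] P (i + 1)}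
    (h : ∀ i, Function.Exact (d i) (d (i + 1))) (j : ℤ) :
    IsShortExact (LinearMap.ker (d j)).subtype (toCycles h j) where
  inj := Subtype.val_injective
  exact := fun x => by
    constructor
    · intro hx
      exact ⟨⟨x, congrArg Subtype.val hx⟩, rfl⟩
    · rintro ⟨y, rfl⟩
      exact Subtype.ext y.2
  surj := fun ⟨x, hx⟩ => by
    obtain ⟨y, rfl⟩ := (h j x).1 hx
    exact ⟨y, rfl⟩

/-! #### Gorenstein projective modules -/

/-- `A` is the kernel of a surjection from a projective module to `B`, and linear maps from `A` to
projective modules extend. -/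
def ProjectiveStep (A B : ModuleCat.{u} S) : Prop :=
  ∃ (P : ModuleCat.{u} S) (i : A →ₗ[S] P) (p : P →ₗ[S] B), IsShortExact i p ∧
    Module.Projective S P ∧ ∀ Q : ModuleCat.{u} S, Module.Projective S Q →
      ∀ f : A →ₗ[S] Q, ∃ g : P →ₗ[S] Q, ∀ a, g (i a) = f a

/-- Splicing a two-sided chain of steps gives a complete projective resolution. Gorenstein
projectivity can thus be proved for a whole class at once from local data. -/
theorem gorensteinProjective_of_class (𝒲 : ModuleCat.{u} S → Prop)
    (hright : ∀ W, 𝒲 W → ∃ W', 𝒲 W' ∧ ProjectiveStep W W')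
    (hleft : ∀ W, 𝒲 W → ∃ W', 𝒲 W' ∧ ProjectiveStep W' W)
    (W : ModuleCat.{u} S) (hW : 𝒲 W) : GorensteinProjective S W := by
  obtain ⟨Z, rfl, hZ⟩ := exists_int_chain _ 𝒲 hright hleft W hW
  choose P i p hip hP hQ using hZ
  refine ⟨P, fun j => i (j + 1) ∘ₗ p j, ⟨hP, exact_of_isShortExact hip, fun Q hQ' j g => ?_⟩,
    nonempty_equiv_ker (hip 0) _ (hip _).inj⟩
  constructor
  · intro hg
    obtain ⟨t, ht⟩ := (hip (j + 1)).exists_desc g (fun z => by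
      obtain ⟨y, rfl⟩ := (hip j).surj z
      exact DFunLike.congr_fun hg y)
    obtain ⟨g', hg'⟩ := hQ (j + 1 + 1) Q hQ' t
    exact ⟨g', LinearMap.ext fun x => (hg' _).trans (ht x)⟩
  · rintro ⟨g', rfl⟩
    ext x
    simp [(hip (j + 1)).apply_apply]

theorem gorensteinProjective_ker {P : ℤ → ModuleCat.{u} S} {d : ∀ i, P i →ₗ[S] P (i + 1)}
    (h : IsCompleteProjectiveResolution P d) :
    (∀ j, GorensteinProjective S (ModuleCat.of S (LinearMap.ker (d j)))) ∧
      ∀ j k, k = j + 1 → ProjectiveStep (ModuleCat.of S (LinearMap.ker (d j)))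
        (ModuleCat.of S (LinearMap.ker (d k))) := by
  have key : ∀ j k, k = j + 1 → ProjectiveStep (ModuleCat.of S (LinearMap.ker (d j)))
        (ModuleCat.of S (LinearMap.ker (d k))) := by
    rintro j k rfl
    refine ⟨P j, (LinearMap.ker (d j)).subtype, toCycles h.exact j, isShortExact_toCycles _ j,
      h.projective j, fun Q hQ f => ?_⟩
    -- A map on the cycles of `P (l + 2)` pulls back to a map on `P (l + 1)` that kills the image of
    -- `d l`; exactness of `Hom(P, Q)` there factors it through `d (l + 1)`, giving an extension to
    -- `P (l + 2)`.
    obtain ⟨l, rfl⟩ : ∃ l, j = l + 1 + 1 := ⟨j - 2, by ring⟩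
    have hf : (f ∘ₗ toCycles h.exact (l + 1)) ∘ₗ d l = 0 := LinearMap.ext fun x => by
      have : toCycles h.exact (l + 1) (d l x) = 0 :=
        Subtype.ext ((h.exact l).apply_apply_eq_zero x)
      simp [this]
    obtain ⟨g, hg⟩ := (h.hom_exact Q hQ l _).1 hf
    refine ⟨g, fun a => ?_⟩
    obtain ⟨y, rfl⟩ := (isShortExact_toCycles h.exact (l + 1)).surj a
    exact DFunLike.congr_fun hg y
  refine ⟨fun j => gorensteinProjective_of_class
    (fun W => ∃ j, W = ModuleCat.of S (LinearMap.ker (d j))) ?_ ?_ _ ⟨j, rfl⟩, key⟩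
  · rintro W ⟨j, rfl⟩
    exact ⟨_, ⟨j + 1, rfl⟩, key _ _ rfl⟩
  · rintro W ⟨j, rfl⟩
    exact ⟨_, ⟨j - 1, rfl⟩, key _ _ (by ring)⟩

namespace GorensteinProjective

theorem of_equiv {X Y : ModuleCat.{u} S} (h : GorensteinProjective S X) (e : X ≃ₗ[S] Y) :
    GorensteinProjective S Y := by
  obtain ⟨P, d, hP, ⟨e'⟩⟩ := h
  exact ⟨P, d, hP, ⟨e.symm.trans e'⟩⟩

theorem exists_right {X : ModuleCat.{u} S} (h : GorensteinProjective S X) :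
    ∃ X', GorensteinProjective S X' ∧ ProjectiveStep X X' := by
  obtain ⟨P, d, hP, ⟨e⟩⟩ := h
  obtain ⟨Q, i, p, hip, hQ, hf⟩ := (gorensteinProjective_ker hP).2 0 (0 + 1) rfl
  refine ⟨_, (gorensteinProjective_ker hP).1 (0 + 1), Q, i ∘ₗ e.toLinearMap, p,
    hip.comp_equiv_left e, hQ, fun N hN f => ?_⟩
  obtain ⟨g, hg⟩ := hf N hN (f ∘ₗ e.symm.toLinearMap)
  exact ⟨g, fun a => (hg (e a)).trans (by simp)⟩

theorem exists_left {X : ModuleCat.{u} S} (h : GorensteinProjective S X) :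
    ∃ X', GorensteinProjective S X' ∧ ProjectiveStep X' X := by
  obtain ⟨P, d, hP, ⟨e⟩⟩ := h
  obtain ⟨Q, i, p, hip, hQ, hf⟩ := (gorensteinProjective_ker hP).2 (-1) 0 (by norm_num)
  exact ⟨_, (gorensteinProjective_ker hP).1 (-1), Q, i, e.symm.toLinearMap ∘ₗ p,
    hip.comp_equiv_right e.symm, hQ, hf⟩

theorem extOneVanishes_of_projective {X Q : ModuleCat.{u} S} (h : GorensteinProjective S X)
    (hQ : Module.Projective S Q) : ExtOneVanishes S X Q := by
  obtain ⟨X', -, P, i, p, hip, hP, hf⟩ := h.exists_left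
  exact .of_projective_presentation hip hP (hf Q hQ)

/-- The class of modules `N` with `Ext¹(X, N) = 0` for all Gorenstein projective `X` is closed
under cokernels of injections. -/
theorem extOneVanishes_cokernel {N' N N'' : Type u} [AddCommGroup N'] [Module S N']
    [AddCommGroup N] [Module S N] [AddCommGroup N''] [Module S N''] {j : N' →ₗ[S] N}
    {q : N →ₗ[S] N''} (hjq : IsShortExact j q)
    (h' : ∀ X : ModuleCat.{u} S, GorensteinProjective S X → ExtOneVanishes S X N')
    (h : ∀ X : ModuleCat.{u} S, GorensteinProjective S X → ExtOneVanishes S X N)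
    (X : ModuleCat.{u} S) (hX : GorensteinProjective S X) : ExtOneVanishes S X N'' := by
  obtain ⟨X', hX', P, i, p, hip, hP, -⟩ := hX.exists_left
  refine .of_projective_presentation hip hP fun f => ?_
  obtain ⟨g, hg⟩ := (h' X' hX').exists_lift hjq f
  obtain ⟨g', hg'⟩ := h X hX _ _ i p hip g
  exact ⟨q ∘ₗ g', fun k => by rw [LinearMap.comp_apply, hg', hg]⟩

/-- Induction on the length, starting from projective modules and passing to cokernels. -/
theorem extOneVanishes_of_hasResolutionLE {n : ℕ} {N : ModuleCat.{u} S}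
    (hN : HasResolutionLE (IsProj S) n N) (X : ModuleCat.{u} S) (hX : GorensteinProjective S X) :
    ExtOneVanishes S X N := by
  induction n generalizing N X with
  | zero =>
    obtain ⟨F, hF, ⟨e⟩⟩ := hN
    exact (hX.extOneVanishes_of_projective hF).congr_right e
  | succ n ih =>
    obtain ⟨K, F, j, q, h₁, h₂, h₃, hF, hK⟩ := hN
    exact extOneVanishes_cokernel ⟨h₁, h₂, h₃⟩ (fun X hX => ih hK X hX)
      (fun X hX => hX.extOneVanishes_of_projective hF) X hX

end GorensteinProjective

/-! #### Gorenstein injective modules -/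

/-- `A` is the kernel of a surjection from an injective module to `B`, and linear maps from
injective modules to `B` lift. -/
def InjectiveStep (A B : ModuleCat.{u} S) : Prop :=
  ∃ (I : ModuleCat.{u} S) (i : A →ₗ[S] I) (p : I →ₗ[S] B), IsShortExact i p ∧
    Module.Injective S I ∧ ∀ E : ModuleCat.{u} S, Module.Injective S E →
      ∀ f : E →ₗ[S] B, ∃ g : E →ₗ[S] I, ∀ a, p (g a) = f a

theorem gorensteinInjective_of_class (𝒲 : ModuleCat.{u} S → Prop)
    (hright : ∀ W, 𝒲 W → ∃ W', 𝒲 W' ∧ InjectiveStep W W')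
    (hleft : ∀ W, 𝒲 W → ∃ W', 𝒲 W' ∧ InjectiveStep W' W)
    (W : ModuleCat.{u} S) (hW : 𝒲 W) : GorensteinInjective S W := by
  obtain ⟨Z, rfl, hZ⟩ := exists_int_chain _ 𝒲 hright hleft W hW
  choose P i p hip hP hQ using hZ
  refine ⟨P, fun j => i (j + 1) ∘ₗ p j, ⟨hP, exact_of_isShortExact hip, fun Q hQ' j g => ?_⟩,
    nonempty_equiv_ker (hip 0) _ (hip _).inj⟩
  constructor
  · intro hg
    obtain ⟨t, ht⟩ := (hip (j + 1)).exists_lift g (fun z =>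
      (hip (j + 1 + 1)).inj ((DFunLike.congr_fun hg z).trans (map_zero _).symm))
    obtain ⟨g', hg'⟩ := hQ j Q hQ' t
    exact ⟨g', LinearMap.ext fun x => by simp [hg', ht]⟩
  · rintro ⟨g', rfl⟩
    ext x
    simp [(hip (j + 1)).apply_apply]

theorem gorensteinInjective_ker {P : ℤ → ModuleCat.{u} S} {d : ∀ i, P i →ₗ[S] P (i + 1)}
    (h : IsCompleteInjectiveResolution P d) :
    (∀ j, GorensteinInjective S (ModuleCat.of S (LinearMap.ker (d j)))) ∧
      ∀ j k, k = j + 1 → InjectiveStep (ModuleCat.of S (LinearMap.ker (d j)))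
        (ModuleCat.of S (LinearMap.ker (d k))) := by
  have key : ∀ j k, k = j + 1 → InjectiveStep (ModuleCat.of S (LinearMap.ker (d j)))
        (ModuleCat.of S (LinearMap.ker (d k))) := by
    rintro j k rfl
    refine ⟨P j, (LinearMap.ker (d j)).subtype, toCycles h.exact j, isShortExact_toCycles _ j,
      h.injective j, fun E hE f => ?_⟩
    have hf : d (j + 1) ∘ₗ ((LinearMap.ker (d (j + 1))).subtype ∘ₗ f) = 0 :=
      LinearMap.ext fun x => (f x).2
    obtain ⟨g, hg⟩ := (h.hom_exact E hE j _).1 hf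
    exact ⟨g, fun a => Subtype.ext (DFunLike.congr_fun hg a)⟩
  refine ⟨fun j => gorensteinInjective_of_class
    (fun W => ∃ j, W = ModuleCat.of S (LinearMap.ker (d j))) ?_ ?_ _ ⟨j, rfl⟩, key⟩
  · rintro W ⟨j, rfl⟩
    exact ⟨_, ⟨j + 1, rfl⟩, key _ _ rfl⟩
  · rintro W ⟨j, rfl⟩
    exact ⟨_, ⟨j - 1, rfl⟩, key _ _ (by ring)⟩

namespace GorensteinInjective

theorem of_equiv {X Y : ModuleCat.{u} S} (h : GorensteinInjective S X) (e : X ≃ₗ[S] Y) :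
    GorensteinInjective S Y := by
  obtain ⟨P, d, hP, ⟨e'⟩⟩ := h
  exact ⟨P, d, hP, ⟨e.symm.trans e'⟩⟩

theorem exists_right {X : ModuleCat.{u} S} (h : GorensteinInjective S X) :
    ∃ X', GorensteinInjective S X' ∧ InjectiveStep X X' := by
  obtain ⟨P, d, hP, ⟨e⟩⟩ := h
  obtain ⟨Q, i, p, hip, hQ, hf⟩ := (gorensteinInjective_ker hP).2 0 (0 + 1) rfl
  exact ⟨_, (gorensteinInjective_ker hP).1 (0 + 1), Q, i ∘ₗ e.toLinearMap, p,
    hip.comp_equiv_left e, hQ, hf⟩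

theorem exists_left {X : ModuleCat.{u} S} (h : GorensteinInjective S X) :
    ∃ X', GorensteinInjective S X' ∧ InjectiveStep X' X := by
  obtain ⟨P, d, hP, ⟨e⟩⟩ := h
  obtain ⟨Q, i, p, hip, hQ, hf⟩ := (gorensteinInjective_ker hP).2 (-1) 0 (by norm_num)
  refine ⟨_, (gorensteinInjective_ker hP).1 (-1), Q, i, e.symm.toLinearMap ∘ₗ p,
    hip.comp_equiv_right e.symm, hQ, fun N hN f => ?_⟩
  obtain ⟨g, hg⟩ := hf N hN (e.toLinearMap ∘ₗ f)
  exact ⟨g, fun a => by simp [hg]⟩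

theorem extOneVanishes_of_injective {X E : ModuleCat.{u} S} (h : GorensteinInjective S X)
    (hE : Module.Injective S E) : ExtOneVanishes S E X := by
  obtain ⟨X', -, P, i, p, hip, hP, hf⟩ := h.exists_right
  exact .of_injective_presentation hip hP (hf E hE)

/-- The class of modules `N` with `Ext¹(N, X) = 0` for all Gorenstein injective `X` is closed
under kernels of surjections. -/
theorem extOneVanishes_kernel {N' N N'' : Type u} [AddCommGroup N'] [Module S N']
    [AddCommGroup N] [Module S N] [AddCommGroup N''] [Module S N''] {j : N' →ₗ[S] N}
    {q : N →ₗ[S] N''} (hjq : IsShortExact j q)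
    (h : ∀ X : ModuleCat.{u} S, GorensteinInjective S X → ExtOneVanishes S N X)
    (h'' : ∀ X : ModuleCat.{u} S, GorensteinInjective S X → ExtOneVanishes S N'' X)
    (X : ModuleCat.{u} S) (hX : GorensteinInjective S X) : ExtOneVanishes S N' X := by
  obtain ⟨X', hX', P, i, p, hip, hP, -⟩ := hX.exists_right
  refine .of_injective_presentation hip hP fun f => ?_
  obtain ⟨g, hg⟩ := h'' X' hX' _ _ j q hjq f
  obtain ⟨g', hg'⟩ := (h X hX).exists_lift hip g
  exact ⟨g' ∘ₗ j, fun k => by rw [LinearMap.comp_apply, hg', hg]⟩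

end GorensteinInjective

/-! #### Gorenstein flat modules -/

/-- `A` is the kernel of a surjection from a flat module to `B`, and stays a submodule after
tensoring with injective right modules. -/
def FlatStep (A B : ModuleCat.{u} S) : Prop :=
  ∃ (F : ModuleCat.{u} S) (i : A →ₗ[S] F) (p : F →ₗ[S] B), IsShortExact i p ∧
    IsFlatLeft S F ∧ ∀ E : ModuleCat.{u} Sᵐᵒᵖ, Module.Injective Sᵐᵒᵖ E →
      Function.Injective (RTensor.lTensor E i)

theorem gorensteinFlat_of_class (𝒲 : ModuleCat.{u} S → Prop)
    (hright : ∀ W, 𝒲 W → ∃ W', 𝒲 W' ∧ FlatStep W W')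
    (hleft : ∀ W, 𝒲 W → ∃ W', 𝒲 W' ∧ FlatStep W' W)
    (W : ModuleCat.{u} S) (hW : 𝒲 W) : GorensteinFlat S W := by
  obtain ⟨Z, rfl, hZ⟩ := exists_int_chain _ 𝒲 hright hleft W hW
  choose P i p hip hP hQ using hZ
  refine ⟨P, fun j => i (j + 1) ∘ₗ p j, ⟨hP, exact_of_isShortExact hip, fun E hE j t => ?_⟩,
    nonempty_equiv_ker (hip 0) _ (hip _).inj⟩
  constructor
  · intro ht
    rw [← RTensor.lTensor_lTensor] at ht
    obtain ⟨s, rfl⟩ := (RTensor.lTensor_exact _ _ (hip (j + 1)).exact (hip (j + 1)).surj t).1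
      (hQ (j + 1 + 1) E hE (ht.trans (map_zero _).symm))
    obtain ⟨w, rfl⟩ := RTensor.lTensor_surjective _ (hip j).surj s
    exact ⟨w, (RTensor.lTensor_lTensor _ _ w).symm⟩
  · rintro ⟨s, rfl⟩
    rw [RTensor.lTensor_lTensor]
    exact RTensor.lTensor_eq_zero _ (fun x => by simp [(hip (j + 1)).apply_apply]) s

namespace GorensteinFlat

/-- The dual of a Gorenstein flat module is Gorenstein injective. -/
theorem gorensteinInjective_leftDual {X : ModuleCat.{u} S} (h : GorensteinFlat S X) :
    GorensteinInjective Sᵐᵒᵖ (ModuleCat.of Sᵐᵒᵖ (LeftDual S X)) := by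
  obtain ⟨F, d, h, ⟨e⟩⟩ := h
  have key : ∀ j k, k = j + 1 →
      InjectiveStep (ModuleCat.of Sᵐᵒᵖ (LeftDual S (LinearMap.ker (d k))))
        (ModuleCat.of Sᵐᵒᵖ (LeftDual S (LinearMap.ker (d j)))) := by
    rintro j k rfl
    refine ⟨ModuleCat.of Sᵐᵒᵖ (LeftDual S (F j)), LeftDual.map (toCycles h.exact j),
      LeftDual.map (LinearMap.ker (d j)).subtype,
      LeftDual.map_isShortExact (isShortExact_toCycles h.exact j),
      (isFlatLeft_iff_injective_leftDual _).1 (h.flat j), fun E hE => ?_⟩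
    -- By adjunction, lifting maps `E → (ker d)⁺` to `F⁺` means that `E ⊗ ker d → E ⊗ F` is
    -- injective. This follows from exactness of `E ⊗ F` at the preceding degree.
    refine (RTensor.lTensor_injective_iff_of_left _).1 ?_
    rw [injective_iff_map_eq_zero]
    intro t ht
    obtain ⟨l, rfl⟩ : ∃ l, j = l + 1 + 1 := ⟨j - 2, by ring⟩
    obtain ⟨s, rfl⟩ := RTensor.lTensor_surjective _ (isShortExact_toCycles h.exact (l + 1)).surj t
    rw [RTensor.lTensor_lTensor] at ht
    obtain ⟨w, rfl⟩ := (h.tensor_exact E hE l s).1 ht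
    rw [RTensor.lTensor_lTensor]
    exact RTensor.lTensor_eq_zero _ (fun x =>
      Subtype.ext ((h.exact l).apply_apply_eq_zero x)) w
  have h0 : GorensteinInjective Sᵐᵒᵖ (ModuleCat.of Sᵐᵒᵖ (LeftDual S (LinearMap.ker (d 0)))) := by
    refine gorensteinInjective_of_class
      -- Dualising reverses the complex: steps to the right now lower the index.
      (fun W => ∃ j, W = ModuleCat.of Sᵐᵒᵖ (LeftDual S (LinearMap.ker (d j)))) ?_ ?_ _ ⟨0, rfl⟩
    · rintro W ⟨j, rfl⟩
      exact ⟨_, ⟨j - 1, rfl⟩, key _ _ (by ring)⟩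
    · rintro W ⟨j, rfl⟩
      exact ⟨_, ⟨j + 1, rfl⟩, key _ _ rfl⟩
  refine h0.of_equiv (LinearEquiv.ofLinearMap (LeftDual.map e.toLinearMap)
    (LeftDual.map e.symm.toLinearMap) ?_ ?_)
  · ext φ : 1
    exact DFunLike.ext _ _ fun x => by simp
  · ext φ : 1
    exact DFunLike.ext _ _ fun x => by simp

end GorensteinFlat

end Chains

/-! ### Left modules over the trivial extension -/

noncomputable section LeftModules

variable {R : Type u} [Ring R] {M : Type u} [AddCommGroup M] [Module R M] [Module Rᵐᵒᵖ M]
  [SMulCommClass R Rᵐᵒᵖ M]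

/-- Associativity of the tensor product in the weak form needed here: for fixed `x` the assignment
`m ⊗ m' ↦ m ⊗ (m' ⊗ x)` is a homomorphism on `M ⊗ M`. -/
theorem subsingleton_tensor_tensor (hM : Subsingleton (RTensor R M M)) (X : Type*)
    [AddCommGroup X] [Module R X] : Subsingleton (RTensor R M (RTensor R M X)) := by
  have key : ∀ (m m' : M) (x : X), RTensor.tmul R m (RTensor.tmul R m' x) = 0 := by
    intro m m' x
    let f : RTensor R M M →+ RTensor R M (RTensor R M X) := RTensor.lift
      (AddMonoidHom.mk' (fun m => AddMonoidHom.mk'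
          (fun m' => RTensor.tmul R m (RTensor.tmul R m' x))
          (fun a b => by rw [RTensor.add_tmul, RTensor.tmul_add]))
        (fun a b => by ext m'; simp [RTensor.add_tmul]))
      (fun r m m' => by simp [RTensor.smul_tmul, RTensor.smul_tmul_left])
    have h : f (RTensor.tmul R m m') = RTensor.tmul R m (RTensor.tmul R m' x) := rfl
    rw [← h, Subsingleton.elim (RTensor.tmul R m m') 0, map_zero]
  refine subsingleton_of_forall_eq 0 fun t => ?_
  induction t using RTensor.induction_on with
  | zero => rfl
  | add s t hs ht => rw [hs, ht, add_zero]
  | tmul m y =>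
    induction y using RTensor.induction_on with
    | zero => rw [RTensor.tmul_zero]
    | add s t hs ht => rw [RTensor.tmul_add, hs, ht, add_zero]
    | tmul m' x => exact key m m' x

/-- A linear map over `R ⋉ M` as a linear map over `R`. -/
def restrictLeft {X Y : ModuleCat.{u} (TrivSqZeroExt R M)} (f : X →ₗ[TrivSqZeroExt R M] Y) :
    underlyingLeft R M X →ₗ[R] underlyingLeft R M Y where
  toFun x := f x
  map_add' := map_add f
  map_smul' r x := f.map_smul (TrivSqZeroExt.inl r : TrivSqZeroExt R M) x

theorem leftStructureMap_restrictLeft {X Y : ModuleCat.{u} (TrivSqZeroExt R M)}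
    (f : X →ₗ[TrivSqZeroExt R M] Y) (t : RTensor R M (underlyingLeft R M X)) :
    leftStructureMap R M Y (RTensor.lTensor M (restrictLeft f) t) =
      restrictLeft f (leftStructureMap R M X t) := by
  induction t using RTensor.induction_on with
  | zero => simp
  | add s t hs ht => rw [map_add, map_add, map_add, map_add, hs, ht]
  | tmul m x => exact (f.map_smul (TrivSqZeroExt.inr m : TrivSqZeroExt R M) x).symm

/-- An `R`-linear map compatible with the structure maps is linear over `R ⋉ M`. -/
def linearOfRestrictLeft {X Y : ModuleCat.{u} (TrivSqZeroExt R M)}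
    (g : underlyingLeft R M X →ₗ[R] underlyingLeft R M Y)
    (hg : ∀ (m : M) (x : underlyingLeft R M X), g (leftStructureMap R M X (RTensor.tmul R m x)) =
      leftStructureMap R M Y (RTensor.tmul R m (g x))) : X →ₗ[TrivSqZeroExt R M] Y where
  toFun x := g x
  map_add' := map_add g
  map_smul' t x := by
    have h₁ : ∀ (Z : ModuleCat.{u} (TrivSqZeroExt R M)) (z : Z), t • z =
        (TrivSqZeroExt.inl t.fst : TrivSqZeroExt R M) • z +
          (TrivSqZeroExt.inr t.snd : TrivSqZeroExt R M) • z := fun Z z => by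
      rw [← add_smul, TrivSqZeroExt.inl_fst_add_inr_snd_eq]
    exact (congrArg (fun z : X => (g z : Y)) (h₁ X x)).trans ((map_add g _ _).trans
      ((congrArg₂ (· + ·) (g.map_smul t.fst x) (hg t.snd x)).trans (h₁ Y (g x)).symm))

theorem isShortExact_restrictLeft {X Y Z : ModuleCat.{u} (TrivSqZeroExt R M)}
    {i : X →ₗ[TrivSqZeroExt R M] Y} {p : Y →ₗ[TrivSqZeroExt R M] Z} (h : IsShortExact i p) :
    IsShortExact (restrictLeft i) (restrictLeft p) := ⟨h.inj, h.exact, h.surj⟩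

theorem isShortExact_of_restrictLeft {X Y Z : ModuleCat.{u} (TrivSqZeroExt R M)}
    {i : X →ₗ[TrivSqZeroExt R M] Y} {p : Y →ₗ[TrivSqZeroExt R M] Z}
    (h : IsShortExact (restrictLeft i) (restrictLeft p)) : IsShortExact i p :=
  ⟨h.inj, h.exact, h.surj⟩

/-- The composition of two structure maps vanishes. -/
theorem leftStructureMap_leftStructureMap (X : ModuleCat.{u} (TrivSqZeroExt R M)) (m : M)
    (t : RTensor R M (underlyingLeft R M X)) :
    leftStructureMap R M X (RTensor.tmul R m (leftStructureMap R M X t)) = 0 := by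
  induction t using RTensor.induction_on with
  | zero => rw [map_zero, RTensor.tmul_zero, map_zero]
  | add s t hs ht => rw [map_add, RTensor.tmul_add, map_add, hs, ht, add_zero]
  | tmul m' x =>
    change (TrivSqZeroExt.inr m : TrivSqZeroExt R M) •
      (TrivSqZeroExt.inr m' : TrivSqZeroExt R M) • (show X from x) = 0
    rw [← mul_smul, TrivSqZeroExt.inr_mul_inr, zero_smul]

/-! #### Modules from pairs -/

section LeftPair

variable (X : Type u) [AddCommGroup X] [Module R X] (u : RTensor R M X →ₗ[R] X)
  (hu : ∀ (m : M) (t : RTensor R M X), u (RTensor.tmul R m (u t)) = 0)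

/-- The `R ⋉ M`-module structure given by a pair `(X, u)`. -/
@[reducible]
def leftPairModule : Module (TrivSqZeroExt R M) X where
  smul t x := t.fst • x + u (RTensor.tmul R t.snd x)
  one_smul x := by
    change (1 : R) • x + u (RTensor.tmul R (0 : M) x) = x
    rw [one_smul, RTensor.zero_tmul, map_zero, add_zero]
  mul_smul s t x := by
    change (s * t).fst • x + u (RTensor.tmul R (s * t).snd x) =
      s.fst • (t.fst • x + u (RTensor.tmul R t.snd x)) +
        u (RTensor.tmul R s.snd (t.fst • x + u (RTensor.tmul R t.snd x)))
    rw [RTensor.tmul_add, map_add, hu, add_zero, TrivSqZeroExt.fst_mul, TrivSqZeroExt.snd_mul,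
      mul_smul, smul_add, RTensor.add_tmul, ← RTensor.smul_tmul_left, RTensor.smul_tmul, map_add,
      map_smul, add_assoc]
  smul_zero t := by
    change t.fst • (0 : X) + u (RTensor.tmul R t.snd 0) = 0
    rw [smul_zero, RTensor.tmul_zero, map_zero, add_zero]
  smul_add t x y := by
    change t.fst • (x + y) + u (RTensor.tmul R t.snd (x + y)) =
      (t.fst • x + u (RTensor.tmul R t.snd x)) + (t.fst • y + u (RTensor.tmul R t.snd y))
    rw [smul_add, RTensor.tmul_add, map_add, add_add_add_comm]
  add_smul s t x := by
    change (s.fst + t.fst) • x + u (RTensor.tmul R (s.snd + t.snd) x) =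
      (s.fst • x + u (RTensor.tmul R s.snd x)) + (t.fst • x + u (RTensor.tmul R t.snd x))
    rw [add_smul, RTensor.add_tmul, map_add, add_add_add_comm]
  zero_smul x := by
    change (0 : R) • x + u (RTensor.tmul R (0 : M) x) = 0
    rw [zero_smul, RTensor.zero_tmul, map_zero, add_zero]

/-- The `R ⋉ M`-module given by a pair `(X, u)`. -/
def leftPair : ModuleCat.{u} (TrivSqZeroExt R M) :=
  letI := leftPairModule X u hu
  ModuleCat.of (TrivSqZeroExt R M) X

/-- The underlying module of the pair `(X, u)` is `X`. -/
def leftPairEquiv : underlyingLeft R M (leftPair X u hu) ≃ₗ[R] X where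
  toFun x := x
  invFun x := x
  left_inv _ := rfl
  right_inv _ := rfl
  map_add' _ _ := rfl
  map_smul' r x := by
    change r • (show X from x) + u (RTensor.tmul R (0 : M) (show X from x)) = r • (show X from x)
    rw [RTensor.zero_tmul, map_zero, add_zero]

theorem leftPairEquiv_leftStructureMap (m : M) (x : underlyingLeft R M (leftPair X u hu)) :
    leftPairEquiv X u hu (leftStructureMap R M (leftPair X u hu) (RTensor.tmul R m x)) =
      u (RTensor.tmul R m (leftPairEquiv X u hu x)) := by
  change (0 : R) • (show X from x) + u (RTensor.tmul R m (show X from x)) =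
    u (RTensor.tmul R m (show X from x))
  rw [zero_smul, zero_add]

end LeftPair

variable (R M) in
/-- An `R`-module as an `R ⋉ M`-module on which `M` acts by zero. -/
def trivialLeft (N : Type u) [AddCommGroup N] [Module R N] : ModuleCat.{u} (TrivSqZeroExt R M) :=
  leftPair N (0 : RTensor R M N →ₗ[R] N) fun _ _ => rfl

variable (R M) in
/-- The underlying `R`-module of a module with trivial action of `M`. -/
def trivialLeftEquiv (N : Type u) [AddCommGroup N] [Module R N] :
    underlyingLeft R M (trivialLeft R M N) ≃ₗ[R] N :=
  leftPairEquiv N (0 : RTensor R M N →ₗ[R] N) fun _ _ => rfl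

theorem leftStructureMap_trivialLeft (N : Type u) [AddCommGroup N] [Module R N] (m : M)
    (x : underlyingLeft R M (trivialLeft R M N)) :
    leftStructureMap R M (trivialLeft R M N) (RTensor.tmul R m x) = 0 :=
  (trivialLeftEquiv R M N).injective
    ((leftPairEquiv_leftStructureMap N (0 : RTensor R M N →ₗ[R] N) (fun _ _ => rfl) m x).trans
      (map_zero _).symm)

section Trivial

variable {X : ModuleCat.{u} (TrivSqZeroExt R M)} {N N' : Type u} [AddCommGroup N] [Module R N]
  [AddCommGroup N'] [Module R N']

/-- An `R`-linear map that vanishes on the image of `M`, as an `R ⋉ M`-linear map to a module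
with trivial action. -/
def toTrivialLeft (f : underlyingLeft R M X →ₗ[R] N)
    (hf : ∀ (m : M) (x : underlyingLeft R M X),
      f (leftStructureMap R M X (RTensor.tmul R m x)) = 0) :
    X →ₗ[TrivSqZeroExt R M] trivialLeft R M N :=
  linearOfRestrictLeft ((trivialLeftEquiv R M N).symm.toLinearMap ∘ₗ f) fun m x => by
    rw [leftStructureMap_trivialLeft, LinearMap.comp_apply, hf, map_zero]

theorem restrictLeft_trivialLeft_leftStructureMap (f : X →ₗ[TrivSqZeroExt R M] trivialLeft R M N)
    (m : M) (x : underlyingLeft R M X) :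
    restrictLeft f (leftStructureMap R M X (RTensor.tmul R m x)) = 0 := by
  rw [← leftStructureMap_restrictLeft, RTensor.lTensor_tmul, leftStructureMap_trivialLeft]

/-- Linear maps between modules with trivial action. -/
def mapTrivialLeft (f : N →ₗ[R] N') :
    trivialLeft R M N →ₗ[TrivSqZeroExt R M] trivialLeft R M N' :=
  toTrivialLeft (f ∘ₗ (trivialLeftEquiv R M N).toLinearMap) fun m x => by
    rw [leftStructureMap_trivialLeft, map_zero]

end Trivial

variable (R M) in
/-- The induced module `(R ⋉ M) ⊗_R P = P ⊕ M ⊗_R P`. -/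
def inducedLeft (P : Type u) [AddCommGroup P] [Module R P] : ModuleCat.{u} (TrivSqZeroExt R M) :=
  leftPair (P × RTensor R M P)
    (LinearMap.inr R P (RTensor R M P) ∘ₗ RTensor.lTensorLinear M (LinearMap.fst R P _))
    fun m t => by
      simp [RTensor.tmul_zero]

variable (R M) in
/-- The underlying `R`-module of an induced module. -/
def inducedLeftEquiv (P : Type u) [AddCommGroup P] [Module R P] :
    underlyingLeft R M (inducedLeft R M P) ≃ₗ[R] P × RTensor R M P :=
  leftPairEquiv (P × RTensor R M P)
    (LinearMap.inr R P (RTensor R M P) ∘ₗ RTensor.lTensorLinear M (LinearMap.fst R P _))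
    fun m t => by
      simp [RTensor.tmul_zero]

theorem leftStructureMap_inducedLeft (P : Type u) [AddCommGroup P] [Module R P] (m : M)
    (x : underlyingLeft R M (inducedLeft R M P)) :
    leftStructureMap R M (inducedLeft R M P) (RTensor.tmul R m x) =
      (inducedLeftEquiv R M P).symm (0, RTensor.tmul R m (inducedLeftEquiv R M P x).1) :=
  (inducedLeftEquiv R M P).injective
    ((leftPairEquiv_leftStructureMap (P × RTensor R M P) _ _ m x).trans
      ((inducedLeftEquiv R M P).apply_symm_apply _).symm)

/-! #### Extensions of `C` by `M ⊗ C` -/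

/-- The structure map of the left module `X` factors as `M ⊗ X → M ⊗ C → X`, where
`0 → M ⊗ C → X → C → 0` is exact. -/
structure IsLeftExtension (X : ModuleCat.{u} (TrivSqZeroExt R M)) (C : Type u) [AddCommGroup C]
    [Module R C] (j : RTensor R M C →ₗ[R] underlyingLeft R M X)
    (π : underlyingLeft R M X →ₗ[R] C) : Prop where
  ses : IsShortExact j π
  structureMap_eq : ∀ (m : M) (x : underlyingLeft R M X),
    leftStructureMap R M X (RTensor.tmul R m x) = j (RTensor.tmul R m (π x))

theorem isLeftExtension_inducedLeft (P : Type u) [AddCommGroup P] [Module R P] :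
    IsLeftExtension (inducedLeft R M P) P
      ((inducedLeftEquiv R M P).symm.toLinearMap ∘ₗ LinearMap.inr R P (RTensor R M P))
      (LinearMap.fst R P (RTensor R M P) ∘ₗ (inducedLeftEquiv R M P).toLinearMap) where
  ses :=
    { inj := (inducedLeftEquiv R M P).symm.injective.comp LinearMap.inr_injective
      exact := fun x => by
        constructor
        · intro h
          refine ⟨(inducedLeftEquiv R M P x).2, ?_⟩
          rw [LinearMap.comp_apply, LinearEquiv.coe_coe, LinearEquiv.symm_apply_eq]
          exact Prod.ext h.symm rfl
        · rintro ⟨t, rfl⟩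
          simp
      surj := fun p => ⟨(inducedLeftEquiv R M P).symm (p, 0), by simp⟩ }
  structureMap_eq := fun m x => leftStructureMap_inducedLeft P m x

namespace IsLeftExtension

variable {X : ModuleCat.{u} (TrivSqZeroExt R M)} {C : Type u} [AddCommGroup C]
    [Module R C] {j : RTensor R M C →ₗ[R] underlyingLeft R M X}
    {π : underlyingLeft R M X →ₗ[R] C}

theorem j_lTensor (h : IsLeftExtension X C j π) (t : RTensor R M (underlyingLeft R M X)) :
    j (RTensor.lTensor M π t) = leftStructureMap R M X t := by
  induction t using RTensor.induction_on with
  | zero => simp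
  | add s t hs ht => rw [map_add, map_add, map_add, hs, ht]
  | tmul m x => exact (h.structureMap_eq m x).symm

theorem map_j_eq_zero (h : IsLeftExtension X C j π) {N : Type*} [AddCommGroup N] [Module R N]
    (f : underlyingLeft R M X →ₗ[R] N) (hf : ∀ (m : M) (x : underlyingLeft R M X),
      f (leftStructureMap R M X (RTensor.tmul R m x)) = 0)
    (t : RTensor R M C) : f (j t) = 0 := by
  obtain ⟨s, rfl⟩ := RTensor.lTensor_surjective π h.ses.surj t
  rw [h.j_lTensor]
  induction s using RTensor.induction_on with
  | zero => simp
  | add s t hs ht => rw [map_add, map_add, hs, ht, add_zero]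
  | tmul m x => exact hf m x

/-- Linear maps from `X` that vanish on the image of `M` factor through `C`. -/
theorem exists_desc (h : IsLeftExtension X C j π) {N : Type*} [AddCommGroup N] [Module R N]
    (f : underlyingLeft R M X →ₗ[R] N) (hf : ∀ (m : M) (x : underlyingLeft R M X),
      f (leftStructureMap R M X (RTensor.tmul R m x)) = 0) :
    ∃ g : C →ₗ[R] N, ∀ x, g (π x) = f x :=
  h.ses.exists_desc f (h.map_j_eq_zero f hf)

theorem π_structureMap (h : IsLeftExtension X C j π) (m : M) (x : underlyingLeft R M X) :
    π (leftStructureMap R M X (RTensor.tmul R m x)) = 0 := by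
  rw [h.structureMap_eq, h.ses.apply_apply]

theorem structureMap_j (h : IsLeftExtension X C j π) (m : M) (t : RTensor R M C) :
    leftStructureMap R M X (RTensor.tmul R m (j t)) = 0 := by
  rw [h.structureMap_eq, h.ses.apply_apply, RTensor.tmul_zero, map_zero]

/-- By right exactness the kernel is the image of `M ⊗ (M ⊗ C) = 0`. -/
theorem lTensor_bijective (hM : Subsingleton (RTensor R M M)) (h : IsLeftExtension X C j π) :
    Function.Bijective (RTensor.lTensor M π) := by
  refine ⟨(injective_iff_map_eq_zero _).2 fun t ht => ?_, RTensor.lTensor_surjective _ h.ses.surj⟩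
  obtain ⟨s, rfl⟩ := (RTensor.lTensor_exact j π h.ses.exact h.ses.surj t).1 ht
  have := subsingleton_tensor_tensor hM C
  rw [Subsingleton.elim s 0, map_zero]

theorem injective_leftStructureMap (hM : Subsingleton (RTensor R M M))
    (h : IsLeftExtension X C j π) : Function.Injective (leftStructureMap R M X) := fun s t e =>
  (h.lTensor_bijective hM).1 (h.ses.inj (by rw [h.j_lTensor, h.j_lTensor, e]))

theorem nonempty_equiv_coker (h : IsLeftExtension X C j π) :
    Nonempty (C ≃ₗ[R] underlyingLeft R M X ⧸ LinearMap.range (leftStructureMap R M X)) := by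
  have hr : LinearMap.range (leftStructureMap R M X) = LinearMap.ker π := by
    ext x
    rw [LinearMap.mem_ker]
    constructor
    · rintro ⟨t, rfl⟩
      rw [← h.j_lTensor, h.ses.apply_apply]
    · intro hx
      obtain ⟨t, rfl⟩ := h.ses.exists_of_eq_zero hx
      obtain ⟨s, rfl⟩ := RTensor.lTensor_surjective π h.ses.surj t
      exact ⟨s, (h.j_lTensor s).symm⟩
  exact ⟨((Submodule.quotEquivOfEq _ _ hr).trans
    (LinearMap.quotKerEquivOfSurjective π h.ses.surj)).symm⟩

end IsLeftExtension

/-- `M ⊗ X → M ⊗ coker u` is an isomorphism, since its kernel is the image of `M ⊗ (M ⊗ X) = 0`. The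
map `j` is `u` transported along its inverse. -/
theorem exists_isLeftExtension (hM : Subsingleton (RTensor R M M))
    (X : ModuleCat.{u} (TrivSqZeroExt R M)) (h : Function.Injective (leftStructureMap R M X)) :
    ∃ j, IsLeftExtension X
      (underlyingLeft R M X ⧸ LinearMap.range (leftStructureMap R M X)) j
      (LinearMap.range (leftStructureMap R M X)).mkQ := by
  have hs := isShortExact_range_mkQ _ h
  have hb : Function.Bijective (RTensor.lTensorLinear M
      (LinearMap.range (leftStructureMap R M X)).mkQ) := by
    refine ⟨(injective_iff_map_eq_zero _).2 fun t ht => ?_,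
      RTensor.lTensor_surjective _ hs.surj⟩
    obtain ⟨s, rfl⟩ := (RTensor.lTensor_exact _ _ hs.exact hs.surj t).1 ht
    have := subsingleton_tensor_tensor hM (underlyingLeft R M X)
    rw [Subsingleton.elim s 0, map_zero]
  let e := LinearEquiv.ofBijective _ hb
  have he : ∀ t, e t = RTensor.lTensor M (LinearMap.range (leftStructureMap R M X)).mkQ t :=
    fun t => rfl
  refine ⟨leftStructureMap R M X ∘ₗ e.symm.toLinearMap, hs.comp_equiv_left e.symm,
    fun m x => ?_⟩
  rw [LinearMap.comp_apply]
  congr 1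
  rw [LinearEquiv.coe_coe, LinearEquiv.eq_symm_apply, he]
  rfl

/-- The form of Φ used in all arguments: the cokernel may be replaced by any isomorphic `C`, and the
kernel of `π` is known as `M ⊗ C`. -/
theorem phiClass_iff (hM : Subsingleton (RTensor R M M)) (𝒳 : ObjectProperty (ModuleCat.{u} R))
    (h𝒳 : ∀ X Y : ModuleCat.{u} R, 𝒳 X → Nonempty (X ≃ₗ[R] Y) → 𝒳 Y)
    (X : ModuleCat.{u} (TrivSqZeroExt R M)) :
    PhiClass M 𝒳 X ↔ ∃ C : ModuleCat.{u} R, 𝒳 C ∧ ∃ j π, IsLeftExtension X C j π := by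
  constructor
  · rintro ⟨h₁, h₂⟩
    obtain ⟨j, hj⟩ := exists_isLeftExtension hM X h₁
    exact ⟨_, h₂, j, _, hj⟩
  · rintro ⟨C, hC, j, π, h⟩
    exact ⟨h.injective_leftStructureMap hM, h𝒳 _ _ hC h.nonempty_equiv_coker⟩

/-! #### Induced modules and projective modules -/

section Induced

variable {P : Type u} [AddCommGroup P] [Module R P] {X Y : ModuleCat.{u} (TrivSqZeroExt R M)}

/-- The `R ⋉ M`-linear map from an induced module given by an `R`-linear map. -/
def inducedLift (g : P →ₗ[R] underlyingLeft R M X) :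
    inducedLeft R M P →ₗ[TrivSqZeroExt R M] X :=
  linearOfRestrictLeft
    (g.coprod (leftStructureMap R M X ∘ₗ RTensor.lTensorLinear M g) ∘ₗ
      (inducedLeftEquiv R M P).toLinearMap) fun m x => by
    rw [leftStructureMap_inducedLeft]
    simp [RTensor.tmul_add, leftStructureMap_leftStructureMap]

theorem restrictLeft_inducedLift (g : P →ₗ[R] underlyingLeft R M X)
    (x : underlyingLeft R M (inducedLeft R M P)) : restrictLeft (inducedLift g) x =
      g (inducedLeftEquiv R M P x).1 +
        leftStructureMap R M X (RTensor.lTensor M g (inducedLeftEquiv R M P x).2) := rfl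

/-- Linear maps from an induced module are determined by their values on `P`. -/
theorem induced_hom_ext {f g : inducedLeft R M P →ₗ[TrivSqZeroExt R M] X}
    (h : ∀ p, restrictLeft f ((inducedLeftEquiv R M P).symm (p, 0)) =
      restrictLeft g ((inducedLeftEquiv R M P).symm (p, 0))) : f = g := by
  have key : ∀ t : RTensor R M P, restrictLeft f ((inducedLeftEquiv R M P).symm (0, t)) =
      restrictLeft g ((inducedLeftEquiv R M P).symm (0, t)) := by
    intro t
    induction t using RTensor.induction_on with
    | zero => exact h 0
    | add s t hs ht =>
      have e : ((0, s + t) : P × RTensor R M P) = (0, s) + (0, t) := by simp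
      rw [e, map_add, map_add, map_add, hs, ht]
    | tmul m p =>
      have e := leftStructureMap_inducedLeft P m ((inducedLeftEquiv R M P).symm (p, 0))
      rw [LinearEquiv.apply_symm_apply] at e
      rw [← e, ← leftStructureMap_restrictLeft, ← leftStructureMap_restrictLeft,
        RTensor.lTensor_tmul, RTensor.lTensor_tmul, h]
  have hx : ∀ x : underlyingLeft R M (inducedLeft R M P), restrictLeft f x = restrictLeft g x := by
    intro x
    have e : x = (inducedLeftEquiv R M P).symm ((inducedLeftEquiv R M P x).1, 0) +
        (inducedLeftEquiv R M P).symm (0, (inducedLeftEquiv R M P x).2) := by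
      rw [← map_add, LinearEquiv.eq_symm_apply]
      simp
    rw [e, map_add, map_add, h, key]
  exact LinearMap.ext hx

/-- Induction is left adjoint to restriction, and restriction preserves surjections. -/
theorem projective_inducedLeft (hP : Module.Projective R P) :
    Module.Projective (TrivSqZeroExt R M) (inducedLeft R M P) := by
  refine Module.Projective.of_lifting_property'' fun f hf => ?_
  let F : ModuleCat.{u} (TrivSqZeroExt R M) :=
    ModuleCat.of _ (inducedLeft R M P →₀ TrivSqZeroExt R M)
  let f' : F →ₗ[TrivSqZeroExt R M] inducedLeft R M P := f
  obtain ⟨g, hg⟩ := Module.projective_lifting_property (restrictLeft f')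
    ((inducedLeftEquiv R M P).symm.toLinearMap ∘ₗ LinearMap.inl R P _) hf
  refine ⟨inducedLift (X := F) g, induced_hom_ext fun p => ?_⟩
  change restrictLeft f' (restrictLeft (inducedLift (X := F) g) _) = _
  rw [restrictLeft_inducedLift, LinearEquiv.apply_symm_apply, map_zero, map_zero, add_zero]
  exact DFunLike.congr_fun hg p

/-- Naturality of the structure map: `u_Y ∘ (M ⊗ f) = f ∘ u_X`, and the left side is injective. -/
theorem injective_leftStructureMap_of_lTensor_injective
    (h : Function.Injective (leftStructureMap R M Y)) (f : X →ₗ[TrivSqZeroExt R M] Y)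
    (hf : Function.Injective (RTensor.lTensor M (restrictLeft f))) :
    Function.Injective (leftStructureMap R M X) := fun s t e =>
  hf (h (by rw [leftStructureMap_restrictLeft, leftStructureMap_restrictLeft, e]))

/-- Projective modules over `R ⋉ M` are extensions of projective modules over `R`. -/
theorem exists_isLeftExtension_of_projective (hM : Subsingleton (RTensor R M M))
    (L : ModuleCat.{u} (TrivSqZeroExt R M)) (hL : Module.Projective (TrivSqZeroExt R M) L) :
    ∃ C : ModuleCat.{u} R, Module.Projective R C ∧ ∃ j π, IsLeftExtension L C j π := by
  -- `L` is a quotient, hence a retract, of the module induced from its underlying `R`-module.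
  have hinj : Function.Injective (leftStructureMap R M L) := by
    let g : underlyingLeft R M L →ₗ[R] underlyingLeft R M L := LinearMap.id
    have hs : Function.Surjective (inducedLift g) := fun x =>
      ⟨(inducedLeftEquiv R M (underlyingLeft R M L)).symm (x, 0), by
        refine (restrictLeft_inducedLift g _).trans ?_
        rw [LinearEquiv.apply_symm_apply, map_zero, map_zero, add_zero]
        rfl⟩
    obtain ⟨s, hs⟩ := Module.projective_lifting_property _ LinearMap.id hs
    exact injective_leftStructureMap_of_lTensor_injective
      ((isLeftExtension_inducedLeft _).injective_leftStructureMap hM) s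
      (RTensor.lTensor_injective_of_retract _ (restrictLeft (inducedLift g))
        fun x => DFunLike.congr_fun hs x)
  obtain ⟨j, hj⟩ := exists_isLeftExtension hM L hinj
  refine ⟨ModuleCat.of R _, ?_, j, _, hj⟩
  -- Maps from `C` to an `R`-module `N` are the maps from `L` to `N` with trivial action, so
  -- projectivity descends from `L` to its quotient `C`.
  refine Module.Projective.of_lifting_property'' fun f hf => ?_
  obtain ⟨g, hg⟩ := Module.projective_lifting_property (mapTrivialLeft (M := M) f)
    (toTrivialLeft _ hj.π_structureMap) hf
  obtain ⟨g', hg'⟩ := hj.exists_desc ((trivialLeftEquiv R M _).toLinearMap ∘ₗ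
    restrictLeft g)
    (fun m x => by
      rw [LinearMap.comp_apply, restrictLeft_trivialLeft_leftStructureMap, map_zero])
  refine ⟨g', LinearMap.ext fun c => ?_⟩
  obtain ⟨x, rfl⟩ := hj.ses.surj c
  rw [LinearMap.comp_apply, hg']
  exact DFunLike.congr_fun hg x

end Induced

end LeftModules

/-! ### Gorenstein projective modules over the trivial extension -/

section GorensteinProjectiveExtension

variable {R : Type u} [Ring R] {M : Type u} [AddCommGroup M] [Module R M] [Module Rᵐᵒᵖ M]
  [SMulCommClass R Rᵐᵒᵖ M]

namespace IsLeftExtension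

variable {X : ModuleCat.{u} (TrivSqZeroExt R M)} {C : Type u} [AddCommGroup C]
    [Module R C] {j : RTensor R M C →ₗ[R] underlyingLeft R M X}
    {π : underlyingLeft R M X →ₗ[R] C}

/-- A projective presentation of `C` induces one of an extension of `C` by `M ⊗ C`. -/
theorem exists_cover (h : IsLeftExtension X C j π) {C' P : Type u} [AddCommGroup C'] [Module R C']
    [AddCommGroup P] [Module R P] {κ : C' →ₗ[R] P} {ε : P →ₗ[R] C} (hκε : IsShortExact κ ε)
    (hP : Module.Projective R P) (hκ : Function.Injective (RTensor.lTensor M κ)) :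
    ∃ (K : ModuleCat.{u} (TrivSqZeroExt R M)) (i : K →ₗ[TrivSqZeroExt R M] inducedLeft R M P)
      (q : inducedLeft R M P →ₗ[TrivSqZeroExt R M] X), IsShortExact i q ∧
      ∃ jK πK, IsLeftExtension K C' jK πK ∧
        ∀ k, κ (πK k) = (inducedLeftEquiv R M P (restrictLeft i k)).1 := by
  -- As in the horseshoe lemma, a lift `s` of `ε` to `X` extends to a surjection from the induced
  -- module; on the summand `M ⊗ P` it is `j ∘ (M ⊗ ε)`.
  obtain ⟨s, hs⟩ := Module.projective_lifting_property π ε h.ses.surj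
  have hs : ∀ p, π (s p) = ε p := fun p => DFunLike.congr_fun hs p
  have hG : ∀ x, restrictLeft (inducedLift s) x = s (inducedLeftEquiv R M P x).1 +
      j (RTensor.lTensor M ε (inducedLeftEquiv R M P x).2) := fun x => by
    rw [restrictLeft_inducedLift, ← h.j_lTensor, RTensor.lTensor_lTensor]
    congr 4
  have hGs : Function.Surjective (restrictLeft (inducedLift s)) := fun y => by
    obtain ⟨p, hp⟩ := hκε.surj (π y)
    obtain ⟨t, ht⟩ := h.ses.exists_of_eq (l := y) (l' := s p) (by rw [hs, hp])
    obtain ⟨t, rfl⟩ := RTensor.lTensor_surjective ε hκε.surj t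
    refine ⟨(inducedLeftEquiv R M P).symm (p, t), (hG _).trans ?_⟩
    rw [LinearEquiv.apply_symm_apply, ht]
    exact add_sub_cancel _ _
  let K : ModuleCat.{u} (TrivSqZeroExt R M) := ModuleCat.of _ (LinearMap.ker (inducedLift s))
  let i : K →ₗ[TrivSqZeroExt R M] inducedLeft R M P := (LinearMap.ker (inducedLift s)).subtype
  have hi : IsShortExact i (inducedLift s) := isShortExact_ker_subtype _ hGs
  have hi' := isShortExact_restrictLeft hi
  obtain ⟨πK, hπK⟩ := hκε.exists_lift
    (LinearMap.fst R P _ ∘ₗ (inducedLeftEquiv R M P).toLinearMap ∘ₗ restrictLeft i) (fun k => by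
      have := congrArg π (hi'.apply_apply k)
      rw [hG, map_add, hs, h.ses.apply_apply, add_zero, map_zero] at this
      exact this)
  have hπK : ∀ k, κ (πK k) = (inducedLeftEquiv R M P (restrictLeft i k)).1 := hπK
  -- `M ⊗ C'` embeds in the kernel through the second summand, by injectivity of `M ⊗ κ`.
  obtain ⟨jK, hjK⟩ := hi'.exists_lift
    ((inducedLeftEquiv R M P).symm.toLinearMap ∘ₗ LinearMap.inr R P _ ∘ₗ
      RTensor.lTensorLinear M κ) (fun t => by
      rw [hG]
      simp [RTensor.lTensor_lTensor,
        RTensor.lTensor_eq_zero (ε ∘ₗ κ) (fun c => hκε.apply_apply c)])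
  have hjK : ∀ t, restrictLeft i (jK t) =
      (inducedLeftEquiv R M P).symm (0, RTensor.lTensor M κ t) := hjK
  refine ⟨K, i, inducedLift s, hi, jK, πK, ⟨⟨fun a b e => ?_, fun k => ⟨fun hk => ?_, ?_⟩,
    fun c => ?_⟩, fun m k => ?_⟩, hπK⟩
  · have e' := congrArg (restrictLeft i) e
    rw [hjK, hjK] at e'
    exact hκ (congrArg Prod.snd ((inducedLeftEquiv R M P).symm.injective e'))
  · have h₁ := hπK k
    rw [hk, map_zero] at h₁
    have h₂ := hi'.apply_apply k
    rw [hG, ← h₁, map_zero, zero_add] at h₂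
    obtain ⟨t, ht⟩ := (RTensor.lTensor_exact κ ε hκε.exact hκε.surj _).1
      (h.ses.inj (h₂.trans (map_zero j).symm))
    refine ⟨t, hi'.inj ?_⟩
    rw [hjK, LinearEquiv.symm_apply_eq]
    exact Prod.ext h₁ ht
  · rintro ⟨t, rfl⟩
    refine hκε.inj ?_
    rw [hπK, hjK, LinearEquiv.apply_symm_apply, map_zero]
  · obtain ⟨t, ht⟩ := h.ses.exists_of_eq_zero (l := s (κ c)) (by rw [hs, hκε.apply_apply])
    obtain ⟨t, rfl⟩ := RTensor.lTensor_surjective ε hκε.surj t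
    obtain ⟨k, hk⟩ := hi'.exists_of_eq_zero (l := (inducedLeftEquiv R M P).symm (κ c, -t)) (by
      rw [hG, LinearEquiv.apply_symm_apply, map_neg, map_neg, ht, add_neg_cancel])
    refine ⟨k, hκε.inj ?_⟩
    rw [hπK, hk, LinearEquiv.apply_symm_apply]
  · refine hi'.inj ?_
    rw [← leftStructureMap_restrictLeft, RTensor.lTensor_tmul, leftStructureMap_inducedLeft, hjK,
      RTensor.lTensor_tmul, hπK]

/-- An embedding of `C` in a projective module induces one of an extension of `C` by `M ⊗ C`. -/
theorem exists_embedding (h : IsLeftExtension X C j π) {P C' : Type u} [AddCommGroup C']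
    [Module R C'] [AddCommGroup P] [Module R P] {ι : C →ₗ[R] P} {ρ : P →ₗ[R] C'}
    (hιρ : IsShortExact ι ρ) (hι : Function.Injective (RTensor.lTensor M ι))
    (hext : ExtOneVanishes R C (RTensor R M P)) :
    ∃ (X' : ModuleCat.{u} (TrivSqZeroExt R M)) (i : X →ₗ[TrivSqZeroExt R M] inducedLeft R M P)
      (q : inducedLeft R M P →ₗ[TrivSqZeroExt R M] X'), IsShortExact i q ∧
      ∃ j' π', IsLeftExtension X' C' j' π' := by
  -- `Ext¹(C, M ⊗ P) = 0` extends `M ⊗ ι` from `M ⊗ C` to a map `f` on `X`; the pair `(ι ∘ π, f)` is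
  -- the desired embedding.
  obtain ⟨f, hf⟩ := hext _ _ j π h.ses (RTensor.lTensorLinear M ι)
  have hf : ∀ t, f (j t) = RTensor.lTensor M ι t := hf
  let i : X →ₗ[TrivSqZeroExt R M] inducedLeft R M P := linearOfRestrictLeft
    ((inducedLeftEquiv R M P).symm.toLinearMap ∘ₗ (ι ∘ₗ π).prod f) fun m x => by
      rw [leftStructureMap_inducedLeft]
      simp [h.structureMap_eq, hf, h.ses.apply_apply]
  have hi : ∀ x, restrictLeft i x = (inducedLeftEquiv R M P).symm (ι (π x), f x) := fun x => rfl
  have hij : ∀ t, restrictLeft i (j t) =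
      (inducedLeftEquiv R M P).symm (0, RTensor.lTensor M ι t) := fun t => by
    rw [hi, hf, h.ses.apply_apply, map_zero]
  have hinj : Function.Injective (restrictLeft i) := by
    rw [injective_iff_map_eq_zero]
    intro x hx
    rw [hi, LinearEquiv.map_eq_zero_iff, Prod.mk_eq_zero] at hx
    obtain ⟨t, rfl⟩ := h.ses.exists_of_eq_zero (hιρ.inj (hx.1.trans (map_zero ι).symm))
    have ht := hx.2
    rw [hf] at ht
    rw [hι (ht.trans (map_zero _).symm), map_zero]
  let X' : ModuleCat.{u} (TrivSqZeroExt R M) :=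
    ModuleCat.of _ (inducedLeft R M P ⧸ LinearMap.range i)
  let q : inducedLeft R M P →ₗ[TrivSqZeroExt R M] X' := (LinearMap.range i).mkQ
  have hq : IsShortExact i q := isShortExact_range_mkQ i hinj
  have hq' := isShortExact_restrictLeft hq
  obtain ⟨π', hπ'⟩ := hq'.exists_desc
    (ρ ∘ₗ LinearMap.fst R P _ ∘ₗ (inducedLeftEquiv R M P).toLinearMap) (fun x => by
      simp [hi, hιρ.apply_apply])
  have hπ' : ∀ x, π' (restrictLeft q x) = ρ (inducedLeftEquiv R M P x).1 := hπ'
  have hM : IsShortExact (RTensor.lTensorLinear M ι) (RTensor.lTensorLinear M ρ) :=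
    ⟨hι, RTensor.lTensor_exact ι ρ hιρ.exact hιρ.surj, RTensor.lTensor_surjective ρ hιρ.surj⟩
  obtain ⟨j', hj'⟩ := hM.exists_desc
    (restrictLeft q ∘ₗ (inducedLeftEquiv R M P).symm.toLinearMap ∘ₗ LinearMap.inr R P _)
    (fun t => by
      rw [RTensor.lTensorLinear_apply]
      refine Eq.trans ?_ (hq'.apply_apply (j t))
      rw [hij]
      rfl)
  have hj' : ∀ t, j' (RTensor.lTensor M ρ t) =
      restrictLeft q ((inducedLeftEquiv R M P).symm (0, t)) := hj'
  refine ⟨X', i, q, hq, j', π', ⟨(injective_iff_map_eq_zero _).2 fun σ hσ => ?_,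
    fun y => ⟨fun hy => ?_, ?_⟩, fun c => ?_⟩, fun m y => ?_⟩
  · obtain ⟨t, rfl⟩ := RTensor.lTensor_surjective ρ hιρ.surj σ
    rw [hj'] at hσ
    obtain ⟨x, hx⟩ := hq'.exists_of_eq_zero hσ
    rw [hi] at hx
    have hx := (inducedLeftEquiv R M P).symm.injective hx
    obtain ⟨s, rfl⟩ := h.ses.exists_of_eq_zero
      (hιρ.inj ((congrArg Prod.fst hx).trans (map_zero ι).symm))
    have hs : f (j s) = t := congrArg Prod.snd hx
    rw [hf] at hs
    rw [← hs]
    exact hM.apply_apply s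
  · obtain ⟨x, rfl⟩ := hq'.surj y
    rw [hπ'] at hy
    obtain ⟨c, hc⟩ := hιρ.exists_of_eq_zero hy
    obtain ⟨x', rfl⟩ := h.ses.surj c
    refine ⟨RTensor.lTensor M ρ ((inducedLeftEquiv R M P x).2 - f x'), ?_⟩
    rw [hj', ← sub_eq_zero, ← map_sub]
    refine Eq.trans ?_ (hq'.apply_apply (-x'))
    congr 1
    rw [map_neg, hi, ← map_neg, LinearEquiv.eq_symm_apply, map_sub,
      LinearEquiv.apply_symm_apply]
    ext
    · simp [hc]
    · simp
  · rintro ⟨σ, rfl⟩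
    obtain ⟨t, rfl⟩ := RTensor.lTensor_surjective ρ hιρ.surj σ
    rw [hj', hπ', LinearEquiv.apply_symm_apply, map_zero]
  · obtain ⟨p, rfl⟩ := hιρ.surj c
    exact ⟨restrictLeft q ((inducedLeftEquiv R M P).symm (p, 0)), by
      rw [hπ', LinearEquiv.apply_symm_apply]⟩
  · obtain ⟨x, rfl⟩ := hq'.surj y
    rw [hπ', ← RTensor.lTensor_tmul ρ, hj', ← leftStructureMap_inducedLeft,
      ← leftStructureMap_restrictLeft, RTensor.lTensor_tmul]

/-- Linear maps from a left extension to a module with trivial action factor through its quotient.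
So extending maps from the syzygy of `X` to the induced module reduces to extending maps from `C'`
to `P` over `R`. -/
theorem extOneVanishes_trivialLeft (h : IsLeftExtension X C j π) {C' P N : Type u}
    [AddCommGroup C'] [Module R C'] [AddCommGroup P] [Module R P] [AddCommGroup N] [Module R N]
    {κ : C' →ₗ[R] P} {ε : P →ₗ[R] C} (hκε : IsShortExact κ ε)
    (hP : Module.Projective R P) (hκ : Function.Injective (RTensor.lTensor M κ))
    (hext : ExtOneVanishes R C N) :
    ExtOneVanishes (TrivSqZeroExt R M) X (trivialLeft R M N) := by
  obtain ⟨K, i, q, hiq, jK, πK, hK, hπK⟩ := h.exists_cover hκε hP hκ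
  refine .of_projective_presentation hiq (projective_inducedLeft hP) fun f => ?_
  obtain ⟨f', hf'⟩ := hK.exists_desc ((trivialLeftEquiv R M N).toLinearMap ∘ₗ restrictLeft f)
    (fun m x => by
      rw [LinearMap.comp_apply, restrictLeft_trivialLeft_leftStructureMap, map_zero])
  obtain ⟨g, hg⟩ := hext _ _ κ ε hκε f'
  refine ⟨toTrivialLeft
    (g ∘ₗ LinearMap.fst R P _ ∘ₗ (inducedLeftEquiv R M P).toLinearMap) fun m x => ?_, fun k => ?_⟩
  · rw [leftStructureMap_inducedLeft]
    simp
  · refine (trivialLeftEquiv R M N).injective ?_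
    exact ((congrArg g (hπK k)).symm.trans (hg _)).trans (hf' k)

/-- An extension of `C` by `M ⊗ C` as an extension of modules with trivial action. -/
theorem exists_isShortExact_trivialLeft (h : IsLeftExtension X C j π) :
    ∃ (a : trivialLeft R M (RTensor R M C) →ₗ[TrivSqZeroExt R M] X)
      (b : X →ₗ[TrivSqZeroExt R M] trivialLeft R M C), IsShortExact a b := by
  refine ⟨linearOfRestrictLeft (j ∘ₗ (trivialLeftEquiv R M _).toLinearMap) (fun m x => ?_),
    toTrivialLeft π h.π_structureMap, isShortExact_of_restrictLeft ?_⟩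
  · rw [leftStructureMap_trivialLeft, map_zero, LinearMap.comp_apply, h.structureMap_j]
  · exact (h.ses.comp_equiv_left (trivialLeftEquiv R M (RTensor R M C))).comp_equiv_right
      (trivialLeftEquiv R M C).symm

/-- Short exact sequences of extensions induce short exact sequences of the quotients. -/
theorem exists_isShortExact_quotient {Y Z : ModuleCat.{u} (TrivSqZeroExt R M)} {D E : Type u}
    [AddCommGroup D] [Module R D] [AddCommGroup E] [Module R E]
    {jY : RTensor R M D →ₗ[R] underlyingLeft R M Y} {πY : underlyingLeft R M Y →ₗ[R] D}
    {jZ : RTensor R M E →ₗ[R] underlyingLeft R M Z} {πZ : underlyingLeft R M Z →ₗ[R] E}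
    (h : IsLeftExtension X C j π) (hY : IsLeftExtension Y D jY πY)
    (hZ : IsLeftExtension Z E jZ πZ) {i : X →ₗ[TrivSqZeroExt R M] Y}
    {p : Y →ₗ[TrivSqZeroExt R M] Z} (hip : IsShortExact i p) :
    ∃ (α : C →ₗ[R] D) (β : D →ₗ[R] E), IsShortExact α β ∧
      (∀ x, α (π x) = πY (restrictLeft i x)) ∧ ∀ y, β (πY y) = πZ (restrictLeft p y) := by
  have hip' := isShortExact_restrictLeft hip
  obtain ⟨α, hα⟩ := h.exists_desc (πY ∘ₗ restrictLeft i) (fun m x => by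
    rw [LinearMap.comp_apply, ← leftStructureMap_restrictLeft, RTensor.lTensor_tmul,
      hY.π_structureMap])
  obtain ⟨β, hβ⟩ := hY.exists_desc (πZ ∘ₗ restrictLeft p) (fun m x => by
    rw [LinearMap.comp_apply, ← leftStructureMap_restrictLeft, RTensor.lTensor_tmul,
      hZ.π_structureMap])
  simp only [LinearMap.comp_apply] at hα hβ
  have hjα : ∀ t, restrictLeft i (j t) = jY (RTensor.lTensor M α t) := fun t => by
    obtain ⟨s, rfl⟩ := RTensor.lTensor_surjective π h.ses.surj t
    have e : α ∘ₗ π = πY ∘ₗ restrictLeft i := LinearMap.ext hα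
    rw [h.j_lTensor, ← leftStructureMap_restrictLeft, ← hY.j_lTensor, RTensor.lTensor_lTensor,
      RTensor.lTensor_lTensor, e]
  have hjβ : ∀ t, restrictLeft p (jY t) = jZ (RTensor.lTensor M β t) := fun t => by
    obtain ⟨s, rfl⟩ := RTensor.lTensor_surjective πY hY.ses.surj t
    have e : β ∘ₗ πY = πZ ∘ₗ restrictLeft p := LinearMap.ext hβ
    rw [hY.j_lTensor, ← leftStructureMap_restrictLeft, ← hZ.j_lTensor, RTensor.lTensor_lTensor,
      RTensor.lTensor_lTensor, e]
  have hsurj : Function.Surjective β := fun e => by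
    obtain ⟨z, rfl⟩ := hZ.ses.surj e
    obtain ⟨y, rfl⟩ := hip'.surj z
    exact ⟨πY y, hβ y⟩
  have hexact : Function.Exact α β := fun d => by
    constructor
    · intro hd
      obtain ⟨y, rfl⟩ := hY.ses.surj d
      rw [hβ] at hd
      obtain ⟨σ, hσ⟩ := hZ.ses.exists_of_eq_zero hd
      obtain ⟨τ, rfl⟩ := RTensor.lTensor_surjective β hsurj σ
      rw [← hjβ] at hσ
      obtain ⟨x, hx⟩ := hip'.exists_of_eq hσ.symm
      exact ⟨π x, by rw [hα, hx, map_sub, hY.ses.apply_apply, sub_zero]⟩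
    · rintro ⟨c, rfl⟩
      obtain ⟨x, rfl⟩ := h.ses.surj c
      rw [hα, hβ, hip'.apply_apply, map_zero]
  refine ⟨α, β, ⟨(injective_iff_map_eq_zero _).2 fun c hc => ?_, hexact, hsurj⟩, hα, hβ⟩
  -- If `π x` dies in `D`, then `i x = jY τ`. As `p` kills it and `jZ` is injective, `τ` dies in `M
  -- ⊗ E` and comes from `M ⊗ C`; hence `x` lies in the image of `j`, and `π x = 0`.
  obtain ⟨x, rfl⟩ := h.ses.surj c
  rw [hα] at hc
  obtain ⟨τ, hτ⟩ := hY.ses.exists_of_eq_zero hc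
  have h₁ : jZ (RTensor.lTensor M β τ) = 0 := by rw [← hjβ, hτ, hip'.apply_apply]
  obtain ⟨σ, rfl⟩ := (RTensor.lTensor_exact α β hexact hsurj τ).1
    (hZ.ses.inj (h₁.trans (map_zero _).symm))
  rw [← hjα] at hτ
  rw [← hip'.inj hτ, h.ses.apply_apply]

end IsLeftExtension

/-- Induction preserves short exact sequences that stay exact after tensoring with `M`. -/
theorem exists_isShortExact_inducedLeft {K F N : Type u} [AddCommGroup K] [Module R K]
    [AddCommGroup F] [Module R F] [AddCommGroup N] [Module R N] {i : K →ₗ[R] F} {p : F →ₗ[R] N}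
    (h : IsShortExact i p) (hi : Function.Injective (RTensor.lTensor M i)) :
    ∃ (a : inducedLeft R M K →ₗ[TrivSqZeroExt R M] inducedLeft R M F)
      (b : inducedLeft R M F →ₗ[TrivSqZeroExt R M] inducedLeft R M N), IsShortExact a b := by
  let φ : ∀ {A B : Type u} [AddCommGroup A] [Module R A] [AddCommGroup B] [Module R B]
      (_ : A →ₗ[R] B), inducedLeft R M A →ₗ[TrivSqZeroExt R M] inducedLeft R M B :=
    fun {A B} _ _ _ _ f => linearOfRestrictLeft ((inducedLeftEquiv R M B).symm.toLinearMap ∘ₗ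
      f.prodMap (RTensor.lTensorLinear M f) ∘ₗ (inducedLeftEquiv R M A).toLinearMap) fun m x => by
        rw [leftStructureMap_inducedLeft, leftStructureMap_inducedLeft]
        simp
  refine ⟨φ i, φ p, isShortExact_of_restrictLeft ?_⟩
  have h' : IsShortExact (i.prodMap (RTensor.lTensorLinear M i))
      (p.prodMap (RTensor.lTensorLinear M p)) :=
    { inj := h.inj.prodMap hi
      exact := fun x => by
        rw [LinearMap.prodMap_apply, Prod.mk_eq_zero, h.exact x.1, RTensor.lTensorLinear_apply,
          RTensor.lTensor_exact i p h.exact h.surj x.2]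
        constructor
        · rintro ⟨⟨a, ha⟩, ⟨b, hb⟩⟩
          exact ⟨(a, b), Prod.ext ha hb⟩
        · rintro ⟨⟨a, b⟩, hab⟩
          exact ⟨⟨a, congrArg Prod.fst hab⟩, ⟨b, congrArg Prod.snd hab⟩⟩
      surj := h.surj.prodMap (RTensor.lTensor_surjective p h.surj) }
  refine ⟨(inducedLeftEquiv R M F).symm.injective.comp
    (h'.inj.comp (inducedLeftEquiv R M K).injective), fun x => ?_,
    (inducedLeftEquiv R M N).symm.surjective.comp
    (h'.surj.comp (inducedLeftEquiv R M F).surjective)⟩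
  change (inducedLeftEquiv R M N).symm ((p.prodMap (RTensor.lTensorLinear M p))
    (inducedLeftEquiv R M F x)) = 0 ↔ _
  rw [LinearEquiv.map_eq_zero_iff]
  refine (h'.exact _).trans ⟨?_, ?_⟩
  · rintro ⟨y, hy⟩
    refine ⟨(inducedLeftEquiv R M K).symm y, ?_⟩
    change (inducedLeftEquiv R M F).symm (i.prodMap (RTensor.lTensorLinear M i)
      (inducedLeftEquiv R M K ((inducedLeftEquiv R M K).symm y))) = x
    rw [LinearEquiv.apply_symm_apply, hy]
    exact (inducedLeftEquiv R M F).symm_apply_apply x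
  · rintro ⟨y, rfl⟩
    refine ⟨inducedLeftEquiv R M K y, ?_⟩
    exact ((inducedLeftEquiv R M F).apply_symm_apply _).symm

/-! ### Vanishing of Tor and Ext for projective, induced and trivial modules -/

theorem torAcyclic_of_projective (hM : Subsingleton (RTensor R M M))
    (hTor : ∀ P : ModuleCat.{u} R, Module.Projective R P → TorAcyclic R M (RTensor R M P))
    (L : ModuleCat.{u} (TrivSqZeroExt R M)) (hL : Module.Projective (TrivSqZeroExt R M) L) :
    TorAcyclic R M (underlyingLeft R M L) := by
  obtain ⟨C, hC, j, π, h⟩ := exists_isLeftExtension_of_projective hM L hL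
  exact .extension h.ses (hTor C hC) (.of_flat (isFlatLeft_of_projective C hC))

theorem hasResolutionLE_tensor_finsupp {n : ℕ} {𝓕 : ObjectProperty (ModuleCat.{u} R)} {ι : Type u}
    (h𝓕 : ∀ F : ModuleCat.{u} R, 𝓕 F → 𝓕 (ModuleCat.of R (ι →₀ F)))
    (h : HasResolutionLE 𝓕 n (ModuleCat.of R M)) :
    HasResolutionLE 𝓕 n (ModuleCat.of R (RTensor R M (ι →₀ R))) :=
  (h.finsupp h𝓕).of_equiv (tensorFinsuppEquiv R M ι)

/-- Every projective module is a retract of a free module. -/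
theorem exists_retract_finsupp (Q : ModuleCat.{u} R) (hQ : Module.Projective R Q) :
    ∃ (s : Q →ₗ[R] (Q →₀ R)) (r : (Q →₀ R) →ₗ[R] Q), ∀ x, r (s x) = x := by
  obtain ⟨s, hs⟩ := Module.projective_lifting_property (Finsupp.linearCombination R (id : Q → Q))
    LinearMap.id (Finsupp.linearCombination_id_surjective R Q)
  exact ⟨s, Finsupp.linearCombination R (id : Q → Q), fun x => DFunLike.congr_fun hs x⟩

/-- `Ext¹(C, M ⊗ Q) = 0` for `C` Gorenstein projective and `Q` projective, if `M` has finite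
projective dimension. -/
theorem extOneVanishes_tensor {n : ℕ} (h : HasResolutionLE (IsProj R) n (ModuleCat.of R M))
    {C Q : ModuleCat.{u} R} (hC : GorensteinProjective R C) (hQ : Module.Projective R Q) :
    ExtOneVanishes R C (RTensor R M Q) := by
  obtain ⟨s, r, hrs⟩ := exists_retract_finsupp Q hQ
  refine (GorensteinProjective.extOneVanishes_of_hasResolutionLE
    (hasResolutionLE_tensor_finsupp (ι := Q) isProj_finsupp h) C hC).retract_right
    (RTensor.lTensorLinear M s) (RTensor.lTensorLinear M r) fun t => ?_
  rw [RTensor.lTensorLinear_apply, RTensor.lTensorLinear_apply, RTensor.lTensor_lTensor]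
  exact RTensor.lTensor_eq_self _ hrs t

/-- Vanishing of Tor with `M` keeps a finite projective resolution of `K` exact under induction, so
the induced module has a finite projective resolution over `R ⋉ M`. -/
theorem extOneVanishes_inducedLeft {n : ℕ} {K : ModuleCat.{u} R}
    (hK : HasResolutionLE (IsProj R) n K) (hTor : TorAcyclic R M K)
    (Z : ModuleCat.{u} (TrivSqZeroExt R M)) (hZ : GorensteinProjective (TrivSqZeroExt R M) Z) :
    ExtOneVanishes (TrivSqZeroExt R M) Z (inducedLeft R M K) := by
  induction n generalizing K Z with
  | zero =>
    obtain ⟨F, hF, ⟨e⟩⟩ := hK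
    have : Module.Projective R F := hF
    exact hZ.extOneVanishes_of_projective (projective_inducedLeft (.of_equiv e))
  | succ n ih =>
    obtain ⟨K', F, i, p, h₁, h₂, h₃, hF, hK'⟩ := hK
    have hip : IsShortExact i p := ⟨h₁, h₂, h₃⟩
    obtain ⟨a, b, hab⟩ := exists_isShortExact_inducedLeft (M := M) hip (hTor.lTensor_injective hip)
    exact GorensteinProjective.extOneVanishes_cokernel hab
      (fun Z hZ => ih hK' (hTor.syzygy_right hip (isFlatLeft_of_projective F hF)) Z hZ)
      (fun Z hZ => hZ.extOneVanishes_of_projective (projective_inducedLeft hF)) Z hZ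

/-- For `F` free, the module `F` with trivial action is the quotient of the induced module of `F` by
`M ⊗ F` with trivial action. The latter is itself induced because `M ⊗ (M ⊗ F) = 0`, and the
previous lemma applies to it. Projective modules are retracts of free ones. -/
theorem extOneVanishes_trivialLeft_of_projective {n : ℕ} (hM : Subsingleton (RTensor R M M))
    (hTor : ∀ P : ModuleCat.{u} R, Module.Projective R P → TorAcyclic R M (RTensor R M P))
    (h : HasResolutionLE (IsProj R) n (ModuleCat.of R M)) {Q : ModuleCat.{u} R}
    (hQ : Module.Projective R Q) (Z : ModuleCat.{u} (TrivSqZeroExt R M))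
    (hZ : GorensteinProjective (TrivSqZeroExt R M) Z) :
    ExtOneVanishes (TrivSqZeroExt R M) Z (trivialLeft R M Q) := by
  obtain ⟨s, r, hrs⟩ := exists_retract_finsupp Q hQ
  have hF : Module.Projective R (Q →₀ R) := inferInstance
  have hsub := subsingleton_tensor_tensor hM (Q →₀ R)
  obtain ⟨a, b, hab⟩ := (isLeftExtension_inducedLeft (R := R) (M := M)
    (RTensor R M (Q →₀ R))).exists_isShortExact_trivialLeft
  -- The kernel of `b` is `M ⊗ (M ⊗ F)` with trivial action, which is zero.
  have hb : Function.Bijective b := ⟨(injective_iff_map_eq_zero b).2 fun x hx => by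
    obtain ⟨y, rfl⟩ := hab.exists_of_eq_zero hx
    rw [(trivialLeftEquiv R M (RTensor R M (RTensor R M (Q →₀ R)))).injective
      (Subsingleton.elim _ _ : trivialLeftEquiv R M (RTensor R M (RTensor R M (Q →₀ R))) y =
        trivialLeftEquiv R M (RTensor R M (RTensor R M (Q →₀ R))) 0)]
    exact map_zero a, hab.surj⟩
  obtain ⟨a', b', hab'⟩ := (isLeftExtension_inducedLeft (R := R) (M := M)
    (Q →₀ R)).exists_isShortExact_trivialLeft
  have h₁ := GorensteinProjective.extOneVanishes_cokernel hab'
    (fun Z hZ => (extOneVanishes_inducedLeft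
      (hasResolutionLE_tensor_finsupp (ι := Q) isProj_finsupp h)
      (hTor (ModuleCat.of R (Q →₀ R)) hF) Z hZ).congr_right (LinearEquiv.ofBijective b hb))
    (fun Z hZ => hZ.extOneVanishes_of_projective (projective_inducedLeft hF)) Z hZ
  refine h₁.retract_right (mapTrivialLeft s) (mapTrivialLeft r) fun x => ?_
  exact (trivialLeftEquiv R M Q).injective (hrs _)

/-- Once all structure maps are known to be injective, the steps of a complete resolution over `R ⋉
M` pass to steps between the cokernels, which are therefore Gorenstein projective as a class. -/
theorem gorensteinProjective_le_phiClass (hM : Subsingleton (RTensor R M M))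
    (hTor : ∀ P : ModuleCat.{u} R, Module.Projective R P → TorAcyclic R M (RTensor R M P))
    {n k : ℕ} (hpd : HasResolutionLE (IsProj R) n (ModuleCat.of R M))
    (hfd : HasResolutionLE (IsFlatRight R) k (ModuleCat.of Rᵐᵒᵖ M))
    (X : ModuleCat.{u} (TrivSqZeroExt R M)) (hX : GorensteinProjective (TrivSqZeroExt R M) X) :
    PhiClass M (GorensteinProjective R) X := by
  have hinj : ∀ Z, GorensteinProjective (TrivSqZeroExt R M) Z →
      Function.Injective (leftStructureMap R M Z) := by
    intro Z hZ
    obtain ⟨Z', hZ', P, i, p, hip, hP, -⟩ := hZ.exists_right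
    obtain ⟨C, -, j, π, h⟩ := exists_isLeftExtension_of_projective hM P hP
    refine injective_leftStructureMap_of_lTensor_injective (h.injective_leftStructureMap hM) i ?_
    -- The cokernels `Z'`, `Z''`, … provide an infinite coresolution by projectives over `R ⋉ M`.
    -- Their underlying modules are extensions of a projective `C` by `M ⊗ C`, hence have no higher
    -- Tor with `M`.
    refine hfd.lTensor_injective
      (fun W => ∃ Z, GorensteinProjective (TrivSqZeroExt R M) Z ∧ W = underlyingLeft R M Z) ?_
      (isShortExact_restrictLeft hip) ⟨Z', hZ', rfl⟩
    rintro W ⟨Z, hZ, rfl⟩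
    obtain ⟨Z', hZ', P, i, p, hip, hP, -⟩ := hZ.exists_right
    exact ⟨_, _, _, _, isShortExact_restrictLeft hip, torAcyclic_of_projective hM hTor P hP,
      Z', hZ', rfl⟩
  have hstep : ∀ (Z Z' : ModuleCat.{u} (TrivSqZeroExt R M)) (C C' : ModuleCat.{u} R) j π j' π',
      IsLeftExtension Z C j π → IsLeftExtension Z' C' j' π' → ProjectiveStep Z Z' →
      GorensteinProjective (TrivSqZeroExt R M) Z' → ProjectiveStep C C' := by
    rintro Z Z' C C' j π j' π' h h' ⟨P, i, p, hip, hP, -⟩ hZ'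
    obtain ⟨D, hD, jP, πP, hP'⟩ := exists_isLeftExtension_of_projective hM P hP
    obtain ⟨α, β, hαβ, hα, -⟩ := h.exists_isShortExact_quotient hP' h' hip
    refine ⟨D, α, β, hαβ, hD, fun Q hQ f => ?_⟩
    -- A map `C → Q` is regarded as a map from `Z` to `Q` with trivial action; it extends to `P` by
    -- `Ext¹(Z', Q) = 0` and descends to `D`.
    obtain ⟨g, hg⟩ := extOneVanishes_trivialLeft_of_projective hM hTor hpd hQ Z' hZ' _ _ i p hip
      (toTrivialLeft (f ∘ₗ π) fun m x => by
        rw [LinearMap.comp_apply, h.π_structureMap, map_zero])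
    obtain ⟨g', hg'⟩ := hP'.exists_desc ((trivialLeftEquiv R M Q).toLinearMap ∘ₗ restrictLeft g)
      (fun m x => by
        rw [LinearMap.comp_apply, restrictLeft_trivialLeft_leftStructureMap, map_zero])
    refine ⟨g', fun c => ?_⟩
    obtain ⟨x, rfl⟩ := h.ses.surj c
    rw [hα, hg']
    exact congrArg (trivialLeftEquiv R M Q) (hg x)
  refine (phiClass_iff hM _ (fun X Y hX ⟨e⟩ => hX.of_equiv e) X).2 ?_
  obtain ⟨j, hj⟩ := exists_isLeftExtension hM X (hinj X hX)
  refine ⟨ModuleCat.of R _, gorensteinProjective_of_class (fun C => ∃ Z,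
    GorensteinProjective (TrivSqZeroExt R M) Z ∧ ∃ j π, IsLeftExtension Z C j π) ?_ ?_ _
    ⟨X, hX, j, _, hj⟩, j, _, hj⟩
  · rintro C ⟨Z, hZ, j, π, h⟩
    obtain ⟨Z', hZ', hZZ'⟩ := hZ.exists_right
    obtain ⟨j', hj'⟩ := exists_isLeftExtension hM Z' (hinj Z' hZ')
    exact ⟨ModuleCat.of R _, ⟨Z', hZ', j', _, hj'⟩,
      hstep Z Z' C (ModuleCat.of R _) _ _ _ _ h hj' hZZ' hZ'⟩
  · rintro C ⟨Z, hZ, j, π, h⟩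
    obtain ⟨Z', hZ', hZZ'⟩ := hZ.exists_left
    obtain ⟨j', hj'⟩ := exists_isLeftExtension hM Z' (hinj Z' hZ')
    exact ⟨ModuleCat.of R _, ⟨Z', hZ', j', _, hj'⟩,
      hstep Z' Z (ModuleCat.of R _) C _ _ _ _ hj' h hZZ' hZ⟩

/-- The class of extensions of Gorenstein projective `C` is stable under embeddings into, and covers
by, induced projectives. -/
theorem phiClass_le_gorensteinProjective (hM : Subsingleton (RTensor R M M))
    {n k : ℕ} (hpd : HasResolutionLE (IsProj R) n (ModuleCat.of R M))
    (hfd : HasResolutionLE (IsFlatRight R) k (ModuleCat.of Rᵐᵒᵖ M))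
    (X : ModuleCat.{u} (TrivSqZeroExt R M)) (hX : PhiClass M (GorensteinProjective R) X) :
    GorensteinProjective (TrivSqZeroExt R M) X := by
  have htens : ∀ (C P C' : ModuleCat.{u} R) (i : C →ₗ[R] P) (p : P →ₗ[R] C'), IsShortExact i p →
      GorensteinProjective R C' → Function.Injective (RTensor.lTensor M i) := by
    intro C P C' i p hip hC'
    refine hfd.lTensor_injective (GorensteinProjective R) (fun Z hZ => ?_) hip hC'
    obtain ⟨Z', hZ', P, i, p, hip, hP, -⟩ := hZ.exists_right
    exact ⟨P, Z', i, p, hip, .of_flat (isFlatLeft_of_projective P hP), hZ'⟩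
  -- A projective `Q` is an extension of `D` by `M ⊗ D`, both with trivial action and `D`
  -- projective; the claim reduces to `Ext¹(C, M ⊗ D) = 0` and `Ext¹(C, D) = 0` over `R`.
  have hext : ∀ (X : ModuleCat.{u} (TrivSqZeroExt R M)) (C : ModuleCat.{u} R) j π,
      GorensteinProjective R C → IsLeftExtension X C j π →
      ∀ Q : ModuleCat.{u} (TrivSqZeroExt R M), Module.Projective (TrivSqZeroExt R M) Q →
        ExtOneVanishes (TrivSqZeroExt R M) X Q := by
    intro X C j π hC h Q hQ
    obtain ⟨D, hD, jQ, πQ, hQ'⟩ := exists_isLeftExtension_of_projective hM Q hQ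
    obtain ⟨a, b, hab⟩ := hQ'.exists_isShortExact_trivialLeft
    obtain ⟨C', hC', P, i, p, hip, hP, -⟩ := hC.exists_left
    have hi := htens _ _ _ i p hip hC
    exact .extension_right hab
      (h.extOneVanishes_trivialLeft hip hP hi (extOneVanishes_tensor hpd hC hD))
      (h.extOneVanishes_trivialLeft hip hP hi (hC.extOneVanishes_of_projective hD))
  refine gorensteinProjective_of_class
    (fun X => ∃ C : ModuleCat.{u} R, GorensteinProjective R C ∧ ∃ j π, IsLeftExtension X C j π)
    ?_ ?_ X ((phiClass_iff hM _ (fun X Y hX ⟨e⟩ => hX.of_equiv e) X).1 hX)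
  · rintro X ⟨C, hC, j, π, h⟩
    obtain ⟨C', hC', P, i, p, hip, hP, -⟩ := hC.exists_right
    obtain ⟨X', a, b, hab, j', π', h'⟩ := h.exists_embedding hip (htens _ _ _ i p hip hC')
      (extOneVanishes_tensor hpd hC hP)
    exact ⟨X', ⟨C', hC', j', π', h'⟩, _, a, b, hab, projective_inducedLeft hP,
      fun Q hQ f => hext X' C' j' π' hC' h' Q hQ _ _ a b hab f⟩
  · rintro X ⟨C, hC, j, π, h⟩
    obtain ⟨C', hC', P, i, p, hip, hP, -⟩ := hC.exists_left
    obtain ⟨K, a, b, hab, j', π', h', -⟩ := h.exists_cover hip hP (htens _ _ _ i p hip hC)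
    exact ⟨K, ⟨C', hC', j', π', h'⟩, _, a, b, hab, projective_inducedLeft hP,
      fun Q hQ f => hext X C j π hC h Q hQ _ _ a b hab f⟩

end GorensteinProjectiveExtension

/-! ### Right modules over the trivial extension -/

namespace RightHom

variable {R : Type*} [Ring R] {M : Type*} [AddCommGroup M] [Module Rᵐᵒᵖ M] {A B C : Type*} [AddCommGroup A] [Module Rᵐᵒᵖ A] [AddCommGroup B]
  [Module Rᵐᵒᵖ B] [AddCommGroup C] [Module Rᵐᵒᵖ C]

@[simp]
theorem add_apply (f g : RightHom R M A) (m : M) : (f + g) m = f m + g m := rfl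

@[simp]
theorem sub_apply (f g : RightHom R M A) (m : M) : (f - g) m = f m - g m := rfl

@[simp]
theorem zero_apply (m : M) : (0 : RightHom R M A) m = 0 := rfl

variable [Module R M] [SMulCommClass R Rᵐᵒᵖ M]

theorem smul_apply (a : Rᵐᵒᵖ) (f : RightHom R M A) (m : M) : (a • f) m = f (unop a • m) := rfl

variable (M) in
/-- The linear map `Hom(M, A) → Hom(M, B)` given by composition with `g`. -/
def map (g : A →ₗ[Rᵐᵒᵖ] B) : RightHom R M A →ₗ[Rᵐᵒᵖ] RightHom R M B where
  toFun f := (g ∘ₗ (show M →ₗ[Rᵐᵒᵖ] A from f) : M →ₗ[Rᵐᵒᵖ] B)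
  map_add' f f' := DFunLike.ext _ _ fun m => map_add g (f m) (f' m)
  map_smul' _ _ := rfl

@[simp]
theorem map_apply (g : A →ₗ[Rᵐᵒᵖ] B) (f : RightHom R M A) (m : M) : map M g f m = g (f m) := rfl

/-- `Hom(M, -)` preserves a short exact sequence if `Ext¹(M, -)` of its first term vanishes. -/
theorem isShortExact {i : A →ₗ[Rᵐᵒᵖ] B} {p : B →ₗ[Rᵐᵒᵖ] C} (h : IsShortExact i p)
    (hs : Function.Surjective (map M p)) : IsShortExact (map M i) (map M p) where
  inj := fun f g e => DFunLike.ext _ _ fun m => h.inj (DFunLike.congr_fun e m)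
  exact := fun f => by
    constructor
    · intro hf
      obtain ⟨g, hg⟩ := h.exists_lift (show M →ₗ[Rᵐᵒᵖ] B from f)
        (fun m => DFunLike.congr_fun hf m)
      exact ⟨g, DFunLike.ext _ _ hg⟩
    · rintro ⟨g, rfl⟩
      exact DFunLike.ext _ _ fun m => h.apply_apply (g m)
  surj := hs

theorem map_surjective {R M A B C : Type u} [Ring R] [AddCommGroup M] [Module R M]
    [Module Rᵐᵒᵖ M] [SMulCommClass R Rᵐᵒᵖ M] [AddCommGroup A] [Module Rᵐᵒᵖ A] [AddCommGroup B]
    [Module Rᵐᵒᵖ B] [AddCommGroup C] [Module Rᵐᵒᵖ C] {i : A →ₗ[Rᵐᵒᵖ] B} {p : B →ₗ[Rᵐᵒᵖ] C}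
    (h : IsShortExact i p) (hA : ExtOneVanishes Rᵐᵒᵖ M A) :
    Function.Surjective (map (R := R) M p) := fun f => by
  obtain ⟨g, hg⟩ := hA.exists_lift h (show M →ₗ[Rᵐᵒᵖ] C from f)
  exact ⟨g, DFunLike.ext _ _ hg⟩

/-- `Hom(M, Hom(M, A))` embeds in the additive maps from `M ⊗ M` to `A`. This replaces `M ⊗ (M ⊗ X)
= 0` on the right side. -/
theorem apply_apply_eq_zero (hM : Subsingleton (RTensor R M M)) (f : M →ₗ[Rᵐᵒᵖ] RightHom R M A)
    (m m' : M) : f m m' = 0 := by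
  let g : RTensor R M M →+ A := RTensor.lift
    (AddMonoidHom.mk' (fun m => AddMonoidHom.mk' (fun m' => f m m') (map_add (f m)))
      (fun a b => by ext m'; simp))
    (fun r m m' => by simp [smul_apply])
  have h : g (RTensor.tmul R m m') = f m m' := rfl
  rw [← h, Subsingleton.elim (RTensor.tmul R m m') 0, map_zero]

end RightHom

noncomputable section RightModules

variable {R : Type u} [Ring R] {M : Type u} [AddCommGroup M] [Module R M] [Module Rᵐᵒᵖ M]
  [SMulCommClass R Rᵐᵒᵖ M]

/-- A linear map of right modules over `R ⋉ M` as a linear map over `R`. -/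
def restrictRight {X Y : ModuleCat.{u} (TrivSqZeroExt R M)ᵐᵒᵖ}
    (f : X →ₗ[(TrivSqZeroExt R M)ᵐᵒᵖ] Y) :
    underlyingRight R M X →ₗ[Rᵐᵒᵖ] underlyingRight R M Y where
  toFun x := f x
  map_add' := map_add f
  map_smul' r x := f.map_smul (op (TrivSqZeroExt.inl (unop r) : TrivSqZeroExt R M)) x

theorem rightStructureMap_restrictRight {X Y : ModuleCat.{u} (TrivSqZeroExt R M)ᵐᵒᵖ}
    (f : X →ₗ[(TrivSqZeroExt R M)ᵐᵒᵖ] Y) (x : underlyingRight R M X) (m : M) :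
    rightStructureMap R M Y (restrictRight f x) m =
      restrictRight f (rightStructureMap R M X x m) :=
  (f.map_smul (op (TrivSqZeroExt.inr m : TrivSqZeroExt R M)) x).symm

/-- An `R`-linear map compatible with the structure maps is linear over `R ⋉ M`. -/
def linearOfRestrictRight {X Y : ModuleCat.{u} (TrivSqZeroExt R M)ᵐᵒᵖ}
    (g : underlyingRight R M X →ₗ[Rᵐᵒᵖ] underlyingRight R M Y)
    (hg : ∀ (x : underlyingRight R M X) (m : M), g (rightStructureMap R M X x m) =
      rightStructureMap R M Y (g x) m) : X →ₗ[(TrivSqZeroExt R M)ᵐᵒᵖ] Y where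
  toFun x := g x
  map_add' := map_add g
  map_smul' t x := by
    have h₁ : ∀ (Z : ModuleCat.{u} (TrivSqZeroExt R M)ᵐᵒᵖ) (z : Z), t • z =
        op (TrivSqZeroExt.inl (unop t).fst : TrivSqZeroExt R M) • z +
          op (TrivSqZeroExt.inr (unop t).snd : TrivSqZeroExt R M) • z := fun Z z => by
      rw [← add_smul, ← MulOpposite.op_add, TrivSqZeroExt.inl_fst_add_inr_snd_eq, op_unop]
    exact (congrArg (fun z : X => (g z : Y)) (h₁ X x)).trans ((map_add g _ _).trans
      ((congrArg₂ (· + ·) (g.map_smul (op (unop t).fst) x) (hg x (unop t).snd)).trans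
        (h₁ Y (g x)).symm))

theorem isShortExact_restrictRight {X Y Z : ModuleCat.{u} (TrivSqZeroExt R M)ᵐᵒᵖ}
    {i : X →ₗ[(TrivSqZeroExt R M)ᵐᵒᵖ] Y} {p : Y →ₗ[(TrivSqZeroExt R M)ᵐᵒᵖ] Z}
    (h : IsShortExact i p) : IsShortExact (restrictRight i) (restrictRight p) :=
  ⟨h.inj, h.exact, h.surj⟩

theorem isShortExact_of_restrictRight {X Y Z : ModuleCat.{u} (TrivSqZeroExt R M)ᵐᵒᵖ}
    {i : X →ₗ[(TrivSqZeroExt R M)ᵐᵒᵖ] Y} {p : Y →ₗ[(TrivSqZeroExt R M)ᵐᵒᵖ] Z}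
    (h : IsShortExact (restrictRight i) (restrictRight p)) : IsShortExact i p :=
  ⟨h.inj, h.exact, h.surj⟩

/-- The composition of two structure maps vanishes. -/
theorem rightStructureMap_rightStructureMap (X : ModuleCat.{u} (TrivSqZeroExt R M)ᵐᵒᵖ)
    (x : underlyingRight R M X) (m m' : M) :
    rightStructureMap R M X (rightStructureMap R M X x m) m' = 0 := by
  change op (TrivSqZeroExt.inr m' : TrivSqZeroExt R M) •
    op (TrivSqZeroExt.inr m : TrivSqZeroExt R M) • (show X from x) = 0
  rw [← mul_smul, ← op_mul, TrivSqZeroExt.inr_mul_inr, op_zero, zero_smul]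

/-! #### Modules from pairs -/

section RightPair

variable (X : Type u) [AddCommGroup X] [Module Rᵐᵒᵖ X] (v : X →ₗ[Rᵐᵒᵖ] RightHom R M X)
  (hv : ∀ x m m', v (v x m) m' = 0)

/-- The right `R ⋉ M`-module structure given by a pair `[X, v]`. -/
@[reducible]
def rightPairModule : Module (TrivSqZeroExt R M)ᵐᵒᵖ X where
  smul t x := op (unop t).fst • x + v x (unop t).snd
  one_smul x := by
    change (1 : Rᵐᵒᵖ) • x + v x 0 = x
    rw [one_smul, map_zero, add_zero]
  mul_smul s t x := by
    change op (unop t * unop s).fst • x + v x (unop t * unop s).snd =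
      op (unop s).fst • (op (unop t).fst • x + v x (unop t).snd) +
        v (op (unop t).fst • x + v x (unop t).snd) (unop s).snd
    rw [map_add, RightHom.add_apply, hv, add_zero, TrivSqZeroExt.fst_mul, TrivSqZeroExt.snd_mul,
      op_mul, mul_smul, smul_add, map_smul, RightHom.smul_apply, map_add,
      map_smul (v x) (op (unop s).fst), unop_op, add_assoc,
      add_comm (v x ((unop t).fst • (unop s).snd))]
  smul_zero t := by
    change op (unop t).fst • (0 : X) + v 0 (unop t).snd = 0
    rw [smul_zero, map_zero, RightHom.zero_apply, add_zero]
  smul_add t x y := by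
    change op (unop t).fst • (x + y) + v (x + y) (unop t).snd =
      (op (unop t).fst • x + v x (unop t).snd) + (op (unop t).fst • y + v y (unop t).snd)
    rw [smul_add, map_add, RightHom.add_apply, add_add_add_comm]
  add_smul s t x := by
    change (op (unop s).fst + op (unop t).fst) • x + v x ((unop s).snd + (unop t).snd) =
      (op (unop s).fst • x + v x (unop s).snd) + (op (unop t).fst • x + v x (unop t).snd)
    rw [add_smul, map_add, add_add_add_comm]
  zero_smul x := by
    change (0 : Rᵐᵒᵖ) • x + v x 0 = 0
    rw [zero_smul, map_zero, add_zero]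

/-- The right `R ⋉ M`-module given by a pair `[X, v]`. -/
def rightPair : ModuleCat.{u} (TrivSqZeroExt R M)ᵐᵒᵖ :=
  letI := rightPairModule X v hv
  ModuleCat.of (TrivSqZeroExt R M)ᵐᵒᵖ X

/-- The underlying module of the pair `[X, v]` is `X`. -/
def rightPairEquiv : underlyingRight R M (rightPair X v hv) ≃ₗ[Rᵐᵒᵖ] X where
  toFun x := x
  invFun x := x
  left_inv _ := rfl
  right_inv _ := rfl
  map_add' _ _ := rfl
  map_smul' r x := by
    change op (unop r) • (show X from x) + v (show X from x) 0 = r • (show X from x)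
    rw [map_zero, add_zero, op_unop]

theorem rightPairEquiv_rightStructureMap (x : underlyingRight R M (rightPair X v hv)) (m : M) :
    rightPairEquiv X v hv (rightStructureMap R M (rightPair X v hv) x m) =
      v (rightPairEquiv X v hv x) m := by
  change (0 : Rᵐᵒᵖ) • (show X from x) + v (show X from x) m = v (show X from x) m
  rw [zero_smul, zero_add]

end RightPair

variable (R M) in
/-- A right `R`-module as a right `R ⋉ M`-module on which `M` acts by zero. -/
def trivialRight (N : Type u) [AddCommGroup N] [Module Rᵐᵒᵖ N] :
    ModuleCat.{u} (TrivSqZeroExt R M)ᵐᵒᵖ :=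
  rightPair N (0 : N →ₗ[Rᵐᵒᵖ] RightHom R M N) fun _ _ _ => rfl

variable (R M) in
/-- The underlying `R`-module of a module with trivial action of `M`. -/
def trivialRightEquiv (N : Type u) [AddCommGroup N] [Module Rᵐᵒᵖ N] :
    underlyingRight R M (trivialRight R M N) ≃ₗ[Rᵐᵒᵖ] N :=
  rightPairEquiv N (0 : N →ₗ[Rᵐᵒᵖ] RightHom R M N) fun _ _ _ => rfl

theorem rightStructureMap_trivialRight (N : Type u) [AddCommGroup N] [Module Rᵐᵒᵖ N]
    (x : underlyingRight R M (trivialRight R M N)) (m : M) :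
    rightStructureMap R M (trivialRight R M N) x m = 0 :=
  (trivialRightEquiv R M N).injective
    ((rightPairEquiv_rightStructureMap N (0 : N →ₗ[Rᵐᵒᵖ] RightHom R M N) (fun _ _ _ => rfl)
      x m).trans (map_zero _).symm)

section Trivial

variable {X : ModuleCat.{u} (TrivSqZeroExt R M)ᵐᵒᵖ} {N N' : Type u} [AddCommGroup N]
  [Module Rᵐᵒᵖ N] [AddCommGroup N'] [Module Rᵐᵒᵖ N']

/-- An `R`-linear map whose image is annihilated by `M`, as an `R ⋉ M`-linear map from a module
with trivial action. -/
def ofTrivialRight (f : N →ₗ[Rᵐᵒᵖ] underlyingRight R M X)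
    (hf : ∀ n m, rightStructureMap R M X (f n) m = 0) :
    trivialRight R M N →ₗ[(TrivSqZeroExt R M)ᵐᵒᵖ] X :=
  linearOfRestrictRight (f ∘ₗ (trivialRightEquiv R M N).toLinearMap) fun x m => by
    rw [rightStructureMap_trivialRight, map_zero, LinearMap.comp_apply, hf]

theorem rightStructureMap_restrictRight_trivialRight
    (f : trivialRight R M N →ₗ[(TrivSqZeroExt R M)ᵐᵒᵖ] X)
    (x : underlyingRight R M (trivialRight R M N)) (m : M) :
    rightStructureMap R M X (restrictRight f x) m = 0 := by
  rw [rightStructureMap_restrictRight, rightStructureMap_trivialRight, map_zero]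

/-- Linear maps between modules with trivial action. -/
def mapTrivialRight (f : N →ₗ[Rᵐᵒᵖ] N') :
    trivialRight R M N →ₗ[(TrivSqZeroExt R M)ᵐᵒᵖ] trivialRight R M N' :=
  ofTrivialRight ((trivialRightEquiv R M N').symm.toLinearMap ∘ₗ f) fun _ _ =>
    rightStructureMap_trivialRight _ _ _

end Trivial

variable (R M) in
/-- The coinduced module `Hom_R(R ⋉ M, E) = E ⊕ Hom_R(M, E)`. -/
def coinducedRight (E : Type u) [AddCommGroup E] [Module Rᵐᵒᵖ E] :
    ModuleCat.{u} (TrivSqZeroExt R M)ᵐᵒᵖ :=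
  rightPair (E × RightHom R M E)
    (RightHom.map M (LinearMap.inl Rᵐᵒᵖ E (RightHom R M E)) ∘ₗ LinearMap.snd Rᵐᵒᵖ E _)
    fun _ _ _ => rfl

variable (R M) in
/-- The underlying `R`-module of a coinduced module. -/
def coinducedRightEquiv (E : Type u) [AddCommGroup E] [Module Rᵐᵒᵖ E] :
    underlyingRight R M (coinducedRight R M E) ≃ₗ[Rᵐᵒᵖ] E × RightHom R M E :=
  rightPairEquiv (E × RightHom R M E)
    (RightHom.map M (LinearMap.inl Rᵐᵒᵖ E (RightHom R M E)) ∘ₗ LinearMap.snd Rᵐᵒᵖ E _)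
    fun _ _ _ => rfl

theorem rightStructureMap_coinducedRight (E : Type u) [AddCommGroup E] [Module Rᵐᵒᵖ E]
    (x : underlyingRight R M (coinducedRight R M E)) (m : M) :
    rightStructureMap R M (coinducedRight R M E) x m =
      (coinducedRightEquiv R M E).symm ((coinducedRightEquiv R M E x).2 m, 0) :=
  (coinducedRightEquiv R M E).injective
    ((rightPairEquiv_rightStructureMap (E × RightHom R M E) _ _ x m).trans
      ((coinducedRightEquiv R M E).apply_symm_apply _).symm)

/-! #### Extensions of `Hom(M, C)` by `C` -/

/-- The structure map of the right module `Y` factors as `Y → Hom(M, C) → Hom(M, Y)`, where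
`0 → C → Y → Hom(M, C) → 0` is exact. -/
structure IsRightExtension (Y : ModuleCat.{u} (TrivSqZeroExt R M)ᵐᵒᵖ) (C : Type u)
    [AddCommGroup C] [Module Rᵐᵒᵖ C] (j : C →ₗ[Rᵐᵒᵖ] underlyingRight R M Y)
    (π : underlyingRight R M Y →ₗ[Rᵐᵒᵖ] RightHom R M C) : Prop where
  ses : IsShortExact j π
  structureMap_eq : ∀ (y : underlyingRight R M Y) (m : M),
    rightStructureMap R M Y y m = j (π y m)

theorem isRightExtension_coinducedRight (E : Type u) [AddCommGroup E] [Module Rᵐᵒᵖ E] :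
    IsRightExtension (coinducedRight R M E) E
      ((coinducedRightEquiv R M E).symm.toLinearMap ∘ₗ LinearMap.inl Rᵐᵒᵖ E (RightHom R M E))
      (LinearMap.snd Rᵐᵒᵖ E (RightHom R M E) ∘ₗ (coinducedRightEquiv R M E).toLinearMap) where
  ses :=
    { inj := (coinducedRightEquiv R M E).symm.injective.comp LinearMap.inl_injective
      exact := fun x => by
        constructor
        · intro h
          refine ⟨(coinducedRightEquiv R M E x).1, ?_⟩
          rw [LinearMap.comp_apply, LinearEquiv.coe_coe, LinearEquiv.symm_apply_eq]
          exact Prod.ext rfl h.symm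
        · rintro ⟨t, rfl⟩
          simp
      surj := fun p => ⟨(coinducedRightEquiv R M E).symm (0, p), by simp⟩ }
  structureMap_eq := fun x m => rightStructureMap_coinducedRight E x m

namespace IsRightExtension

variable {Y : ModuleCat.{u} (TrivSqZeroExt R M)ᵐᵒᵖ} {C : Type u} [AddCommGroup C]
    [Module Rᵐᵒᵖ C] {j : C →ₗ[Rᵐᵒᵖ] underlyingRight R M Y}
    {π : underlyingRight R M Y →ₗ[Rᵐᵒᵖ] RightHom R M C}

theorem π_eq_zero (h : IsRightExtension Y C j π) {y : underlyingRight R M Y}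
    (hy : ∀ m, rightStructureMap R M Y y m = 0) : π y = 0 :=
  DFunLike.ext _ _ fun m => h.ses.inj (by
    rw [← h.structureMap_eq, hy, RightHom.zero_apply, map_zero])

/-- Linear maps to `Y` with image annihilated by `M` factor through `C`. -/
theorem exists_lift (h : IsRightExtension Y C j π) {N : Type*} [AddCommGroup N] [Module Rᵐᵒᵖ N]
    (f : N →ₗ[Rᵐᵒᵖ] underlyingRight R M Y) (hf : ∀ n m, rightStructureMap R M Y (f n) m = 0) :
    ∃ g : N →ₗ[Rᵐᵒᵖ] C, ∀ n, j (g n) = f n :=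
  h.ses.exists_lift f fun n => h.π_eq_zero (hf n)

theorem structureMap_j (h : IsRightExtension Y C j π) (c : C) (m : M) :
    rightStructureMap R M Y (j c) m = 0 := by
  rw [h.structureMap_eq, h.ses.apply_apply, RightHom.zero_apply, map_zero]

theorem π_structureMap (h : IsRightExtension Y C j π) (y : underlyingRight R M Y) (m : M) :
    π (rightStructureMap R M Y y m) = 0 := by
  rw [h.structureMap_eq, h.ses.apply_apply]

/-- For `f : M → Y` the composite `π ∘ f` lies in `Hom(M, Hom(M, C)) = 0`, so `f` takes values in
`C` and is `π y` for some `y`. -/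
theorem surjective_rightStructureMap (hM : Subsingleton (RTensor R M M))
    (h : IsRightExtension Y C j π) : Function.Surjective (rightStructureMap R M Y) := fun f => by
  obtain ⟨g, hg⟩ := h.ses.exists_lift (show M →ₗ[Rᵐᵒᵖ] underlyingRight R M Y from f)
    (fun m => DFunLike.ext _ _ fun m' => RightHom.apply_apply_eq_zero hM
      (π ∘ₗ (show M →ₗ[Rᵐᵒᵖ] underlyingRight R M Y from f)) m m')
  obtain ⟨y, hy⟩ := h.ses.surj g
  refine ⟨y, DFunLike.ext _ _ fun m => ?_⟩
  rw [h.structureMap_eq, hy]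
  exact hg m

theorem nonempty_equiv_ker (h : IsRightExtension Y C j π) :
    Nonempty (C ≃ₗ[Rᵐᵒᵖ] LinearMap.ker (rightStructureMap R M Y)) := by
  refine ⟨LinearEquiv.ofBijective (LinearMap.codRestrict _ j fun c =>
    DFunLike.ext _ _ fun m => h.structureMap_j c m)
    ⟨fun c c' e => h.ses.inj (congrArg Subtype.val e), fun y => ?_⟩⟩
  obtain ⟨c, hc⟩ := h.ses.exists_of_eq_zero
    (h.π_eq_zero (y := y.1) fun m => DFunLike.congr_fun y.2 m)
  exact ⟨c, Subtype.ext hc⟩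

end IsRightExtension

/-- `Hom(M, ker v) → Hom(M, Y)` is an isomorphism, because maps `M → Y` composed with `v` lie in
`Hom(M, Hom(M, Y)) = 0`. -/
theorem exists_isRightExtension (hM : Subsingleton (RTensor R M M))
    (Y : ModuleCat.{u} (TrivSqZeroExt R M)ᵐᵒᵖ)
    (h : Function.Surjective (rightStructureMap R M Y)) :
    ∃ π, IsRightExtension Y (LinearMap.ker (rightStructureMap R M Y))
      (LinearMap.ker (rightStructureMap R M Y)).subtype π := by
  have hs := isShortExact_ker_subtype _ h
  have hb : Function.Bijective (RightHom.map M
      (LinearMap.ker (rightStructureMap R M Y)).subtype) := by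
    refine ⟨fun f g e => DFunLike.ext _ _ fun m => hs.inj (DFunLike.congr_fun e m), fun f => ?_⟩
    obtain ⟨g, hg⟩ := hs.exists_lift (show M →ₗ[Rᵐᵒᵖ] underlyingRight R M Y from f)
      (fun m => DFunLike.ext _ _ fun m' => RightHom.apply_apply_eq_zero hM
        (rightStructureMap R M Y ∘ₗ (show M →ₗ[Rᵐᵒᵖ] underlyingRight R M Y from f)) m m')
    exact ⟨g, DFunLike.ext _ _ hg⟩
  let e := LinearEquiv.ofBijective _ hb
  have he : ∀ f m, (LinearMap.ker (rightStructureMap R M Y)).subtype (e.symm f m) = f m :=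
    fun f m => DFunLike.congr_fun (e.apply_symm_apply f) m
  exact ⟨e.symm.toLinearMap ∘ₗ rightStructureMap R M Y, hs.comp_equiv_right e.symm,
    fun y m => (he (rightStructureMap R M Y y) m).symm⟩

theorem psiClass_iff (hM : Subsingleton (RTensor R M M))
    (𝒴 : ObjectProperty (ModuleCat.{u} Rᵐᵒᵖ))
    (h𝒴 : ∀ X Y : ModuleCat.{u} Rᵐᵒᵖ, 𝒴 X → Nonempty (X ≃ₗ[Rᵐᵒᵖ] Y) → 𝒴 Y)
    (Y : ModuleCat.{u} (TrivSqZeroExt R M)ᵐᵒᵖ) :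
    PsiClass M 𝒴 Y ↔ ∃ C : ModuleCat.{u} Rᵐᵒᵖ, 𝒴 C ∧ ∃ j π, IsRightExtension Y C j π := by
  constructor
  · rintro ⟨h₁, h₂⟩
    obtain ⟨π, hπ⟩ := exists_isRightExtension hM Y h₁
    exact ⟨_, h₂, _, π, hπ⟩
  · rintro ⟨C, hC, j, π, h⟩
    exact ⟨h.surjective_rightStructureMap hM, h𝒴 _ _ hC h.nonempty_equiv_ker⟩

/-! #### Coinduced modules and injective modules -/

section Coinduced

variable {E : Type u} [AddCommGroup E] [Module Rᵐᵒᵖ E]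
  {X Y : ModuleCat.{u} (TrivSqZeroExt R M)ᵐᵒᵖ}

/-- The `R ⋉ M`-linear map to a coinduced module given by an `R`-linear map. -/
def coinducedLift (g : underlyingRight R M X →ₗ[Rᵐᵒᵖ] E) :
    X →ₗ[(TrivSqZeroExt R M)ᵐᵒᵖ] coinducedRight R M E :=
  linearOfRestrictRight ((coinducedRightEquiv R M E).symm.toLinearMap ∘ₗ
    g.prod (RightHom.map M g ∘ₗ rightStructureMap R M X)) fun x m => by
    rw [rightStructureMap_coinducedRight]
    simp only [LinearMap.comp_apply, LinearEquiv.coe_coe, LinearEquiv.apply_symm_apply]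
    congr 1
    refine Prod.ext rfl (DFunLike.ext _ _ fun m' => ?_)
    simp [rightStructureMap_rightStructureMap]

theorem restrictRight_coinducedLift (g : underlyingRight R M X →ₗ[Rᵐᵒᵖ] E)
    (x : underlyingRight R M X) : restrictRight (coinducedLift g) x =
      (coinducedRightEquiv R M E).symm (g x, RightHom.map M g (rightStructureMap R M X x)) := rfl

/-- Coinduction is right adjoint to restriction: only the first component has to be extended, and
linearity over `R ⋉ M` determines the second. -/
theorem injective_coinducedRight (hE : Module.Injective Rᵐᵒᵖ E) :
    Module.Injective (TrivSqZeroExt R M)ᵐᵒᵖ (coinducedRight R M E) := by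
  refine ⟨fun A B _ _ _ _ i hi f => ?_⟩
  let A' : ModuleCat.{u} (TrivSqZeroExt R M)ᵐᵒᵖ := ModuleCat.of _ A
  let B' : ModuleCat.{u} (TrivSqZeroExt R M)ᵐᵒᵖ := ModuleCat.of _ B
  let i' : A' →ₗ[(TrivSqZeroExt R M)ᵐᵒᵖ] B' := i
  let f' : A' →ₗ[(TrivSqZeroExt R M)ᵐᵒᵖ] coinducedRight R M E := f
  obtain ⟨g, hg⟩ := hE.out (restrictRight i') hi
    (LinearMap.fst Rᵐᵒᵖ E _ ∘ₗ (coinducedRightEquiv R M E).toLinearMap ∘ₗ restrictRight f')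
  have key : ∀ a : underlyingRight R M A', restrictRight (coinducedLift g) (restrictRight i' a) =
      restrictRight f' a := fun a => by
    rw [restrictRight_coinducedLift, LinearEquiv.symm_apply_eq]
    refine Prod.ext (hg a) (DFunLike.ext _ _ fun m => ?_)
    rw [RightHom.map_apply, rightStructureMap_restrictRight, hg]
    simp only [LinearMap.comp_apply, LinearEquiv.coe_coe]
    rw [← rightStructureMap_restrictRight, rightStructureMap_coinducedRight,
      LinearEquiv.apply_symm_apply]
    rfl
  exact ⟨coinducedLift g, key⟩

theorem surjective_rightStructureMap_of_map_surjective
    (h : Function.Surjective (rightStructureMap R M X)) (f : X →ₗ[(TrivSqZeroExt R M)ᵐᵒᵖ] Y)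
    (hf : Function.Surjective (RightHom.map M (restrictRight f))) :
    Function.Surjective (rightStructureMap R M Y) := fun g => by
  obtain ⟨g, rfl⟩ := hf g
  obtain ⟨x, rfl⟩ := h g
  exact ⟨restrictRight f x, DFunLike.ext _ _ fun m => rightStructureMap_restrictRight f x m⟩

/-- Injective right modules over `R ⋉ M` are extensions of injective modules over `R`. -/
theorem exists_isRightExtension_of_injective (hM : Subsingleton (RTensor R M M))
    (I : ModuleCat.{u} (TrivSqZeroExt R M)ᵐᵒᵖ)
    (hI : Module.Injective (TrivSqZeroExt R M)ᵐᵒᵖ I) :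
    ∃ C : ModuleCat.{u} Rᵐᵒᵖ, Module.Injective Rᵐᵒᵖ C ∧ ∃ j π, IsRightExtension I C j π := by
  have hsurj : Function.Surjective (rightStructureMap R M I) := by
    -- The unit of the adjunction embeds `I` in a coinduced module, of which it is then a retract.
    let g : underlyingRight R M I →ₗ[Rᵐᵒᵖ] underlyingRight R M I := LinearMap.id
    have hs : Function.Injective (restrictRight (coinducedLift g)) := fun x y e => by
      rw [restrictRight_coinducedLift, restrictRight_coinducedLift] at e
      exact congrArg Prod.fst ((coinducedRightEquiv R M _).symm.injective e)
    obtain ⟨r, hr⟩ := hI.out (coinducedLift g) hs LinearMap.id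
    refine surjective_rightStructureMap_of_map_surjective
      ((isRightExtension_coinducedRight _).surjective_rightStructureMap hM) r fun f =>
        ⟨RightHom.map M (restrictRight (coinducedLift g)) f, DFunLike.ext _ _ fun m => ?_⟩
    exact hr (f m)
  obtain ⟨π, hπ⟩ := exists_isRightExtension hM I hsurj
  refine ⟨ModuleCat.of Rᵐᵒᵖ _, ⟨fun A B _ _ _ _ i hi f => ?_⟩, _, π, hπ⟩
  let f' : A →ₗ[Rᵐᵒᵖ] LinearMap.ker (rightStructureMap R M I) := f
  obtain ⟨g, hg⟩ := hI.out (mapTrivialRight (M := M) i) hi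
    (ofTrivialRight ((LinearMap.ker (rightStructureMap R M I)).subtype ∘ₗ f')
      fun n m => hπ.structureMap_j _ m)
  obtain ⟨g', hg'⟩ := hπ.exists_lift (restrictRight g ∘ₗ (trivialRightEquiv R M B).symm.toLinearMap)
    (fun n m => rightStructureMap_restrictRight_trivialRight g _ m)
  exact ⟨g', fun a => hπ.ses.inj ((hg' (i a)).trans (hg a))⟩

end Coinduced

end RightModules

/-! ### Gorenstein injective modules over the trivial extension -/

section GorensteinInjectiveExtension

variable {R : Type u} [Ring R] {M : Type u} [AddCommGroup M] [Module R M] [Module Rᵐᵒᵖ M]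
  [SMulCommClass R Rᵐᵒᵖ M]

namespace IsRightExtension

variable {Y : ModuleCat.{u} (TrivSqZeroExt R M)ᵐᵒᵖ} {C : Type u} [AddCommGroup C]
    [Module Rᵐᵒᵖ C] {j : C →ₗ[Rᵐᵒᵖ] underlyingRight R M Y}
    {π : underlyingRight R M Y →ₗ[Rᵐᵒᵖ] RightHom R M C}

/-- An injective copresentation of `C` induces one of an extension of `Hom(M, C)` by `C`. -/
theorem exists_embedding (h : IsRightExtension Y C j π) {E C' : Type u} [AddCommGroup C']
    [Module Rᵐᵒᵖ C'] [AddCommGroup E] [Module Rᵐᵒᵖ E] {ι : C →ₗ[Rᵐᵒᵖ] E} {ρ : E →ₗ[Rᵐᵒᵖ] C'}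
    (hιρ : IsShortExact ι ρ) (hE : Module.Injective Rᵐᵒᵖ E)
    (hρ : Function.Surjective (RightHom.map M ρ)) :
    ∃ (Y' : ModuleCat.{u} (TrivSqZeroExt R M)ᵐᵒᵖ)
      (i : Y →ₗ[(TrivSqZeroExt R M)ᵐᵒᵖ] coinducedRight R M E)
      (q : coinducedRight R M E →ₗ[(TrivSqZeroExt R M)ᵐᵒᵖ] Y'), IsShortExact i q ∧
      ∃ j' π', IsRightExtension Y' C' j' π' ∧
        ∀ e, j' (ρ e) = restrictRight q ((coinducedRightEquiv R M E).symm (e, 0)) := by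
  -- Injectivity of `E` extends `ι` along `j`; the map adjoint to `g` is `y ↦ (g y, ι ∘ π y)`.
  obtain ⟨g, hg⟩ := hE.out j h.ses.inj ι
  have hH := RightHom.isShortExact hιρ hρ
  have hi : ∀ y, restrictRight (coinducedLift g) y =
      (coinducedRightEquiv R M E).symm (g y, RightHom.map M ι (π y)) := fun y => by
    rw [restrictRight_coinducedLift]
    congr 2
    refine DFunLike.ext _ _ fun m => ?_
    rw [RightHom.map_apply, h.structureMap_eq, hg, RightHom.map_apply]
  have hij : ∀ c, restrictRight (coinducedLift g) (j c) =
      (coinducedRightEquiv R M E).symm (ι c, 0) := fun c => by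
    rw [hi, hg, h.ses.apply_apply, map_zero]
  have hπ : ∀ {y e}, restrictRight (coinducedLift g) y = (coinducedRightEquiv R M E).symm (e, 0) →
      ∃ c, j c = y ∧ ι c = e := fun {y e} hy => by
    rw [hi] at hy
    have hy := (coinducedRightEquiv R M E).symm.injective hy
    obtain ⟨c, rfl⟩ := h.ses.exists_of_eq_zero
      (hH.inj ((congrArg Prod.snd hy).trans (map_zero (RightHom.map M ι)).symm))
    exact ⟨c, rfl, (hg c).symm.trans (congrArg Prod.fst hy)⟩
  have hinj : Function.Injective (restrictRight (coinducedLift g)) := by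
    rw [injective_iff_map_eq_zero]
    intro y hy
    obtain ⟨c, rfl, hc⟩ := hπ (e := 0) (hy.trans (map_zero (coinducedRightEquiv R M E).symm).symm)
    rw [hιρ.inj (hc.trans (map_zero ι).symm), map_zero]
  let Y' : ModuleCat.{u} (TrivSqZeroExt R M)ᵐᵒᵖ :=
    ModuleCat.of _ (coinducedRight R M E ⧸ LinearMap.range (coinducedLift g))
  let q : coinducedRight R M E →ₗ[(TrivSqZeroExt R M)ᵐᵒᵖ] Y' :=
    (LinearMap.range (coinducedLift g)).mkQ
  have hq : IsShortExact (coinducedLift g) q := isShortExact_range_mkQ _ hinj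
  have hq' := isShortExact_restrictRight hq
  obtain ⟨j', hj'⟩ := hιρ.exists_desc (restrictRight q ∘ₗ
    (coinducedRightEquiv R M E).symm.toLinearMap ∘ₗ LinearMap.inl Rᵐᵒᵖ E _) (fun c => by
      refine Eq.trans ?_ (hq'.apply_apply (j c))
      rw [hij]
      rfl)
  have hj' : ∀ e, j' (ρ e) = restrictRight q ((coinducedRightEquiv R M E).symm (e, 0)) := hj'
  obtain ⟨π', hπ'⟩ := hq'.exists_desc (RightHom.map M ρ ∘ₗ LinearMap.snd Rᵐᵒᵖ E _ ∘ₗ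
    (coinducedRightEquiv R M E).toLinearMap) (fun y => by
      rw [hi]
      simp only [LinearMap.comp_apply, LinearEquiv.coe_coe, LinearEquiv.apply_symm_apply]
      exact hH.apply_apply (π y))
  have hπ' : ∀ x, π' (restrictRight q x) = RightHom.map M ρ (coinducedRightEquiv R M E x).2 := hπ'
  refine ⟨Y', coinducedLift g, q, hq, j', π', ⟨⟨(injective_iff_map_eq_zero _).2 fun c hc => ?_,
    fun y => ⟨fun hy => ?_, ?_⟩, fun f => ?_⟩, fun y m => ?_⟩, hj'⟩
  · obtain ⟨e, rfl⟩ := hιρ.surj c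
    rw [hj'] at hc
    obtain ⟨y, hy⟩ := hq'.exists_of_eq_zero hc
    obtain ⟨c, -, rfl⟩ := hπ hy
    exact hιρ.apply_apply c
  · obtain ⟨x, rfl⟩ := hq'.surj y
    rw [hπ'] at hy
    obtain ⟨f, hf⟩ := hH.exists_of_eq_zero hy
    obtain ⟨y, rfl⟩ := h.ses.surj f
    refine ⟨ρ ((coinducedRightEquiv R M E x).1 - g y), ?_⟩
    rw [hj', ← sub_eq_zero, ← map_sub]
    refine Eq.trans ?_ (hq'.apply_apply (-y))
    congr 1
    rw [map_neg, hi, ← map_neg, LinearEquiv.eq_symm_apply, map_sub,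
      LinearEquiv.apply_symm_apply, hf]
    ext1
    · simp
    · simp
  · rintro ⟨c, rfl⟩
    obtain ⟨e, rfl⟩ := hιρ.surj c
    rw [hj', hπ', LinearEquiv.apply_symm_apply, map_zero]
  · obtain ⟨f, rfl⟩ := hH.surj f
    exact ⟨restrictRight q ((coinducedRightEquiv R M E).symm (0, f)), by
      rw [hπ', LinearEquiv.apply_symm_apply]⟩
  · obtain ⟨x, rfl⟩ := hq'.surj y
    rw [hπ', RightHom.map_apply, hj', ← rightStructureMap_coinducedRight,
      ← rightStructureMap_restrictRight]

/-- A presentation of `C` by an injective module induces one of an extension of `Hom(M, C)`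
by `C`. -/
theorem exists_cover (h : IsRightExtension Y C j π) {C' E : Type u} [AddCommGroup C']
    [Module Rᵐᵒᵖ C'] [AddCommGroup E] [Module Rᵐᵒᵖ E] {κ : C' →ₗ[Rᵐᵒᵖ] E} {ε : E →ₗ[Rᵐᵒᵖ] C}
    (hκε : IsShortExact κ ε) (hε : Function.Surjective (RightHom.map M ε))
    (hext : ExtOneVanishes Rᵐᵒᵖ (RightHom R M E) C) :
    ∃ (K : ModuleCat.{u} (TrivSqZeroExt R M)ᵐᵒᵖ)
      (i : K →ₗ[(TrivSqZeroExt R M)ᵐᵒᵖ] coinducedRight R M E)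
      (q : coinducedRight R M E →ₗ[(TrivSqZeroExt R M)ᵐᵒᵖ] Y), IsShortExact i q ∧
      ∃ jK πK, IsRightExtension K C' jK πK := by
  have hH := RightHom.isShortExact hκε hε
  -- `Ext¹(Hom(M, E), C) = 0` lifts `Hom(M, ε)` through `π`; together with `j ∘ ε` this gives the
  -- map from the coinduced module onto `Y`.
  obtain ⟨γ, hγ⟩ := hext.exists_lift h.ses (RightHom.map M ε)
  let q : coinducedRight R M E →ₗ[(TrivSqZeroExt R M)ᵐᵒᵖ] Y := linearOfRestrictRight
    ((j ∘ₗ ε).coprod γ ∘ₗ (coinducedRightEquiv R M E).toLinearMap) fun x m => by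
      rw [rightStructureMap_coinducedRight, h.structureMap_eq]
      simp [hγ, h.ses.apply_apply]
  have hG : ∀ x, restrictRight q x = j (ε (coinducedRightEquiv R M E x).1) +
      γ (coinducedRightEquiv R M E x).2 := fun x => rfl
  have hGs : Function.Surjective (restrictRight q) := fun y => by
    obtain ⟨f, hf⟩ := hH.surj (π y)
    obtain ⟨c, hc⟩ := h.ses.exists_of_eq (l := y) (l' := γ f) (by rw [hγ, hf])
    obtain ⟨e, rfl⟩ := hκε.surj c
    refine ⟨(coinducedRightEquiv R M E).symm (e, f), (hG _).trans ?_⟩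
    rw [LinearEquiv.apply_symm_apply, hc]
    exact sub_add_cancel _ _
  let K : ModuleCat.{u} (TrivSqZeroExt R M)ᵐᵒᵖ := ModuleCat.of _ (LinearMap.ker q)
  let i : K →ₗ[(TrivSqZeroExt R M)ᵐᵒᵖ] coinducedRight R M E := (LinearMap.ker q).subtype
  have hi : IsShortExact i q := isShortExact_ker_subtype _ hGs
  have hi' := isShortExact_restrictRight hi
  obtain ⟨πK, hπK⟩ := hH.exists_lift (LinearMap.snd Rᵐᵒᵖ E _ ∘ₗ
    (coinducedRightEquiv R M E).toLinearMap ∘ₗ restrictRight i) (fun k => by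
      have := congrArg π (hi'.apply_apply k)
      rw [hG, map_add, hγ, h.ses.apply_apply, zero_add, map_zero] at this
      exact this)
  have hπK : ∀ k, RightHom.map M κ (πK k) = (coinducedRightEquiv R M E (restrictRight i k)).2 :=
    hπK
  obtain ⟨jK, hjK⟩ := hi'.exists_lift ((coinducedRightEquiv R M E).symm.toLinearMap ∘ₗ
    LinearMap.inl Rᵐᵒᵖ E _ ∘ₗ κ) (fun c => by
      rw [hG]
      simp [hκε.apply_apply])
  have hjK : ∀ c, restrictRight i (jK c) = (coinducedRightEquiv R M E).symm (κ c, 0) := hjK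
  refine ⟨K, i, q, hi, jK, πK, ⟨⟨fun a b e => ?_, fun k => ⟨fun hk => ?_, ?_⟩,
    fun f => ?_⟩, fun k m => ?_⟩⟩
  · have e' := congrArg (restrictRight i) e
    rw [hjK, hjK] at e'
    exact hκε.inj (congrArg Prod.fst ((coinducedRightEquiv R M E).symm.injective e'))
  · have h₁ := hπK k
    rw [hk, map_zero] at h₁
    have h₂ := hi'.apply_apply k
    rw [hG, ← h₁, map_zero, add_zero] at h₂
    obtain ⟨c, hc⟩ := hκε.exists_of_eq_zero (h.ses.inj (h₂.trans (map_zero j).symm))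
    refine ⟨c, hi'.inj ?_⟩
    rw [hjK, LinearEquiv.symm_apply_eq]
    exact Prod.ext hc h₁
  · rintro ⟨c, rfl⟩
    refine hH.inj ?_
    rw [hπK, hjK, LinearEquiv.apply_symm_apply, map_zero]
  · obtain ⟨c, hc⟩ := h.ses.exists_of_eq_zero (l := γ (RightHom.map M κ f)) (by
      rw [hγ, hH.apply_apply])
    obtain ⟨e, rfl⟩ := hκε.surj c
    obtain ⟨k, hk⟩ := hi'.exists_of_eq_zero
      (l := (coinducedRightEquiv R M E).symm (-e, RightHom.map M κ f)) (by
      rw [hG, LinearEquiv.apply_symm_apply, map_neg, map_neg, hc, neg_add_cancel])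
    refine ⟨k, hH.inj ?_⟩
    rw [hπK, hk, LinearEquiv.apply_symm_apply]
  · refine hi'.inj ?_
    rw [← rightStructureMap_restrictRight, rightStructureMap_coinducedRight, hjK, ← hπK,
      RightHom.map_apply]

/-- Maps from a module with trivial action into a right extension land in its submodule, so lifting
to the coinduced module reduces to lifting from `C'` to `E` over `R`. -/
theorem extOneVanishes_trivialRight (h : IsRightExtension Y C j π) {E C' N : Type u}
    [AddCommGroup C'] [Module Rᵐᵒᵖ C'] [AddCommGroup E] [Module Rᵐᵒᵖ E] [AddCommGroup N]
    [Module Rᵐᵒᵖ N] {ι : C →ₗ[Rᵐᵒᵖ] E} {ρ : E →ₗ[Rᵐᵒᵖ] C'}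
    (hιρ : IsShortExact ι ρ) (hE : Module.Injective Rᵐᵒᵖ E)
    (hρ : Function.Surjective (RightHom.map M ρ)) (hext : ExtOneVanishes Rᵐᵒᵖ N C) :
    ExtOneVanishes (TrivSqZeroExt R M)ᵐᵒᵖ (trivialRight R M N) Y := by
  obtain ⟨Y', i, q, hiq, j', π', h', hj'⟩ := h.exists_embedding hιρ hE hρ
  refine .of_injective_presentation hiq (injective_coinducedRight hE) fun f => ?_
  obtain ⟨f', hf'⟩ := h'.exists_lift
    (restrictRight f ∘ₗ (trivialRightEquiv R M N).symm.toLinearMap)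
    (fun n m => rightStructureMap_restrictRight_trivialRight f _ m)
  obtain ⟨g, hg⟩ := hext.exists_lift hιρ f'
  refine ⟨ofTrivialRight ((coinducedRightEquiv R M E).symm.toLinearMap ∘ₗ
    LinearMap.inl Rᵐᵒᵖ E _ ∘ₗ g) fun n m => ?_, fun n => ?_⟩
  · rw [rightStructureMap_coinducedRight]
    simp
  · exact ((hj' (g (trivialRightEquiv R M N n))).symm.trans
      (congrArg j' (hg (trivialRightEquiv R M N n)))).trans (hf' (trivialRightEquiv R M N n))

/-- An extension of `Hom(M, C)` by `C` as an extension of modules with trivial action. -/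
theorem exists_isShortExact_trivialRight (h : IsRightExtension Y C j π) :
    ∃ (a : trivialRight R M C →ₗ[(TrivSqZeroExt R M)ᵐᵒᵖ] Y)
      (b : Y →ₗ[(TrivSqZeroExt R M)ᵐᵒᵖ] trivialRight R M (RightHom R M C)),
      IsShortExact a b := by
  refine ⟨ofTrivialRight j h.structureMap_j, linearOfRestrictRight
    ((trivialRightEquiv R M _).symm.toLinearMap ∘ₗ π) (fun x m => ?_),
    isShortExact_of_restrictRight ?_⟩
  · rw [rightStructureMap_trivialRight, LinearMap.comp_apply, h.π_structureMap, map_zero]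
  · exact (h.ses.comp_equiv_left (trivialRightEquiv R M C)).comp_equiv_right
      (trivialRightEquiv R M (RightHom R M C)).symm

/-- Short exact sequences of extensions induce short exact sequences of the submodules. -/
theorem exists_isShortExact_submodule (hM : Subsingleton (RTensor R M M))
    {X Z : ModuleCat.{u} (TrivSqZeroExt R M)ᵐᵒᵖ} {B D : Type u}
    [AddCommGroup B] [Module Rᵐᵒᵖ B] [AddCommGroup D] [Module Rᵐᵒᵖ D]
    {jX : B →ₗ[Rᵐᵒᵖ] underlyingRight R M X} {πX : underlyingRight R M X →ₗ[Rᵐᵒᵖ] RightHom R M B}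
    {jZ : D →ₗ[Rᵐᵒᵖ] underlyingRight R M Z} {πZ : underlyingRight R M Z →ₗ[Rᵐᵒᵖ] RightHom R M D}
    (hX : IsRightExtension X B jX πX) (h : IsRightExtension Y C j π)
    (hZ : IsRightExtension Z D jZ πZ) {i : X →ₗ[(TrivSqZeroExt R M)ᵐᵒᵖ] Y}
    {p : Y →ₗ[(TrivSqZeroExt R M)ᵐᵒᵖ] Z} (hip : IsShortExact i p) :
    ∃ (α : B →ₗ[Rᵐᵒᵖ] C) (β : C →ₗ[Rᵐᵒᵖ] D), IsShortExact α β ∧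
      ∀ c, jZ (β c) = restrictRight p (j c) := by
  have hip' := isShortExact_restrictRight hip
  obtain ⟨α, hα⟩ := h.exists_lift (restrictRight i ∘ₗ jX) (fun b m => by
    rw [LinearMap.comp_apply, rightStructureMap_restrictRight, hX.structureMap_j, map_zero])
  obtain ⟨β, hβ⟩ := hZ.exists_lift (restrictRight p ∘ₗ j) (fun b m => by
    rw [LinearMap.comp_apply, rightStructureMap_restrictRight, h.structureMap_j, map_zero])
  simp only [LinearMap.comp_apply] at hα hβ
  refine ⟨α, β, ⟨fun b b' e => ?_, fun c => ⟨fun hc => ?_, ?_⟩, fun d => ?_⟩, hβ⟩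
  · have e' := congrArg j e
    rw [hα, hα] at e'
    exact hX.ses.inj (hip'.inj e')
  · have hc' := hβ c
    rw [hc, map_zero] at hc'
    obtain ⟨x, hx⟩ := hip'.exists_of_eq_zero hc'.symm
    obtain ⟨b, rfl⟩ := hX.ses.exists_of_eq_zero (hX.π_eq_zero fun m => hip'.inj (by
      rw [← rightStructureMap_restrictRight, hx, h.structureMap_j, map_zero]))
    exact ⟨b, h.ses.inj (by rw [hα, hx])⟩
  · rintro ⟨b, rfl⟩
    exact hZ.ses.inj (by rw [hβ, hα, hip'.apply_apply, map_zero])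
  · obtain ⟨y, hy⟩ := hip'.surj (jZ d)
    -- A lift `y` of `jZ d` need not be annihilated by `M`, but the action of `M` on it takes values
    -- in `X`. Surjectivity of the structure map of `X` provides `x` with the same action, and `y -
    -- i x` lies in the image of `j`.
    obtain ⟨f, hf⟩ := hip'.exists_lift
      (show M →ₗ[Rᵐᵒᵖ] underlyingRight R M Y from rightStructureMap R M Y y) (fun m => by
        refine (rightStructureMap_restrictRight p y m).symm.trans ?_
        rw [hy, hZ.structureMap_j])
    obtain ⟨x, hx⟩ := hX.surjective_rightStructureMap hM f
    have hfx : ∀ m, rightStructureMap R M Y (y - restrictRight i x) m = 0 := fun m => by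
      rw [map_sub, RightHom.sub_apply, rightStructureMap_restrictRight, hx, sub_eq_zero]
      exact (hf m).symm
    obtain ⟨c, hc⟩ := h.ses.exists_of_eq_zero (h.π_eq_zero hfx)
    exact ⟨c, hZ.ses.inj (by rw [hβ, hc, map_sub, hip'.apply_apply, sub_zero, hy])⟩

end IsRightExtension

/-- Coinduction preserves short exact sequences that stay exact under `Hom(M, -)`. -/
theorem exists_isShortExact_coinducedRight {K F N : Type u} [AddCommGroup K] [Module Rᵐᵒᵖ K]
    [AddCommGroup F] [Module Rᵐᵒᵖ F] [AddCommGroup N] [Module Rᵐᵒᵖ N] {i : K →ₗ[Rᵐᵒᵖ] F}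
    {p : F →ₗ[Rᵐᵒᵖ] N} (h : IsShortExact i p) (hp : Function.Surjective (RightHom.map M p)) :
    ∃ (a : coinducedRight R M K →ₗ[(TrivSqZeroExt R M)ᵐᵒᵖ] coinducedRight R M F)
      (b : coinducedRight R M F →ₗ[(TrivSqZeroExt R M)ᵐᵒᵖ] coinducedRight R M N),
      IsShortExact a b := by
  let φ : ∀ {A B : Type u} [AddCommGroup A] [Module Rᵐᵒᵖ A] [AddCommGroup B] [Module Rᵐᵒᵖ B]
      (_ : A →ₗ[Rᵐᵒᵖ] B),
      coinducedRight R M A →ₗ[(TrivSqZeroExt R M)ᵐᵒᵖ] coinducedRight R M B :=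
    fun {A B} _ _ _ _ f => linearOfRestrictRight ((coinducedRightEquiv R M B).symm.toLinearMap ∘ₗ
      f.prodMap (RightHom.map M f) ∘ₗ (coinducedRightEquiv R M A).toLinearMap) fun x m => by
        rw [rightStructureMap_coinducedRight, rightStructureMap_coinducedRight]
        simp
  refine ⟨φ i, φ p, isShortExact_of_restrictRight ?_⟩
  have hH := RightHom.isShortExact h hp
  have h' : IsShortExact (i.prodMap (RightHom.map M i)) (p.prodMap (RightHom.map M p)) :=
    { inj := h.inj.prodMap hH.inj
      exact := fun x => by
        rw [LinearMap.prodMap_apply, Prod.mk_eq_zero, h.exact x.1, hH.exact x.2]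
        constructor
        · rintro ⟨⟨a, ha⟩, ⟨b, hb⟩⟩
          exact ⟨(a, b), Prod.ext ha hb⟩
        · rintro ⟨⟨a, b⟩, hab⟩
          exact ⟨⟨a, congrArg Prod.fst hab⟩, ⟨b, congrArg Prod.snd hab⟩⟩
      surj := h.surj.prodMap hH.surj }
  refine ⟨(coinducedRightEquiv R M F).symm.injective.comp
    (h'.inj.comp (coinducedRightEquiv R M K).injective), fun x => ?_,
    (coinducedRightEquiv R M N).symm.surjective.comp
    (h'.surj.comp (coinducedRightEquiv R M F).surjective)⟩
  change (coinducedRightEquiv R M N).symm ((p.prodMap (RightHom.map M p))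
    (coinducedRightEquiv R M F x)) = 0 ↔ _
  rw [LinearEquiv.map_eq_zero_iff]
  refine (h'.exact _).trans ⟨?_, ?_⟩
  · rintro ⟨y, hy⟩
    refine ⟨(coinducedRightEquiv R M K).symm y, ?_⟩
    change (coinducedRightEquiv R M F).symm (i.prodMap (RightHom.map M i)
      (coinducedRightEquiv R M K ((coinducedRightEquiv R M K).symm y))) = x
    rw [LinearEquiv.apply_symm_apply, hy]
    exact (coinducedRightEquiv R M F).symm_apply_apply x
  · rintro ⟨y, rfl⟩
    refine ⟨coinducedRightEquiv R M K y, ?_⟩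
    exact ((coinducedRightEquiv R M F).apply_symm_apply _).symm

/-! #### Injective modules as retracts of character modules of free modules -/

/-- Every injective right module is a retract of the character module of a free module. -/
theorem exists_retract_leftDual_finsupp (E : ModuleCat.{u} Rᵐᵒᵖ) (hE : Module.Injective Rᵐᵒᵖ E) :
    ∃ (ι : Type u) (s : E →ₗ[Rᵐᵒᵖ] LeftDual R (ι →₀ R)) (r : LeftDual R (ι →₀ R) →ₗ[Rᵐᵒᵖ] E),
      ∀ x, r (s x) = x := by
  -- `E` embeds in `E⁺⁺`, which embeds in `F⁺` for a free module `F` mapping onto `E⁺`; injectivity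
  -- of `E` splits the embedding.
  let ev : E →ₗ[Rᵐᵒᵖ] LeftDual R (RightDual R E) :=
    { toFun := fun e => (AddMonoidHom.eval e : (E →+ AddCircle (1 : ℚ)) →+ AddCircle (1 : ℚ))
      map_add' := fun a b => DFunLike.ext _ _ fun φ => map_add φ a b
      map_smul' := fun a b => rfl }
  let q := Finsupp.linearCombination R (id : RightDual R E → RightDual R E)
  have hq : Function.Surjective q := Finsupp.linearCombination_id_surjective R _
  have hinj : Function.Injective (LeftDual.map q ∘ₗ ev) := by
    rw [injective_iff_map_eq_zero]
    intro e he
    by_contra hne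
    obtain ⟨φ, hφ⟩ := exists_character_ne_zero hne
    obtain ⟨x, hx⟩ := hq φ
    exact hφ ((DFunLike.congr_fun hx e).symm.trans (DFunLike.congr_fun he x))
  obtain ⟨r, hr⟩ := hE.out (LeftDual.map q ∘ₗ ev) hinj LinearMap.id
  exact ⟨RightDual R E, LeftDual.map q ∘ₗ ev, r, hr⟩

variable (R M) in
/-- The adjunction isomorphism `(M ⊗ X)⁺ ≃ Hom(M, X⁺)`. -/
noncomputable def leftDualTensorEquiv (X : Type u) [AddCommGroup X] [Module R X] :
    LeftDual R (RTensor R M X) ≃ₗ[Rᵐᵒᵖ] RightHom R M (LeftDual R X) where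
  toFun φ := RTensor.toLeftDual φ
  invFun f := RTensor.ofLeftDual f
  left_inv _ := RTensor.hom_ext fun _ _ => rfl
  right_inv _ := rfl
  map_add' _ _ := rfl
  map_smul' _ _ := rfl

/-- Here the Tor hypothesis becomes an Ext statement: `Hom(M, E)` is a retract of `Hom(M, F⁺) ≅ (M ⊗
F)⁺` with `F` free. -/
theorem extAcyclic_rightHom
    (hTor : ∀ P : ModuleCat.{u} R, Module.Projective R P → TorAcyclic R M (RTensor R M P))
    (E : ModuleCat.{u} Rᵐᵒᵖ) (hE : Module.Injective Rᵐᵒᵖ E) :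
    ExtAcyclic Rᵐᵒᵖ M (RightHom R M E) := by
  obtain ⟨ι, s, r, hrs⟩ := exists_retract_leftDual_finsupp E hE
  have hF : Module.Projective R (ι →₀ R) := inferInstance
  refine (hTor (ModuleCat.of R (ι →₀ R)) hF).extAcyclic.retract
    ((leftDualTensorEquiv R M (ι →₀ R)).symm.toLinearMap ∘ₗ RightHom.map M s)
    (RightHom.map M r ∘ₗ (leftDualTensorEquiv R M (ι →₀ R)).toLinearMap) fun f => ?_
  rw [LinearMap.comp_apply, LinearMap.comp_apply, LinearEquiv.coe_coe, LinearEquiv.coe_coe,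
    LinearEquiv.apply_symm_apply]
  exact DFunLike.ext _ _ fun m => hrs (f m)

/-- Dualising a finite flat resolution of `X` gives a finite injective coresolution of `X⁺`, along
which the vanishing passes to kernels. -/
theorem GorensteinInjective.extOneVanishes_leftDual {n : ℕ} {X : ModuleCat.{u} R}
    (hX : HasResolutionLE (IsFlatLeft R) n X) (C : ModuleCat.{u} Rᵐᵒᵖ)
    (hC : GorensteinInjective Rᵐᵒᵖ C) : ExtOneVanishes Rᵐᵒᵖ (LeftDual R X) C := by
  induction n generalizing X C with
  | zero =>
    obtain ⟨F, hF, ⟨e⟩⟩ := hX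
    have hX : IsFlatLeft R X := isFlatLeft_retract hF e.symm.toLinearMap e.toLinearMap
      (fun y => e.apply_symm_apply y)
    exact hC.extOneVanishes_of_injective (E := ModuleCat.of Rᵐᵒᵖ (LeftDual R X))
      ((isFlatLeft_iff_injective_leftDual X).1 hX)
  | succ n ih =>
    obtain ⟨K, F, i, p, h₁, h₂, h₃, hF, hK⟩ := hX
    exact extOneVanishes_kernel (LeftDual.map_isShortExact ⟨h₁, h₂, h₃⟩)
      (fun C hC => hC.extOneVanishes_of_injective (E := ModuleCat.of Rᵐᵒᵖ (LeftDual R F))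
        ((isFlatLeft_iff_injective_leftDual F).1 hF))
      (fun C hC => ih hK C hC) C hC

theorem extOneVanishes_coinducedRight {n : ℕ} {X : ModuleCat.{u} R}
    (hX : HasResolutionLE (IsFlatLeft R) n X) (hTor : TorAcyclic R M X)
    (Z : ModuleCat.{u} (TrivSqZeroExt R M)ᵐᵒᵖ)
    (hZ : GorensteinInjective (TrivSqZeroExt R M)ᵐᵒᵖ Z) :
    ExtOneVanishes (TrivSqZeroExt R M)ᵐᵒᵖ (coinducedRight R M (LeftDual R X)) Z := by
  induction n generalizing X Z with
  | zero =>
    obtain ⟨F, hF, ⟨e⟩⟩ := hX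
    have hX : IsFlatLeft R X := isFlatLeft_retract hF e.symm.toLinearMap e.toLinearMap
      (fun y => e.apply_symm_apply y)
    exact hZ.extOneVanishes_of_injective
      (injective_coinducedRight ((isFlatLeft_iff_injective_leftDual X).1 hX))
  | succ n ih =>
    obtain ⟨K, F, i, p, h₁, h₂, h₃, hF, hK⟩ := hX
    have hip : IsShortExact i p := ⟨h₁, h₂, h₃⟩
    obtain ⟨a, b, hab⟩ := exists_isShortExact_coinducedRight (M := M)
      (LeftDual.map_isShortExact hip)
      (RightHom.map_surjective (LeftDual.map_isShortExact hip) hTor.extOneVanishes)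
    exact GorensteinInjective.extOneVanishes_kernel hab
      (fun Z hZ => hZ.extOneVanishes_of_injective
        (injective_coinducedRight ((isFlatLeft_iff_injective_leftDual F).1 hF)))
      (fun Z hZ => ih hK (hTor.syzygy_right hip hF) Z hZ) Z hZ

/-- `Ext¹(Hom(M, E), C) = 0` for `C` Gorenstein injective and `E` injective, if `M` has finite
flat dimension. -/
theorem extOneVanishes_rightHom {n : ℕ} (h : HasResolutionLE (IsFlatLeft R) n (ModuleCat.of R M))
    {E C : ModuleCat.{u} Rᵐᵒᵖ} (hE : Module.Injective Rᵐᵒᵖ E) (hC : GorensteinInjective Rᵐᵒᵖ C) :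
    ExtOneVanishes Rᵐᵒᵖ (RightHom R M E) C := by
  obtain ⟨ι, s, r, hrs⟩ := exists_retract_leftDual_finsupp E hE
  refine ((GorensteinInjective.extOneVanishes_leftDual
    (hasResolutionLE_tensor_finsupp (ι := ι) isFlatLeft_finsupp h) C hC).congr_left
    (leftDualTensorEquiv R M (ι →₀ R))).retract_left (RightHom.map M s) (RightHom.map M r)
    fun f => DFunLike.ext _ _ fun m => hrs (f m)

/-- For `F` free, `F⁺` with trivial action is the kernel of a surjection from the coinduced module
of `F⁺` onto the trivial module `Hom(M, F⁺) ≅ (M ⊗ F)⁺`. The latter is itself coinduced because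
`Hom(M, Hom(M, F⁺)) = 0`, and it is covered by `extOneVanishes_coinducedRight`. Finally `E` is a
retract of such an `F⁺`. -/
theorem extOneVanishes_trivialRight_of_injective {n : ℕ} (hM : Subsingleton (RTensor R M M))
    (hTor : ∀ P : ModuleCat.{u} R, Module.Projective R P → TorAcyclic R M (RTensor R M P))
    (h : HasResolutionLE (IsFlatLeft R) n (ModuleCat.of R M)) {E : ModuleCat.{u} Rᵐᵒᵖ}
    (hE : Module.Injective Rᵐᵒᵖ E) (Z : ModuleCat.{u} (TrivSqZeroExt R M)ᵐᵒᵖ)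
    (hZ : GorensteinInjective (TrivSqZeroExt R M)ᵐᵒᵖ Z) :
    ExtOneVanishes (TrivSqZeroExt R M)ᵐᵒᵖ (trivialRight R M E) Z := by
  obtain ⟨ι, s, r, hrs⟩ := exists_retract_leftDual_finsupp E hE
  have hF : Module.Projective R (ι →₀ R) := inferInstance
  let e := leftDualTensorEquiv R M (ι →₀ R)
  obtain ⟨a, b, hab⟩ := (isRightExtension_coinducedRight (R := R) (M := M)
    (LeftDual R (RTensor R M (ι →₀ R)))).exists_isShortExact_trivialRight
  have hb : ∀ x, b x = 0 := fun x => by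
    refine (trivialRightEquiv R M (RightHom R M (LeftDual R (RTensor R M (ι →₀ R))))).injective
      (DFunLike.ext _ _ fun m => e.injective (DFunLike.ext _ _ fun m' => ?_))
    exact (RightHom.apply_apply_eq_zero hM (e.toLinearMap ∘ₗ
      (show M →ₗ[Rᵐᵒᵖ] LeftDual R (RTensor R M (ι →₀ R)) from
        trivialRightEquiv R M (RightHom R M (LeftDual R (RTensor R M (ι →₀ R)))) (b x))) m m')
  have ha : Function.Bijective a := ⟨hab.inj, fun x => hab.exists_of_eq_zero (hb x)⟩
  have hH : ∀ Z : ModuleCat.{u} (TrivSqZeroExt R M)ᵐᵒᵖ,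
      GorensteinInjective (TrivSqZeroExt R M)ᵐᵒᵖ Z → ExtOneVanishes (TrivSqZeroExt R M)ᵐᵒᵖ
        (trivialRight R M (RightHom R M (LeftDual R (ι →₀ R)))) Z := fun Z hZ =>
    ((extOneVanishes_coinducedRight
      (hasResolutionLE_tensor_finsupp (ι := ι) isFlatLeft_finsupp h)
      (hTor (ModuleCat.of R (ι →₀ R)) hF) Z hZ).congr_left
        (LinearEquiv.ofBijective a ha).symm).retract_left
      (mapTrivialRight e.symm.toLinearMap) (mapTrivialRight e.toLinearMap) fun x =>
        (trivialRightEquiv R M (RightHom R M (LeftDual R (ι →₀ R)))).injective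
          (e.apply_symm_apply _)
  obtain ⟨a', b', hab'⟩ := (isRightExtension_coinducedRight (R := R) (M := M)
    (LeftDual R (ι →₀ R))).exists_isShortExact_trivialRight
  refine (GorensteinInjective.extOneVanishes_kernel hab' (fun Z hZ =>
    hZ.extOneVanishes_of_injective (injective_coinducedRight
      ((isFlatLeft_iff_injective_leftDual (ModuleCat.of R (ι →₀ R))).1
        (isFlatLeft_of_projective _ hF)))) hH Z hZ).retract_left (mapTrivialRight s)
    (mapTrivialRight r) fun x => ?_
  exact (trivialRightEquiv R M E).injective (hrs _)

theorem gorensteinInjective_le_psiClass (hM : Subsingleton (RTensor R M M))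
    (hTor : ∀ P : ModuleCat.{u} R, Module.Projective R P → TorAcyclic R M (RTensor R M P))
    {n k : ℕ} (hfd : HasResolutionLE (IsFlatLeft R) n (ModuleCat.of R M))
    (hpd : HasResolutionLE (IsProj Rᵐᵒᵖ) k (ModuleCat.of Rᵐᵒᵖ M))
    (Y : ModuleCat.{u} (TrivSqZeroExt R M)ᵐᵒᵖ)
    (hY : GorensteinInjective (TrivSqZeroExt R M)ᵐᵒᵖ Y) :
    PsiClass M (GorensteinInjective Rᵐᵒᵖ) Y := by
  have hsurj : ∀ Z, GorensteinInjective (TrivSqZeroExt R M)ᵐᵒᵖ Z →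
      Function.Surjective (rightStructureMap R M Z) := by
    intro Z hZ
    obtain ⟨Z', hZ', I, i, p, hip, hI, -⟩ := hZ.exists_left
    obtain ⟨C, -, j, π, h⟩ := exists_isRightExtension_of_injective hM I hI
    refine surjective_rightStructureMap_of_map_surjective (h.surjective_rightStructureMap hM) p
      (RightHom.map_surjective (isShortExact_restrictRight hip) ?_)
    -- The shift runs along the resolution to the left: its injective terms extend `Hom(M, C)` by
    -- `C` with `C` injective, so they have no higher Ext from `M`.
    refine hpd.extOneVanishes (fun W => ∃ Z, GorensteinInjective (TrivSqZeroExt R M)ᵐᵒᵖ Z ∧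
      W = underlyingRight R M Z) ?_ _ ⟨Z', hZ', rfl⟩
    rintro W ⟨Z, hZ, rfl⟩
    obtain ⟨Z', hZ', I, i, p, hip, hI, -⟩ := hZ.exists_left
    obtain ⟨C, hC, j, π, h⟩ := exists_isRightExtension_of_injective hM I hI
    exact ⟨_, _, _, _, isShortExact_restrictRight hip,
      .extension h.ses (.of_injective hC) (extAcyclic_rightHom hTor C hC), Z', hZ', rfl⟩
  have hstep : ∀ (Z Z' : ModuleCat.{u} (TrivSqZeroExt R M)ᵐᵒᵖ) (C C' : ModuleCat.{u} Rᵐᵒᵖ)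
      j π j' π', IsRightExtension Z C j π → IsRightExtension Z' C' j' π' → InjectiveStep Z Z' →
      GorensteinInjective (TrivSqZeroExt R M)ᵐᵒᵖ Z → InjectiveStep C C' := by
    rintro Z Z' C C' j π j' π' h h' ⟨I, i, p, hip, hI, -⟩ hZ
    obtain ⟨D, hD, jI, πI, hI'⟩ := exists_isRightExtension_of_injective hM I hI
    obtain ⟨α, β, hαβ, hβ⟩ := IsRightExtension.exists_isShortExact_submodule hM h hI' h' hip
    refine ⟨D, α, β, hαβ, hD, fun E hE f => ?_⟩
    -- A map `E → C'` is regarded as a map from `E` with trivial action to `Z'`; its lift to `I`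
    -- lands in `D`.
    obtain ⟨g, hg⟩ := (extOneVanishes_trivialRight_of_injective hM hTor hfd hE Z hZ).exists_lift
      hip (ofTrivialRight (j' ∘ₗ f) fun n m => h'.structureMap_j (f n) m)
    obtain ⟨g', hg'⟩ := hI'.exists_lift
      (restrictRight g ∘ₗ (trivialRightEquiv R M E).symm.toLinearMap)
      (fun n m => rightStructureMap_restrictRight_trivialRight g _ m)
    refine ⟨g', fun e => h'.ses.inj ?_⟩
    rw [hβ, hg']
    exact hg e
  refine (psiClass_iff hM _ (fun X Y hX ⟨e⟩ => hX.of_equiv e) Y).2 ?_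
  obtain ⟨π, hπ⟩ := exists_isRightExtension hM Y (hsurj Y hY)
  refine ⟨ModuleCat.of Rᵐᵒᵖ _, gorensteinInjective_of_class (fun C => ∃ Z,
    GorensteinInjective (TrivSqZeroExt R M)ᵐᵒᵖ Z ∧ ∃ j π, IsRightExtension Z C j π) ?_ ?_ _
    ⟨Y, hY, _, π, hπ⟩, _, π, hπ⟩
  · rintro C ⟨Z, hZ, j, π, h⟩
    obtain ⟨Z', hZ', hZZ'⟩ := hZ.exists_right
    obtain ⟨π', hπ'⟩ := exists_isRightExtension hM Z' (hsurj Z' hZ')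
    exact ⟨ModuleCat.of Rᵐᵒᵖ _, ⟨Z', hZ', _, π', hπ'⟩,
      hstep Z Z' C (ModuleCat.of Rᵐᵒᵖ _) _ _ _ _ h hπ' hZZ' hZ⟩
  · rintro C ⟨Z, hZ, j, π, h⟩
    obtain ⟨Z', hZ', hZZ'⟩ := hZ.exists_left
    obtain ⟨π', hπ'⟩ := exists_isRightExtension hM Z' (hsurj Z' hZ')
    exact ⟨ModuleCat.of Rᵐᵒᵖ _, ⟨Z', hZ', _, π', hπ'⟩,
      hstep Z' Z (ModuleCat.of Rᵐᵒᵖ _) C _ _ _ _ hπ' h hZZ' hZ'⟩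

theorem psiClass_le_gorensteinInjective (hM : Subsingleton (RTensor R M M))
    {n k : ℕ} (hfd : HasResolutionLE (IsFlatLeft R) n (ModuleCat.of R M))
    (hpd : HasResolutionLE (IsProj Rᵐᵒᵖ) k (ModuleCat.of Rᵐᵒᵖ M))
    (Y : ModuleCat.{u} (TrivSqZeroExt R M)ᵐᵒᵖ) (hY : PsiClass M (GorensteinInjective Rᵐᵒᵖ) Y) :
    GorensteinInjective (TrivSqZeroExt R M)ᵐᵒᵖ Y := by
  have hhom : ∀ (C I C' : ModuleCat.{u} Rᵐᵒᵖ) (i : C →ₗ[Rᵐᵒᵖ] I) (p : I →ₗ[Rᵐᵒᵖ] C'),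
      IsShortExact i p → GorensteinInjective Rᵐᵒᵖ C →
        Function.Surjective (RightHom.map (R := R) M p) := by
    intro C I C' i p hip hC
    refine RightHom.map_surjective hip
      (hpd.extOneVanishes (GorensteinInjective Rᵐᵒᵖ) (fun Z hZ => ?_) C hC)
    obtain ⟨Z', hZ', I, i, p, hip, hI, -⟩ := hZ.exists_left
    exact ⟨Z', I, i, p, hip, .of_injective hI, hZ'⟩
  -- An injective `E` is an extension of `Hom(M, D)` by `D`, both with trivial action and `D`
  -- injective, which leaves two vanishing statements over `R`.
  have hext : ∀ (Y : ModuleCat.{u} (TrivSqZeroExt R M)ᵐᵒᵖ) (C : ModuleCat.{u} Rᵐᵒᵖ) j π,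
      GorensteinInjective Rᵐᵒᵖ C → IsRightExtension Y C j π →
      ∀ E : ModuleCat.{u} (TrivSqZeroExt R M)ᵐᵒᵖ, Module.Injective (TrivSqZeroExt R M)ᵐᵒᵖ E →
        ExtOneVanishes (TrivSqZeroExt R M)ᵐᵒᵖ E Y := by
    intro Y C j π hC h E hE
    obtain ⟨D, hD, jE, πE, hE'⟩ := exists_isRightExtension_of_injective hM E hE
    obtain ⟨a, b, hab⟩ := hE'.exists_isShortExact_trivialRight
    obtain ⟨C', hC', I, i, p, hip, hI, -⟩ := hC.exists_right
    have hp := hhom _ _ _ i p hip hC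
    exact .extension_left hab
      (h.extOneVanishes_trivialRight hip hI hp (hC.extOneVanishes_of_injective hD))
      (h.extOneVanishes_trivialRight hip hI hp (extOneVanishes_rightHom hfd hD hC))
  refine gorensteinInjective_of_class (fun Y => ∃ C : ModuleCat.{u} Rᵐᵒᵖ,
    GorensteinInjective Rᵐᵒᵖ C ∧ ∃ j π, IsRightExtension Y C j π)
    ?_ ?_ Y ((psiClass_iff hM _ (fun X Y hX ⟨e⟩ => hX.of_equiv e) Y).1 hY)
  · rintro Y ⟨C, hC, j, π, h⟩
    obtain ⟨C', hC', I, i, p, hip, hI, -⟩ := hC.exists_right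
    obtain ⟨Y', a, b, hab, j', π', h', -⟩ := h.exists_embedding hip hI (hhom _ _ _ i p hip hC)
    exact ⟨Y', ⟨C', hC', j', π', h'⟩, _, a, b, hab, injective_coinducedRight hI,
      fun E hE f => (hext Y C j π hC h E hE).exists_lift hab f⟩
  · rintro Y ⟨C, hC, j, π, h⟩
    obtain ⟨C', hC', I, i, p, hip, hI, -⟩ := hC.exists_left
    obtain ⟨K, a, b, hab, j', π', h'⟩ := h.exists_cover hip (hhom _ _ _ i p hip hC')
      (extOneVanishes_rightHom hfd hI hC)
    exact ⟨K, ⟨C', hC', j', π', h'⟩, _, a, b, hab, injective_coinducedRight hI,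
      fun E hE f => (hext K C' j' π' hC' h' E hE).exists_lift hab f⟩

end GorensteinInjectiveExtension

/-! ### Tensor products of finitely presented modules with character modules -/

namespace RTensor

variable {R : Type*} [Ring R] {A B J : Type*} [AddCommGroup A] [Module Rᵐᵒᵖ A]
  [AddCommGroup B] [Module Rᵐᵒᵖ B] [AddCommGroup J] [Module Rᵐᵒᵖ J]

/-- The evaluation `A ⊗ J⁺ → Hom(A, J)⁺`. -/
noncomputable def toHomDual (R : Type*) [Ring R] (A J : Type*) [AddCommGroup A] [Module Rᵐᵒᵖ A]
    [AddCommGroup J] [Module Rᵐᵒᵖ J] :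
    RTensor R A (RightDual R J) →+ (A →ₗ[Rᵐᵒᵖ] J) →+ AddCircle (1 : ℚ) :=
  lift (AddMonoidHom.mk' (fun a => AddMonoidHom.mk' (fun φ => AddMonoidHom.mk' (fun f => φ (f a))
      (fun f g => map_add φ (f a) (g a))) (fun φ ψ => rfl))
    (fun a b => by
      ext φ f
      exact (congrArg φ (map_add f a b)).trans (map_add φ _ _)))
    (fun r a φ => by
      ext f
      exact congrArg φ (f.map_smul (op r) a))

@[simp]
theorem toHomDual_tmul (a : A) (φ : RightDual R J) (f : A →ₗ[Rᵐᵒᵖ] J) :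
    toHomDual R A J (tmul R a φ) f = φ (f a) := rfl

theorem toHomDual_rTensor (d : A →ₗ[Rᵐᵒᵖ] B) (t : RTensor R A (RightDual R J))
    (f : B →ₗ[Rᵐᵒᵖ] J) :
    toHomDual R B J (rTensor _ d t) f = toHomDual R A J t (f ∘ₗ d) := by
  induction t using RTensor.induction_on with
  | zero => simp
  | add s t hs ht => simp only [map_add, AddMonoidHom.add_apply, hs, ht]
  | tmul a φ => rfl

theorem exists_eq_sum_tmul_single {n : ℕ} {X : Type*} [AddCommGroup X] [Module R X]
    (t : RTensor R (Fin n → Rᵐᵒᵖ) X) :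
    ∃ x : Fin n → X, t = ∑ i, tmul R (Pi.single i 1) (x i) := by
  induction t using RTensor.induction_on with
  | zero => exact ⟨0, by simp [tmul_zero]⟩
  | add s t hs ht =>
    obtain ⟨x, rfl⟩ := hs
    obtain ⟨y, rfl⟩ := ht
    exact ⟨x + y, by simp [tmul_add, Finset.sum_add_distrib]⟩
  | tmul a x =>
    refine ⟨fun i => unop (a i) • x, ?_⟩
    have ha : a = ∑ i, op (unop (a i)) • (Pi.single i 1 : Fin n → Rᵐᵒᵖ) := by
      ext i
      simp [Finset.sum_apply, Pi.single_apply]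
    conv_lhs => rw [ha, sum_tmul]
    exact Finset.sum_congr rfl fun i _ => smul_tmul _ _ _

theorem toHomDual_pi_bijective (n : ℕ) :
    Function.Bijective (toHomDual R (Fin n → Rᵐᵒᵖ) J) := by
  -- The map sending the `i`-th basis vector to `j` and the others to zero. These maps detect the
  -- coordinates of a tensor.
  let c : Fin n → J → (Fin n → Rᵐᵒᵖ) →ₗ[Rᵐᵒᵖ] J := fun i j =>
    LinearMap.toSpanSingleton Rᵐᵒᵖ J j ∘ₗ LinearMap.proj i
  have hc : ∀ i j x, c i j x = x i • j := fun i j x => rfl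
  constructor
  · rw [injective_iff_map_eq_zero]
    intro t ht
    obtain ⟨φ, rfl⟩ := exists_eq_sum_tmul_single t
    refine Finset.sum_eq_zero fun i _ => ?_
    have : φ i = 0 := DFunLike.ext _ _ fun j => by
      have h := DFunLike.congr_fun ht (c i j)
      rw [map_sum, AddMonoidHom.finsetSum_apply, Finset.sum_eq_single i] at h
      · simpa [hc] using h
      · intro k _ hk
        simp [hc, hk.symm]
      · simp
    rw [this, tmul_zero]
  · intro ψ
    let φ : Fin n → RightDual R J := fun i => AddMonoidHom.mk' (fun j => ψ (c i j)) fun a b => by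
      rw [← map_add]
      congr 1
      exact LinearMap.ext fun x => smul_add (x i) a b
    have hφ : ∀ i j, φ i j = ψ (c i j) := fun i j => rfl
    refine ⟨∑ i, tmul R (Pi.single i 1) (φ i), ?_⟩
    ext f
    rw [map_sum, AddMonoidHom.finsetSum_apply]
    simp only [toHomDual_tmul, hφ]
    rw [← map_sum]
    congr 1
    refine LinearMap.ext fun x => ?_
    have hx : x = ∑ i, x i • (Pi.single i 1 : Fin n → Rᵐᵒᵖ) := by
      ext i
      simp [Finset.sum_apply, Pi.single_apply]
    conv_rhs => rw [hx, map_sum]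
    simp only [LinearMap.sum_apply, hc, map_smul]

/-- Both sides are right exact in `A`, the right one because `ℚ/ℤ` is injective, and they agree on
finite free modules; a finite presentation gives the general case. -/
theorem toHomDual_bijective (hA : Module.FinitePresentation Rᵐᵒᵖ A) :
    Function.Bijective (toHomDual R A J) := by
  obtain ⟨n, K, e, hK⟩ := Module.FinitePresentation.exists_fin Rᵐᵒᵖ A
  obtain ⟨m, d, rfl⟩ := (Submodule.fg_iff_exists_fin_linearMap _ _).1 hK
  let p : (Fin n → Rᵐᵒᵖ) →ₗ[Rᵐᵒᵖ] A := e.symm.toLinearMap ∘ₗ (LinearMap.range d).mkQ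
  have hp : Function.Surjective p := e.symm.surjective.comp (Submodule.mkQ_surjective _)
  have hdp : Function.Exact d p := fun x => by simp [p]
  constructor
  · rw [injective_iff_map_eq_zero]
    intro t ht
    obtain ⟨t, rfl⟩ := rTensor_surjective p hp t
    let d' : ((Fin n → Rᵐᵒᵖ) →ₗ[Rᵐᵒᵖ] J) →+ ((Fin m → Rᵐᵒᵖ) →ₗ[Rᵐᵒᵖ] J) :=
      AddMonoidHom.mk' (fun f => f ∘ₗ d) fun f g => rfl
    -- The character defined by `t` kills the maps that factor through `A`, which form the kernel of
    -- `d'`. It therefore extends from the image of `d'` to a character `ψ`, which comes from a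
    -- tensor `s` with image `t`.
    obtain ⟨ψ, hψ⟩ := exists_character_extension (QuotientAddGroup.kerLift d')
      (QuotientAddGroup.kerLift_injective d')
      (QuotientAddGroup.lift d'.ker (toHomDual R (Fin n → Rᵐᵒᵖ) J t) fun f hf => by
        obtain ⟨g, rfl⟩ : ∃ g : A →ₗ[Rᵐᵒᵖ] J, g ∘ₗ p = f := by
          let f' := (LinearMap.range d).liftQ f (by
            rw [LinearMap.range_le_ker_iff]
            exact hf)
          refine ⟨f' ∘ₗ e.toLinearMap, LinearMap.ext fun x => ?_⟩
          simp [p, f']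
        exact (toHomDual_rTensor p t g).symm.trans (DFunLike.congr_fun ht g))
    obtain ⟨s, rfl⟩ := (toHomDual_pi_bijective m).2 ψ
    have hs : t = rTensor _ d s := (toHomDual_pi_bijective n).1 (by
      ext f
      rw [toHomDual_rTensor]
      exact (DFunLike.congr_fun hψ (f : _ ⧸ d'.ker)).symm)
    rw [hs]
    exact (rTensor_exact d p hdp hp).apply_apply_eq_zero s
  · intro ψ
    let p' : (A →ₗ[Rᵐᵒᵖ] J) →+ ((Fin n → Rᵐᵒᵖ) →ₗ[Rᵐᵒᵖ] J) :=
      AddMonoidHom.mk' (fun f => f ∘ₗ p) fun f g => rfl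
    obtain ⟨ψ', hψ'⟩ := exists_character_extension p' (fun f g e => LinearMap.ext fun a => by
      obtain ⟨x, rfl⟩ := hp a
      exact DFunLike.congr_fun e x) ψ
    obtain ⟨t, rfl⟩ := (toHomDual_pi_bijective n).2 ψ'
    refine ⟨rTensor _ p t, ?_⟩
    ext f
    rw [toHomDual_rTensor]
    exact DFunLike.congr_fun hψ' f

theorem exists_fg_rTensor {X : Type*} [AddCommGroup X] [Module R X] (I : Submodule Rᵐᵒᵖ A)
    (t : RTensor R I X) : ∃ (N : Submodule Rᵐᵒᵖ A) (hN : N ≤ I) (s : RTensor R N X), N.FG ∧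
      rTensor X (Submodule.inclusion hN) s = t := by
  have hle : ∀ {N N' : Submodule Rᵐᵒᵖ A} (h : N ≤ N') (h' : N' ≤ I) (s : RTensor R N X),
      rTensor X (Submodule.inclusion h') (rTensor X (Submodule.inclusion h) s) =
        rTensor X (Submodule.inclusion (h.trans h')) s := fun h h' s => by
    rw [rTensor_rTensor]
    rfl
  induction t using RTensor.induction_on with
  | zero => exact ⟨⊥, bot_le, 0, Submodule.fg_bot, map_zero _⟩
  | add s t hs ht =>
    obtain ⟨N, hN, s, hNf, rfl⟩ := hs
    obtain ⟨N', hN', t, hNf', rfl⟩ := ht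
    refine ⟨N ⊔ N', sup_le hN hN', rTensor X (Submodule.inclusion le_sup_left) s +
      rTensor X (Submodule.inclusion le_sup_right) t, hNf.sup hNf', ?_⟩
    rw [map_add, hle, hle]
  | tmul a x =>
    exact ⟨Submodule.span Rᵐᵒᵖ {a.1}, by simp, tmul R ⟨a.1, Submodule.mem_span_singleton_self _⟩ x,
      Submodule.fg_span_singleton _, rfl⟩

end RTensor

/-! ### Flatness of character modules over coherent rings -/

/-- A left module is flat if tensoring with it preserves inclusions of finitely generated right
ideals. -/
theorem isFlatLeft_of_fg {R : Type u} [Ring R] (X : ModuleCat.{u} R)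
    (h : ∀ I : Submodule Rᵐᵒᵖ R, I.FG → Function.Injective (RTensor.rTensor (R := R) X I.subtype)) :
    IsFlatLeft R X := by
  have hI : ∀ I : Submodule Rᵐᵒᵖ R, Function.Injective (RTensor.rTensor (R := R) X I.subtype) := by
    intro I
    rw [injective_iff_map_eq_zero]
    intro t ht
    obtain ⟨N, hN, s, hNf, rfl⟩ := RTensor.exists_fg_rTensor I t
    rw [RTensor.rTensor_rTensor] at ht
    have hs : s = 0 := h N hNf (ht.trans (map_zero _).symm)
    rw [hs, map_zero]
  refine (isFlatLeft_iff_injective_leftDual X).2 (Module.Baer.injective fun I g => ?_)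
  -- Baer's criterion for `X⁺` concerns ideals of `Rᵐᵒᵖ`, the hypothesis right ideals of `R`; `e`
  -- identifies the two.
  let e : R ≃ₗ[Rᵐᵒᵖ] Rᵐᵒᵖ :=
    { toFun := op
      invFun := unop
      left_inv := fun _ => rfl
      right_inv := fun _ => rfl
      map_add' := fun _ _ => rfl
      map_smul' := fun _ _ => rfl }
  let I' : Submodule Rᵐᵒᵖ R := Submodule.comap e.toLinearMap I
  let k : I' →ₗ[Rᵐᵒᵖ] I := LinearMap.codRestrict I (e.toLinearMap ∘ₗ I'.subtype) fun x => x.2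
  obtain ⟨f, hf⟩ := (RTensor.rTensor_injective_iff (R := R) (X := X) I'.subtype).1 (hI I')
    (g ∘ₗ k)
  exact ⟨f ∘ₗ e.symm.toLinearMap, fun x hx => hf ⟨unop x, hx⟩⟩

/-- Character modules of injective modules over a coherent ring are flat. -/
theorem isFlatLeft_rightDual_of_isRightCoherent {R : Type u} [Ring R] (hR : IsRightCoherent R)
    (J : ModuleCat.{u} Rᵐᵒᵖ) (hJ : Module.Injective Rᵐᵒᵖ J) :
    IsFlatLeft R (ModuleCat.of R (RightDual R J)) := by
  refine isFlatLeft_of_fg _ fun I hI => ?_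
  rw [injective_iff_map_eq_zero]
  intro t ht
  -- As `I` is finitely presented, an element of `I ⊗ J⁺` is determined by its character on `Hom(I,
  -- J)`, and every `f : I → J` extends to `R`.
  refine (RTensor.toHomDual_bijective (J := J) (hR I hI)).1 ?_
  rw [map_zero]
  ext f
  obtain ⟨g, hg⟩ := hJ.out I.subtype Subtype.val_injective f
  have hg : g ∘ₗ I.subtype = f := LinearMap.ext hg
  rw [← hg, ← RTensor.toHomDual_rTensor, AddMonoidHom.zero_apply]
  exact (DFunLike.congr_fun (congrArg (RTensor.toHomDual R R J) ht) g).trans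
    (DFunLike.congr_fun (map_zero (RTensor.toHomDual R R J)) g)

/-! ### Gorenstein flat modules and their character modules -/

section GorensteinFlat

variable {S : Type u} [Ring S]

/-- Schanuel's lemma for two presentations that factor through each other. -/
theorem IsShortExact.nonempty_equiv_of_presentations {K L K' L' N : Type*} [AddCommGroup K]
    [Module S K] [AddCommGroup L] [Module S L] [AddCommGroup K'] [Module S K'] [AddCommGroup L']
    [Module S L'] [AddCommGroup N] [Module S N] {i : K →ₗ[S] L} {p : L →ₗ[S] N}
    {i' : K' →ₗ[S] L'} {p' : L' →ₗ[S] N} (h : IsShortExact i p) (h' : IsShortExact i' p')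
    (s : L →ₗ[S] L') (hs : ∀ x, p' (s x) = p x) (t : L' →ₗ[S] L) (ht : ∀ x, p (t x) = p' x) :
    Nonempty ((K × L') ≃ₗ[S] (K' × L)) := by
  -- With the kernels regarded as submodules, the isomorphism is `(k, y) ↦ (y - s (k + t y), k + t
  -- y)`, and its inverse has the same shape.
  obtain ⟨a, ha⟩ := h'.exists_lift (LinearMap.snd S K L' - s ∘ₗ i.coprod t) (fun x => by
    simp [hs, ht, h.apply_apply])
  obtain ⟨b, hb⟩ := h.exists_lift (LinearMap.snd S K' L - t ∘ₗ i'.coprod s) (fun x => by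
    simp [hs, ht, h'.apply_apply])
  refine ⟨LinearEquiv.ofLinearMap (a.prod (i.coprod t)) (b.prod (i'.coprod s))
    (LinearMap.ext fun x => ?_) (LinearMap.ext fun x => ?_)⟩
  · have h₁ := hb x
    simp only [LinearMap.sub_apply, LinearMap.comp_apply, LinearMap.snd_apply,
      LinearMap.coprod_apply] at h₁
    have h₂ : i.coprod t (b.prod (i'.coprod s) x) = x.2 := by simp [h₁]
    refine Prod.ext (h'.inj ?_) h₂
    refine (ha _).trans ?_
    rw [LinearMap.sub_apply, LinearMap.comp_apply, h₂]
    simp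
  · have h₁ := ha x
    simp only [LinearMap.sub_apply, LinearMap.comp_apply, LinearMap.snd_apply,
      LinearMap.coprod_apply] at h₁
    have h₂ : i'.coprod s (a.prod (i.coprod t) x) = x.2 := by simp [h₁]
    refine Prod.ext (h.inj ?_) h₂
    refine (hb _).trans ?_
    rw [LinearMap.sub_apply, LinearMap.comp_apply, h₂]
    simp

/-- Schanuel's lemma for two copresentations that factor through each other. -/
theorem IsShortExact.nonempty_equiv_of_copresentations {A L L' N N' : Type*} [AddCommGroup A]
    [Module S A] [AddCommGroup L] [Module S L] [AddCommGroup L'] [Module S L'] [AddCommGroup N]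
    [Module S N] [AddCommGroup N'] [Module S N'] {i : A →ₗ[S] L} {p : L →ₗ[S] N}
    {i' : A →ₗ[S] L'} {p' : L' →ₗ[S] N'} (h : IsShortExact i p) (h' : IsShortExact i' p')
    (s : L →ₗ[S] L') (hs : ∀ x, s (i x) = i' x) (t : L' →ₗ[S] L) (ht : ∀ x, t (i' x) = i x) :
    Nonempty ((N × L') ≃ₗ[S] (N' × L)) := by
  obtain ⟨a, ha⟩ := h.exists_desc ((p' ∘ₗ s).prod (LinearMap.id - t ∘ₗ s)) (fun x => by
    simp [hs, ht, h'.apply_apply])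
  obtain ⟨b, hb⟩ := h'.exists_desc ((p ∘ₗ t).prod (LinearMap.id - s ∘ₗ t)) (fun x => by
    simp [hs, ht, h.apply_apply])
  have hF : ∀ x y, a.coprod (p'.prod (-t)) (p x, y) = (p' (s x + y), x - t (s x + y)) := by
    intro x y
    rw [LinearMap.coprod_apply, ha]
    exact Prod.ext (by simp) (by simp; abel)
  have hG : ∀ x y, b.coprod (p.prod (-s)) (p' x, y) = (p (t x + y), x - s (t x + y)) := by
    intro x y
    rw [LinearMap.coprod_apply, hb]
    exact Prod.ext (by simp) (by simp; abel)
  refine ⟨LinearEquiv.ofLinearMap (a.coprod (p'.prod (-t))) (b.coprod (p.prod (-s)))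
    (LinearMap.ext fun ⟨x, y⟩ => ?_) (LinearMap.ext fun ⟨x, y⟩ => ?_)⟩
  · obtain ⟨x, rfl⟩ := h'.surj x
    rw [LinearMap.comp_apply, hG, hF, add_sub_cancel, add_sub_cancel_left, LinearMap.id_apply]
  · obtain ⟨x, rfl⟩ := h.surj x
    rw [LinearMap.comp_apply, hF, hG, add_sub_cancel, add_sub_cancel_left, LinearMap.id_apply]

theorem injective_prod {A B : Type u} [AddCommGroup A] [Module S A] [AddCommGroup B] [Module S B]
    (hA : Module.Injective S A) (hB : Module.Injective S B) : Module.Injective S (A × B) := by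
  refine ⟨fun X Y _ _ _ _ i hi f => ?_⟩
  obtain ⟨g, hg⟩ := hA.out i hi (LinearMap.fst S A B ∘ₗ f)
  obtain ⟨g', hg'⟩ := hB.out i hi (LinearMap.snd S A B ∘ₗ f)
  exact ⟨g.prod g', fun x => Prod.ext (hg x) (hg' x)⟩

/-- The sum of a short exact sequence with an identity on the first terms. -/
theorem IsShortExact.prodMap_id {K L N : Type*} [AddCommGroup K] [Module S K] [AddCommGroup L]
    [Module S L] [AddCommGroup N] [Module S N] {i : K →ₗ[S] L} {p : L →ₗ[S] N}
    (h : IsShortExact i p) (I : Type*) [AddCommGroup I] [Module S I] :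
    IsShortExact (i.prodMap (LinearMap.id : I →ₗ[S] I)) (p ∘ₗ LinearMap.fst S L I) :=
  ⟨h.inj.prodMap Function.injective_id, fun x => by
    rw [LinearMap.comp_apply, LinearMap.fst_apply, h.exact x.1]
    constructor
    · rintro ⟨a, ha⟩
      exact ⟨(a, x.2), Prod.ext ha rfl⟩
    · rintro ⟨a, rfl⟩
      exact ⟨a.1, rfl⟩, h.surj.comp Prod.fst_surjective⟩

/-- The sum of a short exact sequence with an identity on the last terms. -/
theorem IsShortExact.inl_prodMap_id {K L N : Type*} [AddCommGroup K] [Module S K] [AddCommGroup L]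
    [Module S L] [AddCommGroup N] [Module S N] {i : K →ₗ[S] L} {p : L →ₗ[S] N}
    (h : IsShortExact i p) (I : Type*) [AddCommGroup I] [Module S I] :
    IsShortExact (LinearMap.inl S L I ∘ₗ i) (p.prodMap (LinearMap.id : I →ₗ[S] I)) :=
  ⟨LinearMap.inl_injective.comp h.inj, fun x => by
    rw [LinearMap.prodMap_apply, Prod.mk_eq_zero, h.exact x.1]
    constructor
    · rintro ⟨⟨a, ha⟩, hx⟩
      exact ⟨a, Prod.ext ha hx.symm⟩
    · rintro ⟨a, rfl⟩
      exact ⟨⟨a, rfl⟩, rfl⟩, h.surj.prodMap Function.surjective_id⟩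

/-- The direct sum of a Gorenstein injective and an injective module is Gorenstein injective. -/
theorem GorensteinInjective.prod_injective {A I : ModuleCat.{u} S} (hA : GorensteinInjective S A)
    (hI : Module.Injective S I) : GorensteinInjective S (ModuleCat.of S (A × I)) := by
  refine gorensteinInjective_of_class
    -- Only one new module is added to the class: a single step from it in either direction returns
    -- to a Gorenstein injective module.
    (fun W => GorensteinInjective S W ∨ W = ModuleCat.of S (A × I)) ?_ ?_ _ (Or.inr rfl)
  · rintro W (hW | rfl)
    · obtain ⟨W', hW', h⟩ := hW.exists_right
      exact ⟨W', Or.inl hW', h⟩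
    · obtain ⟨B, hB, L, i, p, hip, hL, hE⟩ := hA.exists_right
      refine ⟨B, Or.inl hB, ModuleCat.of S (L × I), _, _, hip.prodMap_id I,
        injective_prod hL hI, fun E hE' f => ?_⟩
      obtain ⟨g, hg⟩ := hE E hE' f
      exact ⟨g.prod 0, hg⟩
  · rintro W (hW | rfl)
    · obtain ⟨W', hW', h⟩ := hW.exists_left
      exact ⟨W', Or.inl hW', h⟩
    · obtain ⟨B, hB, L, i, p, hip, hL, hE⟩ := hA.exists_left
      refine ⟨B, Or.inl hB, ModuleCat.of S (L × I), _, _, hip.inl_prodMap_id I,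
        injective_prod hL hI, fun E hE' f => ?_⟩
      obtain ⟨g, hg⟩ := hE E hE' (LinearMap.fst S A I ∘ₗ f)
      exact ⟨g.prod (LinearMap.snd S A I ∘ₗ f), fun a => Prod.ext (hg a) rfl⟩

end GorensteinFlat

section GorensteinFlat

variable {S : Type u} [Ring S]

/-- If character modules of injective right modules are flat, then a left module with Gorenstein
injective character module is Gorenstein flat. -/
theorem gorensteinFlat_of_leftDual
    (hS : ∀ J : ModuleCat.{u} Sᵐᵒᵖ, Module.Injective Sᵐᵒᵖ J →
      IsFlatLeft S (ModuleCat.of S (RightDual S J)))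
    (X : ModuleCat.{u} S) (hX : GorensteinInjective Sᵐᵒᵖ (ModuleCat.of Sᵐᵒᵖ (LeftDual S X))) :
    GorensteinFlat S X := by
  -- The summand `I` is carried along because Schanuel's lemma controls the dual of the next module
  -- only up to injective summands.
  refine gorensteinFlat_of_class (fun X => ∃ I : ModuleCat.{u} Sᵐᵒᵖ, Module.Injective Sᵐᵒᵖ I ∧
    GorensteinInjective Sᵐᵒᵖ (ModuleCat.of Sᵐᵒᵖ (LeftDual S X × I))) ?_ ?_ X ?_
  · rintro X ⟨I, hI, hX⟩
    obtain ⟨Z, hZ, J, i, p, hip, hJ, hlift⟩ := hX.exists_left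
    let q : J →ₗ[Sᵐᵒᵖ] LeftDual S X × I := p
    -- The adjoint of the first component of `q`. It is injective because `q` is surjective and
    -- characters separate the points of `X`.
    let ι : X →ₗ[S] RightDual S J :=
      { toFun := fun x => AddMonoidHom.mk' (fun j => (q j).1 x) fun a b =>
          DFunLike.congr_fun (congrArg Prod.fst (map_add q a b)) x
        map_add' := fun x y => DFunLike.ext _ _ fun j => map_add (q j).1 x y
        map_smul' := fun r x => DFunLike.ext _ _ fun j =>
          (DFunLike.congr_fun (congrArg Prod.fst (q.map_smul (op r) j)) x).symm }
    have hι : ∀ x j, ι x j = (q j).1 x := fun _ _ => rfl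
    have hιinj : Function.Injective ι := by
      rw [injective_iff_map_eq_zero]
      intro x hx
      by_contra hne
      obtain ⟨φ, hφ⟩ := exists_character_ne_zero hne
      obtain ⟨j, hj⟩ := hip.surj ((show LeftDual S X from φ), (0 : I))
      have h₁ := hι x j
      rw [hx] at h₁
      exact hφ ((DFunLike.congr_fun (congrArg Prod.fst hj) x).symm.trans h₁.symm)
    let ev : J →ₗ[Sᵐᵒᵖ] LeftDual S (RightDual S J) :=
      { toFun := fun e => (AddMonoidHom.eval e : (J →+ AddCircle (1 : ℚ)) →+ AddCircle (1 : ℚ))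
        map_add' := fun a b => DFunLike.ext _ _ fun φ => map_add φ a b
        map_smul' := fun a b => rfl }
    have hev : ∀ j, LeftDual.map ι (ev j) = (q j).1 := fun _ => rfl
    have hs := isShortExact_range_mkQ ι hιinj
    have hflat := hS J hJ
    have hinj := (isFlatLeft_iff_injective_leftDual _).1 hflat
    refine ⟨ModuleCat.of S (RightDual S J ⧸ LinearMap.range ι), ⟨J, hJ, ?_⟩, _, ι, _, hs,
      hflat, fun E hE => ?_⟩
    -- Let `N` be the cokernel of `ι`. The surjections of `J⁺⁺ × I` and of `J` onto `X⁺ × I` factor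
    -- through each other, by the lift `t` and by evaluation; so `N⁺ × J ≅ Z × (J⁺⁺ × I)`.
    · obtain ⟨t, ht⟩ := hlift (ModuleCat.of Sᵐᵒᵖ (LeftDual S (RightDual S J) × I))
        (injective_prod hinj hI) ((LeftDual.map ι).prodMap LinearMap.id)
      obtain ⟨e⟩ := ((LeftDual.map_isShortExact hs).inl_prodMap_id I).nonempty_equiv_of_presentations
        (p' := q) hip t ht (ev.prod (LinearMap.snd Sᵐᵒᵖ _ _ ∘ₗ q)) (fun j => Prod.ext (hev j) rfl)
      exact (hZ.prod_injective (I := ModuleCat.of Sᵐᵒᵖ (LeftDual S (RightDual S J) × I))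
        (injective_prod hinj hI)).of_equiv e.symm
    · refine (RTensor.lTensor_injective_iff_of_left ι).2 fun f => ?_
      obtain ⟨g, hg⟩ := hlift E hE (f.prod 0)
      exact ⟨ev ∘ₗ g, fun a => (hev (g a)).trans (congrArg Prod.fst (hg a))⟩
  · rintro X ⟨I, hI, hX⟩
    obtain ⟨K, P, i, p, hip, hP⟩ := exists_projective_presentation S X
    have hflat := isFlatLeft_of_projective P hP
    have hinj := (isFlatLeft_iff_injective_leftDual P).1 hflat
    have hd := LeftDual.map_isShortExact hip
    obtain ⟨Z, hZ, L, j, q, hjq, hL, -⟩ := hX.exists_right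
    let j' : LeftDual S X × I →ₗ[Sᵐᵒᵖ] L := j
    have hjq' : IsShortExact j' q := hjq
    refine ⟨K, ⟨L, hL, ?_⟩, P, i, p, hip, hflat, fun E hE => ?_⟩
    -- Two embeddings of `X⁺ × I` in injective modules are compared, giving `K⁺ × L ≅ Z × (P⁺ × I)`.
    · have hd' := hd.prodMap_id I
      obtain ⟨s, hs⟩ := hL.out _ hd'.inj j'
      obtain ⟨t, ht⟩ := (injective_prod hinj hI).out j' hjq'.inj _
      obtain ⟨e⟩ := hd'.nonempty_equiv_of_copresentations hjq' s hs t ht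
      exact (hZ.prod_injective (I := ModuleCat.of Sᵐᵒᵖ (LeftDual S P × I))
        (injective_prod hinj hI)).of_equiv e.symm
    · refine (RTensor.lTensor_injective_iff_of_left i).2 fun f => ?_
      exact ((hX.extOneVanishes_of_injective hE).retract_right (LinearMap.inl Sᵐᵒᵖ _ _)
        (LinearMap.fst Sᵐᵒᵖ _ _) fun _ => rfl).exists_lift hd f
  · have h0 : Module.Injective Sᵐᵒᵖ PUnit.{u + 1} :=
      ⟨fun _ _ _ _ _ _ _ _ _ => ⟨0, fun _ => Subsingleton.elim _ _⟩⟩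
    exact ⟨ModuleCat.of Sᵐᵒᵖ PUnit, h0, hX.prod_injective (I := ModuleCat.of Sᵐᵒᵖ PUnit) h0⟩

end GorensteinFlat

/-! ### Gorenstein flat modules over the trivial extension -/

section GorensteinFlatExtension

variable {R : Type u} [Ring R] {M : Type u} [AddCommGroup M] [Module R M] [Module Rᵐᵒᵖ M]
  [SMulCommClass R Rᵐᵒᵖ M]

/-! ### Character modules of left and right extensions -/

theorem IsShortExact.comp_equiv_middle {S : Type*} [Ring S] {K L L' N : Type*} [AddCommGroup K]
    [Module S K] [AddCommGroup L] [Module S L] [AddCommGroup L'] [Module S L'] [AddCommGroup N]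
    [Module S N] {i : K →ₗ[S] L} {p : L →ₗ[S] N} (h : IsShortExact i p) (e : L' ≃ₗ[S] L) :
    IsShortExact (e.symm.toLinearMap ∘ₗ i) (p ∘ₗ e.toLinearMap) where
  inj := e.symm.injective.comp h.inj
  exact := fun x => (h.exact (e x)).trans
    ⟨fun ⟨k, hk⟩ => ⟨k, by simp [hk]⟩, fun ⟨k, hk⟩ => ⟨k, by simp [← hk]⟩⟩
  surj := h.surj.comp e.surjective

theorem RightDual.map_isShortExact {A B C : Type*} [AddCommGroup A] [Module Rᵐᵒᵖ A]
    [AddCommGroup B] [Module Rᵐᵒᵖ B] [AddCommGroup C] [Module Rᵐᵒᵖ C] {i : A →ₗ[Rᵐᵒᵖ] B}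
    {p : B →ₗ[Rᵐᵒᵖ] C} (h : IsShortExact i p) :
    IsShortExact (RightDual.map (R := R) p) (RightDual.map i) where
  inj := fun φ ψ e => DFunLike.ext _ _ fun z => by
    obtain ⟨y, rfl⟩ := h.surj z
    exact DFunLike.congr_fun e y
  exact := fun φ => by
    constructor
    · intro hφ
      let i' := i.toAddMonoidHom.toIntLinearMap
      let p' := p.toAddMonoidHom.toIntLinearMap
      have h' : IsShortExact i' p' := ⟨h.inj, h.exact, h.surj⟩
      obtain ⟨g, hg⟩ := h'.exists_desc (AddMonoidHom.toIntLinearMap φ)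
        (fun x => DFunLike.congr_fun hφ x)
      exact ⟨g.toAddMonoidHom, DFunLike.ext _ _ hg⟩
    · rintro ⟨ψ, rfl⟩
      exact DFunLike.ext _ _ fun x => (congrArg ψ (h.apply_apply x)).trans (map_zero ψ)
  surj := RightDual.map_surjective i h.inj

variable (R M) in
/-- The underlying module of the character module of a left `R ⋉ M`-module. -/
def underlyingLeftDualEquiv (X : ModuleCat.{u} (TrivSqZeroExt R M)) :
    underlyingRight R M (ModuleCat.of _ (LeftDual (TrivSqZeroExt R M) X)) ≃ₗ[Rᵐᵒᵖ]
      LeftDual R (underlyingLeft R M X) where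
  toFun φ := φ
  invFun φ := φ
  left_inv _ := rfl
  right_inv _ := rfl
  map_add' _ _ := rfl
  map_smul' _ _ := rfl

variable (R M) in
/-- The underlying module of the character module of a right `R ⋉ M`-module. -/
def underlyingRightDualEquiv (Y : ModuleCat.{u} (TrivSqZeroExt R M)ᵐᵒᵖ) :
    underlyingLeft R M (ModuleCat.of _ (RightDual (TrivSqZeroExt R M) Y)) ≃ₗ[R]
      RightDual R (underlyingRight R M Y) where
  toFun φ := φ
  invFun φ := φ
  left_inv _ := rfl
  right_inv _ := rfl
  map_add' _ _ := rfl
  map_smul' _ _ := rfl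

/-- The dual of `0 → M ⊗ C → X → C → 0`, with `(M ⊗ C)⁺` rewritten as `Hom(M, C⁺)`. -/
theorem IsLeftExtension.isRightExtension_leftDual {X : ModuleCat.{u} (TrivSqZeroExt R M)}
    {C : Type u} [AddCommGroup C] [Module R C] {j : RTensor R M C →ₗ[R] underlyingLeft R M X}
    {π : underlyingLeft R M X →ₗ[R] C} (h : IsLeftExtension X C j π) :
    IsRightExtension (ModuleCat.of _ (LeftDual (TrivSqZeroExt R M) X)) (LeftDual R C)
      ((underlyingLeftDualEquiv R M X).symm.toLinearMap ∘ₗ LeftDual.map π)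
      (((leftDualTensorEquiv R M C).toLinearMap ∘ₗ LeftDual.map j) ∘ₗ
        (underlyingLeftDualEquiv R M X).toLinearMap) where
  ses := ((LeftDual.map_isShortExact h.ses).comp_equiv_right
    (leftDualTensorEquiv R M C)).comp_equiv_middle (underlyingLeftDualEquiv R M X)
  structureMap_eq := fun φ m => (underlyingLeftDualEquiv R M X).injective
    (DFunLike.ext _ _ fun x => congrArg (underlyingLeftDualEquiv R M X φ) (h.structureMap_eq m x))

variable (R M) in
/-- The isomorphism `M ⊗ D⁺ ≃ Hom(M, D)⁺` for `M` finitely presented as a right module. -/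
noncomputable def tensorRightDualEquiv (hM : Module.FinitePresentation Rᵐᵒᵖ M) (D : Type u)
    [AddCommGroup D] [Module Rᵐᵒᵖ D] :
    RTensor R M (RightDual R D) ≃ₗ[R] RightDual R (RightHom R M D) :=
  let f : RTensor R M (RightDual R D) →ₗ[R] RightDual R (RightHom R M D) :=
    { toFun := fun t => (RTensor.toHomDual R M D t : (M →ₗ[Rᵐᵒᵖ] D) →+ AddCircle (1 : ℚ))
      map_add' := fun s t => map_add (RTensor.toHomDual R M D) s t
      map_smul' := fun r t => DFunLike.ext _ _ fun f => RTensor.toHomDual_rTensor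
        { toFun := fun m => r • m
          map_add' := smul_add r
          map_smul' := fun a m => smul_comm r a m } t f }
  LinearEquiv.ofBijective f (RTensor.toHomDual_bijective hM)

/-- Finite presentation of `M` enters to rewrite `Hom(M, C)⁺` as `M ⊗ C⁺`. -/
theorem IsRightExtension.isLeftExtension_rightDual (hM : Module.FinitePresentation Rᵐᵒᵖ M)
    {Y : ModuleCat.{u} (TrivSqZeroExt R M)ᵐᵒᵖ} {C : Type u} [AddCommGroup C]
    [Module Rᵐᵒᵖ C] {j : C →ₗ[Rᵐᵒᵖ] underlyingRight R M Y}
    {π : underlyingRight R M Y →ₗ[Rᵐᵒᵖ] RightHom R M C} (h : IsRightExtension Y C j π) :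
    IsLeftExtension (ModuleCat.of _ (RightDual (TrivSqZeroExt R M) Y)) (RightDual R C)
      ((underlyingRightDualEquiv R M Y).symm.toLinearMap ∘ₗ
        (RightDual.map π ∘ₗ (tensorRightDualEquiv R M hM C).toLinearMap))
      (RightDual.map j ∘ₗ (underlyingRightDualEquiv R M Y).toLinearMap) where
  ses := ((RightDual.map_isShortExact h.ses).comp_equiv_left
    (tensorRightDualEquiv R M hM C)).comp_equiv_middle (underlyingRightDualEquiv R M Y)
  structureMap_eq := fun m φ => (underlyingRightDualEquiv R M Y).injective
    (DFunLike.ext _ _ fun y => congrArg (underlyingRightDualEquiv R M Y φ) (h.structureMap_eq y m))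

/-- An extension of `Hom(M, C)` by an injective module `C` is coinduced, hence injective. -/
theorem IsRightExtension.injective {Y : ModuleCat.{u} (TrivSqZeroExt R M)ᵐᵒᵖ} {C : Type u}
    [AddCommGroup C] [Module Rᵐᵒᵖ C] {j : C →ₗ[Rᵐᵒᵖ] underlyingRight R M Y}
    {π : underlyingRight R M Y →ₗ[Rᵐᵒᵖ] RightHom R M C} (h : IsRightExtension Y C j π)
    (hC : Module.Injective Rᵐᵒᵖ C) : Module.Injective (TrivSqZeroExt R M)ᵐᵒᵖ Y := by
  obtain ⟨g, hg⟩ := hC.out j h.ses.inj LinearMap.id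
  simp only [LinearMap.id_apply] at hg
  have hi : ∀ y, restrictRight (coinducedLift g) y =
      (coinducedRightEquiv R M C).symm (g y, π y) := fun y => by
    rw [restrictRight_coinducedLift]
    congr 2
    refine DFunLike.ext _ _ fun m => ?_
    rw [RightHom.map_apply, h.structureMap_eq, hg]
  have hb : Function.Bijective (restrictRight (coinducedLift g)) := by
    refine ⟨(injective_iff_map_eq_zero _).2 fun y hy => ?_, fun x => ?_⟩
    · rw [hi, LinearEquiv.map_eq_zero_iff, Prod.mk_eq_zero] at hy
      obtain ⟨c, rfl⟩ := h.ses.exists_of_eq_zero hy.2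
      rw [← hg c, hy.1, map_zero]
    · obtain ⟨y, hy⟩ := h.ses.surj (coinducedRightEquiv R M C x).2
      refine ⟨y + j ((coinducedRightEquiv R M C x).1 - g y), ?_⟩
      rw [hi, LinearEquiv.symm_apply_eq, map_add, hg, map_add, h.ses.apply_apply, hy, add_zero,
        add_sub_cancel]
  let e := LinearEquiv.ofBijective (coinducedLift g) hb
  refine ⟨fun A B _ _ _ _ i hi f => ?_⟩
  obtain ⟨f', hf'⟩ := (injective_coinducedRight hC).out i hi (e.toLinearMap ∘ₗ f)
  exact ⟨e.symm.toLinearMap ∘ₗ f', fun a => by simp [hf']⟩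

/-- Dualising twice turns the right extension `J` with injective `D` into one with `D⁺⁺`, which is
injective because `D⁺` is flat over the coherent ring `R`. Hence `J⁺⁺` is injective and `J⁺` is
flat. -/
theorem isFlatLeft_rightDual_trivSqZeroExt (hM : Subsingleton (RTensor R M M))
    (hR : IsRightCoherent R) (hfp : Module.FinitePresentation Rᵐᵒᵖ M)
    (J : ModuleCat.{u} (TrivSqZeroExt R M)ᵐᵒᵖ)
    (hJ : Module.Injective (TrivSqZeroExt R M)ᵐᵒᵖ J) :
    IsFlatLeft (TrivSqZeroExt R M) (ModuleCat.of _ (RightDual (TrivSqZeroExt R M) J)) := by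
  obtain ⟨D, hD, j, π, h⟩ := exists_isRightExtension_of_injective hM J hJ
  exact (isFlatLeft_iff_injective_leftDual _).2
    ((h.isLeftExtension_rightDual hfp).isRightExtension_leftDual.injective
      ((isFlatLeft_iff_injective_leftDual _).1 (isFlatLeft_rightDual_of_isRightCoherent hR D hD)))

/-- The structure map of `X⁺` is the dual of that of `X` under `(M ⊗ X)⁺ ≅ Hom(M, X⁺)`, and a map
with surjective dual is injective. -/
theorem injective_leftStructureMap_of_leftDual (X : ModuleCat.{u} (TrivSqZeroExt R M))
    (h : Function.Surjective
      (rightStructureMap R M (ModuleCat.of _ (LeftDual (TrivSqZeroExt R M) X)))) :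
    Function.Injective (leftStructureMap R M X) := by
  refine (injective_iff_character_extension (leftStructureMap R M X).toAddMonoidHom).2 fun φ => ?_
  obtain ⟨ψ, hψ⟩ := h (RightHom.map M (underlyingLeftDualEquiv R M X).symm.toLinearMap
    (leftDualTensorEquiv R M (underlyingLeft R M X) φ))
  refine ⟨(underlyingLeftDualEquiv R M X ψ : underlyingLeft R M X →+ AddCircle (1 : ℚ)),
    RTensor.hom_ext fun m x => ?_⟩
  exact DFunLike.congr_fun
    (congrArg (underlyingLeftDualEquiv R M X) (DFunLike.congr_fun hψ m)) x

theorem isFlatLeft_tensor_of_projective (hfl : IsFlatLeft R (ModuleCat.of R M))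
    (P : ModuleCat.{u} R) (hP : Module.Projective R P) :
    IsFlatLeft R (ModuleCat.of R (RTensor R M P)) := by
  obtain ⟨s, r, hrs⟩ := exists_retract_finsupp P hP
  let e := tensorFinsuppEquiv R M P
  refine isFlatLeft_retract (isFlatLeft_finsupp (ι := P) _ hfl)
    (e.symm.toLinearMap ∘ₗ RTensor.lTensorLinear M s)
    (RTensor.lTensorLinear M r ∘ₗ e.toLinearMap) fun t => ?_
  rw [LinearMap.comp_apply, LinearMap.comp_apply, LinearEquiv.coe_coe, LinearEquiv.coe_coe,
    LinearEquiv.apply_symm_apply, RTensor.lTensorLinear_apply, RTensor.lTensorLinear_apply,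
    RTensor.lTensor_lTensor]
  exact RTensor.lTensor_eq_self _ hrs t

/-- Both directions pass to `X⁺`, use the result for Gorenstein injective modules, and return by
`gorensteinFlat_of_leftDual`, over `R` in one direction and over `R ⋉ M` in the other. Flatness of
`M` on the left makes `M ⊗ P` flat for projective `P`, which supplies the Tor condition. -/
theorem gorensteinFlat_iff_phiClass (hM : Subsingleton (RTensor R M M)) (hR : IsRightCoherent R)
    (hfl : IsFlatLeft R (ModuleCat.of R M)) (hfp : Module.FinitePresentation Rᵐᵒᵖ M) {k : ℕ}
    (hpd : HasResolutionLE (IsProj Rᵐᵒᵖ) k (ModuleCat.of Rᵐᵒᵖ M))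
    (X : ModuleCat.{u} (TrivSqZeroExt R M)) :
    GorensteinFlat (TrivSqZeroExt R M) X ↔ PhiClass M (GorensteinFlat R) X := by
  have hfd : HasResolutionLE (IsFlatLeft R) 0 (ModuleCat.of R M) :=
    ⟨_, hfl, ⟨LinearEquiv.refl R M⟩⟩
  have hTor : ∀ P : ModuleCat.{u} R, Module.Projective R P → TorAcyclic R M (RTensor R M P) :=
    fun P hP => .of_flat (isFlatLeft_tensor_of_projective hfl P hP)
  constructor
  · intro hX
    obtain ⟨h₁, h₂⟩ := gorensteinInjective_le_psiClass hM hTor hfd hpd _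
      hX.gorensteinInjective_leftDual
    have hinj := injective_leftStructureMap_of_leftDual X h₁
    refine ⟨hinj, ?_⟩
    obtain ⟨j, hj⟩ := exists_isLeftExtension hM X hinj
    obtain ⟨e⟩ := hj.isRightExtension_leftDual.nonempty_equiv_ker
    exact gorensteinFlat_of_leftDual (isFlatLeft_rightDual_of_isRightCoherent hR) _
      (h₂.of_equiv e.symm)
  · rintro ⟨hinj, hC⟩
    obtain ⟨j, hj⟩ := exists_isLeftExtension hM X hinj
    refine gorensteinFlat_of_leftDual (isFlatLeft_rightDual_trivSqZeroExt hM hR hfp) X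
      (psiClass_le_gorensteinInjective hM hfd hpd _ ?_)
    exact (psiClass_iff hM _ (fun X Y hX ⟨e⟩ => hX.of_equiv e) _).2
      ⟨ModuleCat.of Rᵐᵒᵖ _, hC.gorensteinInjective_leftDual, _, _, hj.isRightExtension_leftDual⟩

end GorensteinFlatExtension

/-! ### The three equalities of classes -/

theorem mainTheorem7 (R : Type u) [Ring R] (M : Type u) [AddCommGroup M] [Module R M]
    [Module Rᵐᵒᵖ M] [SMulCommClass R Rᵐᵒᵖ M] (hM : Subsingleton (RTensor R M M)) :
    ((∀ (P : Type u) [AddCommGroup P] [Module R P], Module.Projective R P →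
          ∀ n : ℕ, 1 ≤ n → Limits.IsZero (RTor R n M (RTensor R M P))) →
        projectiveDimension (ModuleCat.of R M) < ⊤ →
        FiniteFlatDimRight R M →
        GorensteinProjective (TrivSqZeroExt R M) = PhiClass M (GorensteinProjective R)) ∧
      ((∀ (P : Type u) [AddCommGroup P] [Module R P], Module.Projective R P →
          ∀ n : ℕ, 1 ≤ n → Limits.IsZero (RTor R n M (RTensor R M P))) →
        FiniteFlatDimLeft R M →
        projectiveDimension (ModuleCat.of Rᵐᵒᵖ M) < ⊤ →
        GorensteinInjective (TrivSqZeroExt R M)ᵐᵒᵖ = PsiClass M (GorensteinInjective Rᵐᵒᵖ)) ∧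
      (IsRightCoherent R →
        IsFlatLeft R (ModuleCat.of R M) →
        Module.FinitePresentation Rᵐᵒᵖ M →
        projectiveDimension (ModuleCat.of Rᵐᵒᵖ M) < ⊤ →
        GorensteinFlat (TrivSqZeroExt R M) = PhiClass M (GorensteinFlat R)) := by
  have hTor : (∀ (P : Type u) [AddCommGroup P] [Module R P], Module.Projective R P →
      ∀ n : ℕ, 1 ≤ n → Limits.IsZero (RTor R n M (RTensor R M P))) →
      ∀ P : ModuleCat.{u} R, Module.Projective R P → TorAcyclic R M (RTensor R M P) :=
    fun h P hP => torAcyclic_of_isZero_RTor (h P hP)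
  refine ⟨fun h hpd ⟨k, hfd⟩ => ?_, fun h ⟨k, hfd⟩ hpd => ?_, fun hR hfl hfp hpd => ?_⟩
  · obtain ⟨n, hpd⟩ := exists_hasResolutionLE_of_projectiveDimension _ hpd
    exact funext fun X => propext ⟨gorensteinProjective_le_phiClass hM (hTor h) hpd hfd X,
      phiClass_le_gorensteinProjective hM hpd hfd X⟩
  · obtain ⟨n, hpd⟩ := exists_hasResolutionLE_of_projectiveDimension _ hpd
    exact funext fun Y => propext ⟨gorensteinInjective_le_psiClass hM (hTor h) hfd hpd Y,
      psiClass_le_gorensteinInjective hM hfd hpd Y⟩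
  · obtain ⟨n, hpd⟩ := exists_hasResolutionLE_of_projectiveDimension _ hpd
    exact funext fun X => propext (gorensteinFlat_iff_phiClass hM hR hfl hfp hpd X)
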